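/- Let $\overline{X}$ be a compact smooth manifold of dimension $n+1$ with non-empty boundary $M=\partial\overline X$ and interior $X$, and let $\kappa>0$ and $1<p<\infty$. Let $g_+$ be a Riemannian metric on $X$ which is asymptotically hyperbolic with curvature $-\kappa^2$ (written AH$(-\kappa^2)$), that is: (a) $g_+$ is conformally compact of order $C^{3,\alpha}$ for some $\alpha\in(0,1)$: there is a smooth function $r\colon\overline X\to\mathbb R$ with $r>0$ on $X$, $r=0$ on $M$ and $dr\neq 0$ at every point of $M$, such that $r^2g_+$ extends to a Riemannian metric of class $C^{3,\alpha}$ on $\overline X$ (in particular $g_+$ is complete); (b) the sectional curvatures of $g_+$ tend to $-\kappa^2$ at the boundary $M$ (uniformly over the tangent $2$-planes at the points approaching $M$). For a bounded domain $\Omega\subset X$ with smooth boundary put $$\lambda_{1,p}(\Omega)=\inf_{0\ne f\in W^{1,p}_0(\Omega)}\frac{\int_\Omega|\nabla_{g_+}f|_{g_+}^p\,dv_{g_+}}{\int_\Omega|f|^p\,dv_{g_+}},$$ where $W^{1,p}_0(\Omega)$ is the completion of $C_c^\infty(\Omega)$ under the Sobolev norm $\big(\int_\Omega|f|^p+|\nabla_{g_+}f|_{g_+}^p\,dv_{g_+}\big)^{1/p}$,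 and let $$\lambda_{1,p}(X)=\inf_\Omega\lambda_{1,p}(\Omega),$$ the infimum being over all bounded domains $\Omega\subset X$ with smooth boundary. Then $$\lambda_{1,p}(X)\le\left(\frac{n\kappa}{p}\right)^p .$$ -/

import Mathlib

open Set Filter MeasureTheory
open scoped Manifold ContDiff ENNReal NNReal Topology

set_option maxSynthPendingDepth 3

noncomputable section

namespace AsympHyp

/-- The model vector space `ℝ^{n+1}` of an `(n+1)`-dimensional manifold with boundary. -/
abbrev Model (n : ℕ) : Type := EuclideanSpace ℝ (Fin (n + 1))

/-- A field of bilinear forms on the tangent spaces of `X`. A metric on the interior of `X` is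
given by such a field; its values at boundary points are irrelevant and never used. -/
abbrev FormField (n : ℕ) (X : Type*) [TopologicalSpace X]
    [ChartedSpace (EuclideanHalfSpace (n + 1)) X] : Type _ :=
  ∀ x : X, TangentSpace (𝓡∂ (n + 1)) x →L[ℝ] TangentSpace (𝓡∂ (n + 1)) x →L[ℝ] ℝ

section Coordinates

variable {n : ℕ} {X : Type*} [TopologicalSpace X] [ChartedSpace (EuclideanHalfSpace (n + 1)) X]

/-- The expression of `g` in the coordinates of the chart at `x₀`: the pullback of `g` under the
inverse of that chart. -/
def coordForm (g : FormField n X) (x₀ : X) (y : Model n) : Model n →L[ℝ] Model n →L[ℝ] ℝ :=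
  let A := mfderivWithin 𝓘(ℝ, Model n) (𝓡∂ (n + 1)) (extChartAt (𝓡∂ (n + 1)) x₀).symm
    (range (𝓡∂ (n + 1))) y
  (ContinuousLinearMap.precomp ℝ A).comp ((g ((extChartAt (𝓡∂ (n + 1)) x₀).symm y)).comp A)

end Coordinates

section Curvature

variable {E : Type*} [NormedAddCommGroup E] [NormedSpace ℝ E]

/-- The Christoffel vector `Γ(u, v) = Γ^k_{ij} u^i v^j ∂_k` of a metric `G` given in coordinates,
characterized by `G(Γ(u, v), w) = (∂_u G(v, w) + ∂_v G(u, w) - ∂_w G(u, v)) / 2`. -/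
def christoffel (G : E → E →L[ℝ] E →L[ℝ] ℝ) (y u v : E) : E :=
  (G y).inverse ((1 / 2 : ℝ) •
    (fderiv ℝ G y u v + fderiv ℝ G y v u - ((fderiv ℝ G y).flip u).flip v))

/-- The value `Rm(u, v, v, u) = G(R(u, v)v, u)` of the Riemann tensor of a metric `G` given in
coordinates, from the coordinate formula
`R_{ijkl} = (∂_j∂_k G_{il} + ∂_i∂_l G_{jk} - ∂_i∂_k G_{jl} - ∂_j∂_l G_{ik}) / 2`
`+ G_{ab} (Γ^a_{jk} Γ^b_{il} - Γ^a_{ik} Γ^b_{jl})`, in which `K = R_{ijij} / (G_{ii} G_{jj} - G_{ij}^2)`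
is the sectional curvature. -/
def riemannBiquadratic (G : E → E →L[ℝ] E →L[ℝ] ℝ) (y u v : E) : ℝ :=
  fderiv ℝ (fderiv ℝ G) y u v u v
    - (1 / 2) * fderiv ℝ (fderiv ℝ G) y u u v v
    - (1 / 2) * fderiv ℝ (fderiv ℝ G) y v v u u
    + G y (christoffel G y u v) (christoffel G y u v)
    - G y (christoffel G y u u) (christoffel G y v v)

/-- The sectional curvature at `y` of the plane spanned by `u` and `v`. -/
def sectionalCurvature (G : E → E →L[ℝ] E →L[ℝ] ℝ) (y u v : E) : ℝ :=
  riemannBiquadratic G y u v / (G y u u * G y v v - (G y u v) ^ 2)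

end Curvature

section Metrics

variable {n : ℕ} {X : Type*} [TopologicalSpace X] [ChartedSpace (EuclideanHalfSpace (n + 1)) X]

/-- A (smooth) defining function for the boundary of `X`. -/
structure IsDefiningFunction (n : ℕ) {X : Type*} [TopologicalSpace X]
    [ChartedSpace (EuclideanHalfSpace (n + 1)) X] (r : X → ℝ) : Prop where
  smooth : ContMDiff (𝓡∂ (n + 1)) 𝓘(ℝ) ∞ r
  pos : ∀ x ∈ (𝓡∂ (n + 1)).interior X, 0 < r x
  zero : ∀ x ∈ (𝓡∂ (n + 1)).boundary X, r x = 0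
  diff_ne_zero : ∀ x ∈ (𝓡∂ (n + 1)).boundary X, mvfderiv (𝓡∂ (n + 1)) r x ≠ 0

/-- The third derivatives of the components of `h` in coordinates are locally Hölder continuous
with exponent `α`, up to the boundary. -/
def ThirdDerivHolder (h : FormField n X) (α : ℝ≥0) : Prop :=
  ∀ x₀ : X, ∃ s ∈ 𝓝[range (𝓡∂ (n + 1))] (extChartAt (𝓡∂ (n + 1)) x₀ x₀), ∃ C : ℝ≥0,
    HolderOnWith C α (iteratedFDerivWithin ℝ 3 (coordForm h x₀) (range (𝓡∂ (n + 1)))) s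

/-- `g` is a conformally compact metric (of order `C^{3,α}` for some `α ∈ (0, 1)`) on the interior
of `X`: for some defining function `r`, the tensor `r² g` extends to a Riemannian metric of class
`C^{3,α}` on all of `X`. -/
def IsConformallyCompact [IsManifold (𝓡∂ (n + 1)) ∞ X] (g : FormField n X) : Prop :=
  ∃ (r : X → ℝ) (α : ℝ≥0)
    (gbar : Bundle.ContMDiffRiemannianMetric (𝓡∂ (n + 1)) 3 (Model n)
      (fun x : X => TangentSpace (𝓡∂ (n + 1)) x)),
    IsDefiningFunction n r ∧ 0 < α ∧ α < 1 ∧ ThirdDerivHolder gbar.inner α ∧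
    ∀ x ∈ (𝓡∂ (n + 1)).interior X, gbar.inner x = r x ^ 2 • g x

/-- The interior of `X` with the metric `g` is asymptotically hyperbolic `AH(-κ²)`: `g` is
conformally compact and its sectional curvatures tend to `-κ²` at the boundary, that is, near every
boundary point all sectional curvatures at interior points are as close to `-κ²` as one likes. The
curvatures near the boundary point `x₀` are computed in the chart at `x₀`. -/
structure IsAH [IsManifold (𝓡∂ (n + 1)) ∞ X] (g : FormField n X) (κ : ℝ) : Prop where
  conformallyCompact : IsConformallyCompact g
  curvature : ∀ x₀ ∈ (𝓡∂ (n + 1)).boundary X, ∀ ε > 0,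
    ∀ᶠ y in 𝓝[interior (range (𝓡∂ (n + 1)))] (extChartAt (𝓡∂ (n + 1)) x₀ x₀),
      ∀ u v : Model n, LinearIndependent ℝ ![u, v] →
        |sectionalCurvature (coordForm g x₀) y u v - (-κ ^ 2)| < ε

end Metrics

section Eigenvalue

variable {n : ℕ} {X : Type*} [TopologicalSpace X] [ChartedSpace (EuclideanHalfSpace (n + 1)) X]

/-- The volume density `√(det G_{ij})` of `g` in the coordinates of the chart at `x₀`. -/
def volumeDensity (g : FormField n X) (x₀ : X) (y : Model n) : ℝ :=
  √(Matrix.of fun i j : Fin (n + 1) =>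
    coordForm g x₀ y (EuclideanSpace.single i 1) (EuclideanSpace.single j 1)).det

/-- The Riemannian measure of `g` on the interior part of the domain of the chart at `x₀`, extended
by zero to `X`: the image of `√(det G_{ij}) dy` under the inverse of the chart. -/
def chartVolume [MeasurableSpace X] (g : FormField n X) (x₀ : X) : Measure X :=
  Measure.map (extChartAt (𝓡∂ (n + 1)) x₀).symm
    ((volume.restrict ((extChartAt (𝓡∂ (n + 1)) x₀).target ∩
        interior (range (𝓡∂ (n + 1))))).withDensity
      fun y => ENNReal.ofReal (volumeDensity g x₀ y))

/-- The Riemannian measure `dv_g` on the interior of `X` (extended by zero to `X`). The measures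
`chartVolume g x₀` are its restrictions to the chart domains, so it is their supremum. -/
def riemannianVolume [MeasurableSpace X] (g : FormField n X) : Measure X :=
  ⨆ x₀ : X, chartVolume g x₀

/-- The gradient of `f` with respect to `g`: `g(∇f, w) = df(w)`. -/
def grad (g : FormField n X) (f : X → ℝ) (x : X) : TangentSpace (𝓡∂ (n + 1)) x :=
  (g x).inverse (mvfderiv (𝓡∂ (n + 1)) f x)

/-- The length of a tangent vector with respect to `g`. -/
def formNorm (g : FormField n X) (x : X) (v : TangentSpace (𝓡∂ (n + 1)) x) : ℝ :=
  √(g x v v)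

/-- The space `C_c^∞(Ω)`, for an open subset `Ω` of the interior of `X`. -/
def IsTestFunction (n : ℕ) {X : Type*} [TopologicalSpace X]
    [ChartedSpace (EuclideanHalfSpace (n + 1)) X] (Ω : Set X) (u : X → ℝ) : Prop :=
  ContMDiff (𝓡∂ (n + 1)) 𝓘(ℝ) ∞ u ∧ HasCompactSupport u ∧ tsupport u ⊆ Ω

/-- The function `f` belongs to `W^{1,p}_0(Ω)` and has the (weak) gradient `V`: the pair `(f, V)` is
the limit in `L^p(Ω)` of pairs `(u_k, ∇u_k)` with `u_k ∈ C_c^∞(Ω)`. In other words, `f` is a point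
of the completion of `C_c^∞(Ω)` for the norm `(‖u‖_p^p + ‖∇u‖_p^p)^{1/p}`. -/
structure MemSobolevZero [IsManifold (𝓡∂ (n + 1)) ∞ X] [MeasurableSpace X] (g : FormField n X)
    (p : ℝ) (Ω : Set X) (f : X → ℝ) (V : ∀ x : X, TangentSpace (𝓡∂ (n + 1)) x) : Prop where
  measurable_fun : Measurable f
  measurable_grad : @Measurable X (TangentBundle (𝓡∂ (n + 1)) X) _ (borel _) fun x => ⟨x, V x⟩
  approx : ∃ u : ℕ → X → ℝ, (∀ k, IsTestFunction n Ω (u k)) ∧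
    Tendsto (fun k => ∫⁻ x in Ω, ENNReal.ofReal (|u k x - f x| ^ p) ∂(riemannianVolume g))
      atTop (𝓝 0) ∧
    Tendsto (fun k => ∫⁻ x in Ω, ENNReal.ofReal (formNorm g x (grad g (u k) x - V x) ^ p)
      ∂(riemannianVolume g)) atTop (𝓝 0)

/-- The first `p`-Dirichlet eigenvalue of `Ω`: the infimum of the Rayleigh quotients
`∫_Ω |∇f|^p dv / ∫_Ω |f|^p dv` over `0 ≠ f ∈ W^{1,p}_0(Ω)`. -/
def firstEigenvalueOn [IsManifold (𝓡∂ (n + 1)) ∞ X] [MeasurableSpace X] (g : FormField n X)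
    (p : ℝ) (Ω : Set X) : ℝ≥0∞ :=
  ⨅ (f : X → ℝ) (V : ∀ x : X, TangentSpace (𝓡∂ (n + 1)) x) (_ : MemSobolevZero g p Ω f V)
    (_ : ¬ f =ᵐ[(riemannianVolume g).restrict Ω] 0),
    (∫⁻ x in Ω, ENNReal.ofReal (formNorm g x (V x) ^ p) ∂(riemannianVolume g)) /
      (∫⁻ x in Ω, ENNReal.ofReal (|f x| ^ p) ∂(riemannianVolume g))

/-- A bounded domain with smooth boundary in the interior of `X`: a nonempty connected open set
which is relatively compact in the interior of `X` and which lies, near each of its boundary points,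
on one side of a smooth hypersurface. For a complete metric on the interior of `X`, such as a
conformally compact one, the relatively compact sets are the bounded ones. -/
structure IsBoundedSmoothDomain (n : ℕ) {X : Type*} [TopologicalSpace X]
    [ChartedSpace (EuclideanHalfSpace (n + 1)) X] (Ω : Set X) : Prop where
  isOpen : IsOpen Ω
  isConnected : IsConnected Ω
  isCompact_closure : IsCompact (closure Ω)
  closure_subset : closure Ω ⊆ (𝓡∂ (n + 1)).interior X
  smooth_boundary : ∀ x ∈ frontier Ω, ∃ (U : Set X) (ρ : X → ℝ), IsOpen U ∧ x ∈ U ∧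
    ContMDiffOn (𝓡∂ (n + 1)) 𝓘(ℝ) ∞ ρ U ∧ mvfderiv (𝓡∂ (n + 1)) ρ x ≠ 0 ∧
    ∀ y ∈ U, y ∈ Ω ↔ ρ y < 0

/-- The first `p`-Dirichlet eigenvalue `λ_{1,p}` of the interior of `X` with the metric `g`: the
infimum of `λ_{1,p}(Ω)` over the bounded domains `Ω` with smooth boundary. -/
def firstEigenvalue [IsManifold (𝓡∂ (n + 1)) ∞ X] [MeasurableSpace X] (g : FormField n X)
    (p : ℝ) : ℝ≥0∞ :=
  ⨅ (Ω : Set X) (_ : IsBoundedSmoothDomain n Ω), firstEigenvalueOn g p Ω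

end Eigenvalue

end AsympHyp

end

/-!
Near a boundary point the metric is asymptotically that of hyperbolic space, and the bound is
obtained from the test functions that show that the first `p`-eigenvalue of hyperbolic space of
curvature `-κ²` is at most `(nκ/p)^p`. All of them live in a single chart at a boundary point.

Write `g = r⁻² h` with `h` a metric up to the boundary. A computation of the leading terms shows
that the sectional curvatures of `g` tend to `-|dr|²_h` at the boundary
(`tendsto_riemannBiquadratic_conformal`), so `|dr|_h = κ` there (`fderivWithin_sq_le_of_curvature`;
this needs `n ≠ 0`, so that there are planes). In the chart at a boundary point, `r` is to first
order a multiple of the coordinate `y₀`. Hence on a small half ball the length of `d(log y₀)` with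
respect to `g` is at most `k`, with `k` as close to `κ` as desired, while `g` is comparable to the
hyperbolic metric `|dy|²/y₀²` and its volume to `y₀⁻⁽ⁿ⁺¹⁾ dy` (`exists_halfBallBounds`). For
`n = 0` only some bound `k` is needed, as it enters multiplied by `n`.

The test function is `y₀ ^ (n/p)` times a cutoff in `log y₀`, at scale `L` around `-3L`, and a
fixed cutoff in `y` (`testFun`). Its gradient has length at most `(n/p) k` times the function, up
to an error `η y₀ ^ (n/p)` where `η → 0` as `L → ∞` (`abs_fderiv_testFun_le`). As the `p`-th power
of `y₀ ^ (n/p)` times the volume is comparable to `y₀⁻¹ dy`, the `p`-th powers of the norms of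
`y₀ ^ (n/p)` on the support of the test function and of the test function itself are both
comparable to `L`, and by Minkowski's inequality the Rayleigh quotient is at most
`((n/p) k + η M)^p` with `M` independent of `L` (`lintegral_gradBound_le`).

The domain has to be smooth: it is an ellipsoid in the coordinates `(log y₀, y')`, which contains
the support of the test function and, for large `L`, is contained in the half ball
(`isBoundedSmoothDomain_logEllipsoid`). To transfer the integrals to the manifold, the Riemannian
measure, a supremum of measures given in charts, is identified on a chart domain by the change of
variables formula (`restrict_riemannianVolume`). The eigenvalue, an infimum, is
therefore at most `(nκ/p + ε)^p` for every `ε > 0` (`firstEigenvalue_le_add`).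
-/

namespace AsympHyp

/-! ### Positive definite bilinear forms -/

theorem isInvertible_of_injective_bilin {E : Type*} [NormedAddCommGroup E] [NormedSpace ℝ E]
    [FiniteDimensional ℝ E] {B : E →L[ℝ] E →L[ℝ] ℝ} (hB : Function.Injective B) :
    B.IsInvertible := by
  have hd : Module.finrank ℝ E = Module.finrank ℝ (E →L[ℝ] ℝ) := by
    rw [← (LinearMap.toContinuousLinearMap (𝕜 := ℝ) (E := E) (F' := ℝ)).finrank_eq]
    exact Subspace.dual_finrank_eq.symm
  refine ⟨(LinearEquiv.ofInjectiveOfFinrankEq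
    (B : E →ₗ[ℝ] E →L[ℝ] ℝ) hB hd).toContinuousLinearEquiv, ?_⟩
  ext v w
  rfl

/-- A positive definite form identifies a finite-dimensional space with its dual. -/
theorem isInvertible_of_pos {E : Type*} [NormedAddCommGroup E] [NormedSpace ℝ E]
    [FiniteDimensional ℝ E] {B : E →L[ℝ] E →L[ℝ] ℝ} (hB : ∀ v, v ≠ 0 → 0 < B v v) :
    B.IsInvertible := by
  refine isInvertible_of_injective_bilin ((injective_iff_map_eq_zero B).2 fun v hv => ?_)
  by_contra hne
  have := hB v hne
  rw [hv] at this
  simp at this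

/-! ### Tangent vectors and gradients in boundary charts -/

section ChartCoordinates

variable {n : ℕ} {X : Type*} [TopologicalSpace X] [ChartedSpace (EuclideanHalfSpace (n + 1)) X]

theorem range_model (n : ℕ) : range (𝓡∂ (n + 1)) = {y : Model n | 0 ≤ y 0} :=
  range_modelWithCornersEuclideanHalfSpace (n + 1)

theorem interior_range_model (n : ℕ) :
    interior (range (𝓡∂ (n + 1))) = {y : Model n | 0 < y 0} :=
  interior_range_modelWithCornersEuclideanHalfSpace (n + 1)

/-- The differential of the inverse chart at `x₀`, from coordinate vectors to tangent vectors. -/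
noncomputable def coordFrame (x₀ : X) (y : Model n) :
    Model n →L[ℝ] TangentSpace (𝓡∂ (n + 1)) ((extChartAt (𝓡∂ (n + 1)) x₀).symm y) :=
  mfderivWithin 𝓘(ℝ, Model n) (𝓡∂ (n + 1)) (extChartAt (𝓡∂ (n + 1)) x₀).symm
    (range (𝓡∂ (n + 1))) y

theorem coordForm_apply (g : FormField n X) (x₀ : X) (y v w : Model n) :
    coordForm g x₀ y v w =
      g ((extChartAt (𝓡∂ (n + 1)) x₀).symm y) (coordFrame x₀ y v) (coordFrame x₀ y w) := rfl

variable [IsManifold (𝓡∂ (n + 1)) ∞ X]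

theorem coordFrame_bijective (x₀ : X) {y : Model n}
    (hy : y ∈ (extChartAt (𝓡∂ (n + 1)) x₀).target) : Function.Bijective (coordFrame x₀ y) :=
  (isInvertible_mfderivWithin_extChartAt_symm hy).bijective

theorem coordFrame_eq_tangentCoordChange (x₀ : X) {y : Model n}
    (hy : y ∈ (extChartAt (𝓡∂ (n + 1)) x₀).target) (v : Model n) :
    coordFrame x₀ y v = tangentCoordChange (𝓡∂ (n + 1)) x₀ ((extChartAt (𝓡∂ (n + 1)) x₀).symm y)
      ((extChartAt (𝓡∂ (n + 1)) x₀).symm y) v := by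
  have hx : (extChartAt (𝓡∂ (n + 1)) x₀).symm y ∈
      (chartAt (EuclideanHalfSpace (n + 1)) x₀).source := by
    simpa using (extChartAt (𝓡∂ (n + 1)) x₀).map_target hy
  have h1 := TangentBundle.symmL_trivializationAt (I := 𝓡∂ (n + 1)) hx
  have h2 := TangentBundle.symmL_trivializationAt_eq_core (I := 𝓡∂ (n + 1)) hx
  rw [(extChartAt (𝓡∂ (n + 1)) x₀).right_inv hy] at h1
  exact congrArg (fun L : Model n →L[ℝ] Model n => L v) (h1.symm.trans h2)

theorem mem_interior_iff_coord (x₀ : X) {y : Model n}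
    (hy : y ∈ (extChartAt (𝓡∂ (n + 1)) x₀).target) :
    (extChartAt (𝓡∂ (n + 1)) x₀).symm y ∈ (𝓡∂ (n + 1)).interior X ↔ 0 < y 0 := by
  have hx : (extChartAt (𝓡∂ (n + 1)) x₀).symm y ∈
      (chartAt (EuclideanHalfSpace (n + 1)) x₀).source := by
    simpa using (extChartAt (𝓡∂ (n + 1)) x₀).map_target hy
  have h := ModelWithCorners.isInteriorPoint_iff_of_mem_atlas (I := 𝓡∂ (n + 1)) (n := ∞) (M := X)
    (by decide) (chart_mem_atlas (EuclideanHalfSpace (n + 1)) x₀) hx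
  have h2 : (chartAt (EuclideanHalfSpace (n + 1)) x₀).extend (𝓡∂ (n + 1))
    ((extChartAt (𝓡∂ (n + 1)) x₀).symm y) = y := (extChartAt (𝓡∂ (n + 1)) x₀).right_inv hy
  rw [h2] at h
  refine h.trans ⟨fun hy' => ?_, fun hy' => ?_⟩
  · have := interior_mono (extChartAt_target_subset_range (I := 𝓡∂ (n + 1)) x₀) hy'
    rwa [interior_range_model] at this
  · have h3 := (chartAt (EuclideanHalfSpace (n + 1)) x₀).mem_interior_extend_target
      (I := 𝓡∂ (n + 1)) ((chartAt (EuclideanHalfSpace (n + 1)) x₀).map_source hx)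
    have h4 : (𝓡∂ (n + 1)) (chartAt (EuclideanHalfSpace (n + 1)) x₀
      ((extChartAt (𝓡∂ (n + 1)) x₀).symm y)) = y := h2
    rw [h4, interior_range_model] at h3
    exact h3 hy'

theorem mem_boundary_iff_coord (x₀ : X) {y : Model n}
    (hy : y ∈ (extChartAt (𝓡∂ (n + 1)) x₀).target) :
    (extChartAt (𝓡∂ (n + 1)) x₀).symm y ∈ (𝓡∂ (n + 1)).boundary X ↔ y 0 = 0 := by
  rw [← ModelWithCorners.compl_interior, mem_compl_iff, mem_interior_iff_coord x₀ hy, not_lt]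
  have : y ∈ range (𝓡∂ (n + 1)) := extChartAt_target_subset_range x₀ hy
  rw [range_model] at this
  exact ⟨fun h => le_antisymm h this, fun h => h.le⟩

/-- The coordinate expression of a section of class `C^3` of the bundle of bilinear forms is of
class `C^3` up to the boundary. -/
theorem contDiffOn_coordForm {h : FormField n X}
    (hh : ContMDiff (𝓡∂ (n + 1)) ((𝓡∂ (n + 1)).prod 𝓘(ℝ, Model n →L[ℝ] Model n →L[ℝ] ℝ)) 3
      (fun x : X => Bundle.TotalSpace.mk' (Model n →L[ℝ] Model n →L[ℝ] ℝ)
        (E := fun x : X => TangentSpace (𝓡∂ (n + 1)) x →L[ℝ] TangentSpace (𝓡∂ (n + 1)) x →L[ℝ] ℝ)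
        x (h x)))
    (x₀ : X) : ContDiffOn ℝ 3 (coordForm h x₀) (extChartAt (𝓡∂ (n + 1)) x₀).target := by
  let t := trivializationAt (Model n) (TangentSpace (𝓡∂ (n + 1)) : X → Type _) x₀
  have key : ∀ v w : Model n, ContMDiffOn (𝓡∂ (n + 1)) 𝓘(ℝ, ℝ) 3
      (fun x : X => h x (t.symmL ℝ x v) (t.symmL ℝ x w)) t.baseSet := by
    intro v w
    have hv : ∀ v : Model n, ContMDiffOn (𝓡∂ (n + 1)) ((𝓡∂ (n + 1)).prod 𝓘(ℝ, Model n)) 3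
      (fun x : X => Bundle.TotalSpace.mk' (Model n)
        (E := (TangentSpace (𝓡∂ (n + 1)) : X → Type _)) x (t.symmL ℝ x v)) t.baseSet := by
      intro v
      have h1 := t.contMDiffOn_symm (IB := 𝓡∂ (n + 1)) (n := 3)
      have h2 : ContMDiffOn (𝓡∂ (n + 1)) ((𝓡∂ (n + 1)).prod 𝓘(ℝ, Model n)) 3
          (fun x : X => (x, v)) t.baseSet := (contMDiff_id.prodMk contMDiff_const).contMDiffOn
      refine (h1.comp h2 ?_).congr ?_
      · intro x hx; simpa [t.target_eq] using hx
      · intro x hx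
        rw [t.symmL_apply hx]
        exact (t.mk_symm hx v)
    have := (hh.contMDiffOn (s := t.baseSet)).clm_bundle_apply₂ (F₃ := ℝ)
      (E₃ := Bundle.Trivial X ℝ) (hv v) (hv w)
    intro x hx
    exact (Bundle.contMDiffWithinAt_totalSpace.1 (this x hx)).2
  refine contDiffOn_clm_apply.2 fun v => contDiffOn_clm_apply.2 fun w => ?_
  rw [← contMDiffOn_iff_contDiffOn]
  refine ((key v w).comp (contMDiffOn_extChartAt_symm x₀) ?_).congr ?_
  · intro y hy
    simpa [t] using (extChartAt (𝓡∂ (n + 1)) x₀).map_target hy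
  · intro y hy
    have hx : (extChartAt (𝓡∂ (n + 1)) x₀).symm y ∈
        (chartAt (EuclideanHalfSpace (n + 1)) x₀).source := by
      simpa using (extChartAt (𝓡∂ (n + 1)) x₀).map_target hy
    have h1 := TangentBundle.symmL_trivializationAt (I := 𝓡∂ (n + 1)) hx
    rw [(extChartAt (𝓡∂ (n + 1)) x₀).right_inv hy] at h1
    have h2 : ∀ v : Model n, coordFrame x₀ y v =
      t.symmL ℝ ((extChartAt (𝓡∂ (n + 1)) x₀).symm y) v :=
      fun v => congrArg (fun L : Model n →L[ℝ] Model n => L v) h1.symm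
    rw [coordForm_apply, h2, h2]
    rfl

/-- The interior points of the target of the chart at `x₀`. -/
def interiorTarget (n : ℕ) {X : Type*} [TopologicalSpace X]
    [ChartedSpace (EuclideanHalfSpace (n + 1)) X] (x₀ : X) : Set (Model n) :=
  (extChartAt (𝓡∂ (n + 1)) x₀).target ∩ {y | 0 < y 0}

omit [IsManifold (𝓡∂ (n + 1)) ∞ X] in
theorem isOpen_interiorTarget (x₀ : X) : IsOpen (interiorTarget n x₀) := by
  have : interiorTarget n x₀ = (𝓡∂ (n + 1)).symm ⁻¹'
      (chartAt (EuclideanHalfSpace (n + 1)) x₀).target ∩ {y : Model n | 0 < y 0} := by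
    ext y
    simp only [interiorTarget, mfld_simps, mem_inter_iff, mem_ofPred_eq, mem_preimage]
    refine ⟨fun h => ⟨h.1.2, h.2⟩, fun h => ⟨⟨?_, h.1⟩, h.2⟩⟩
    rw [range_model]; exact h.2.le
  rw [this]
  refine ((chartAt (EuclideanHalfSpace (n + 1)) x₀).open_target.preimage
    (𝓡∂ (n + 1)).continuous_symm).inter (isOpen_lt continuous_const ?_)
  fun_prop

/-- The chain rule for a function given in the chart at `x₀` as `U`. -/
theorem mvfderiv_coordFrame (x₀ : X) {y : Model n}
    (hy : y ∈ (extChartAt (𝓡∂ (n + 1)) x₀).target) {u : X → ℝ} {U : Model n → ℝ}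
    (hU : DifferentiableAt ℝ U y)
    (hu : u =ᶠ[𝓝 ((extChartAt (𝓡∂ (n + 1)) x₀).symm y)] fun x => U (extChartAt (𝓡∂ (n + 1)) x₀ x))
    (w : Model n) :
    mvfderiv (𝓡∂ (n + 1)) u ((extChartAt (𝓡∂ (n + 1)) x₀).symm y) (coordFrame x₀ y w)
      = fderiv ℝ U y w := by
  have hx := (extChartAt (𝓡∂ (n + 1)) x₀).map_target hy
  have hxc : (extChartAt (𝓡∂ (n + 1)) x₀).symm y ∈
      (chartAt (EuclideanHalfSpace (n + 1)) x₀).source := by simpa using hx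
  have hyy : extChartAt (𝓡∂ (n + 1)) x₀ ((extChartAt (𝓡∂ (n + 1)) x₀).symm y) = y :=
    (extChartAt (𝓡∂ (n + 1)) x₀).right_inv hy
  have h1 : mfderiv (𝓡∂ (n + 1)) 𝓘(ℝ, ℝ) u ((extChartAt (𝓡∂ (n + 1)) x₀).symm y) =
      (fderiv ℝ U y).comp (mfderiv (𝓡∂ (n + 1)) 𝓘(ℝ, Model n) (extChartAt (𝓡∂ (n + 1)) x₀)
        ((extChartAt (𝓡∂ (n + 1)) x₀).symm y)) := by
    rw [hu.mfderiv_eq]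
    have h3 : MDifferentiableAt 𝓘(ℝ, Model n) 𝓘(ℝ, ℝ) U
        (extChartAt (𝓡∂ (n + 1)) x₀ ((extChartAt (𝓡∂ (n + 1)) x₀).symm y)) := by
      rw [hyy]; exact hU.mdifferentiableAt
    have h2 := mfderiv_comp ((extChartAt (𝓡∂ (n + 1)) x₀).symm y) h3
      (mdifferentiableAt_extChartAt hxc)
    rw [hyy, mfderiv_eq_fderiv] at h2
    exact h2
  have h4 := mfderiv_extChartAt_comp_mfderivWithin_extChartAt_symm (I := 𝓡∂ (n + 1)) hy
  have h5 : mfderiv (𝓡∂ (n + 1)) 𝓘(ℝ, Model n) (extChartAt (𝓡∂ (n + 1)) x₀)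
      ((extChartAt (𝓡∂ (n + 1)) x₀).symm y) (coordFrame x₀ y w) = w :=
    congrArg (fun L : Model n →L[ℝ] Model n => L w) h4
  have h6 : mvfderiv (𝓡∂ (n + 1)) u ((extChartAt (𝓡∂ (n + 1)) x₀).symm y) (coordFrame x₀ y w)
    = mfderiv (𝓡∂ (n + 1)) 𝓘(ℝ, ℝ) u ((extChartAt (𝓡∂ (n + 1)) x₀).symm y)
      (coordFrame x₀ y w) := rfl
  rw [h6, h1]
  exact congrArg (fderiv ℝ U y) h5

/-- The gradient in the coordinates of the chart at `x₀`. -/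
theorem grad_eq_coordFrame (g : FormField n X) (x₀ : X) {y : Model n}
    (hy : y ∈ (extChartAt (𝓡∂ (n + 1)) x₀).target) {u : X → ℝ} {U : Model n → ℝ}
    (hU : DifferentiableAt ℝ U y)
    (hu : u =ᶠ[𝓝 ((extChartAt (𝓡∂ (n + 1)) x₀).symm y)] fun x => U (extChartAt (𝓡∂ (n + 1)) x₀ x))
    (hpos : ∀ v : Model n, v ≠ 0 → 0 < coordForm g x₀ y v v)
    {W : Model n} (hW : coordForm g x₀ y W = fderiv ℝ U y) :
    grad g u ((extChartAt (𝓡∂ (n + 1)) x₀).symm y) = coordFrame x₀ y W := by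
  set x := (extChartAt (𝓡∂ (n + 1)) x₀).symm y with hx
  have hbij := coordFrame_bijective x₀ hy
  have h1 : g x (coordFrame x₀ y W) = mvfderiv (𝓡∂ (n + 1)) u x := by
    ext v
    obtain ⟨w, rfl⟩ := hbij.2 v
    rw [mvfderiv_coordFrame x₀ hy hU hu, ← hW]
    rfl
  have hinv : (g x).IsInvertible := by
    refine isInvertible_of_pos (E := Model n) fun v hne => ?_
    obtain ⟨w, rfl⟩ := hbij.2 v
    have hw : w ≠ 0 := fun h => hne (by rw [h, map_zero]; rfl)
    exact hpos w hw
  exact hinv.inverse_apply_eq.2 h1.symm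

omit [IsManifold (𝓡∂ (n + 1)) ∞ X] in
theorem formNorm_coordFrame (g : FormField n X) (x₀ : X) (y v : Model n) :
    formNorm g ((extChartAt (𝓡∂ (n + 1)) x₀).symm y) (coordFrame x₀ y v)
      = √(coordForm g x₀ y v v) := rfl

end ChartCoordinates

/-! ### The Riemannian measure in a chart -/

section Volume

variable {n : ℕ} {X : Type*} [TopologicalSpace X] [ChartedSpace (EuclideanHalfSpace (n + 1)) X]

/-- The Gram determinant of a form under a linear change of the basis. -/
theorem gramDet_comp (B : Model n →L[ℝ] Model n →L[ℝ] ℝ) (D : Model n →L[ℝ] Model n) :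
    (Matrix.of fun i j : Fin (n + 1) =>
      B (D (EuclideanSpace.single i 1)) (D (EuclideanSpace.single j 1))).det =
    D.det ^ 2 * (Matrix.of fun i j : Fin (n + 1) =>
      B (EuclideanSpace.single i 1) (EuclideanSpace.single j 1)).det := by
  let b : Module.Basis (Fin (n + 1)) ℝ (Model n) :=
    (EuclideanSpace.basisFun (Fin (n + 1)) ℝ).toBasis
  let B' : LinearMap.BilinForm ℝ (Model n) :=
    (ContinuousLinearMap.coeLM ℝ).comp (B : Model n →ₗ[ℝ] Model n →L[ℝ] ℝ)
  have h := LinearMap.BilinForm.toMatrix_comp b b B' (D : Model n →ₗ[ℝ] Model n)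
    (D : Model n →ₗ[ℝ] Model n)
  have h2 := congrArg Matrix.det h
  rw [Matrix.det_mul, Matrix.det_mul, Matrix.det_transpose, LinearMap.det_toMatrix] at h2
  have e1 : ∀ B'' : LinearMap.BilinForm ℝ (Model n), LinearMap.BilinForm.toMatrix b B'' =
    Matrix.of fun i j : Fin (n + 1) =>
      B'' (EuclideanSpace.single i 1) (EuclideanSpace.single j 1) := by
    intro B''; ext i j; simp [LinearMap.BilinForm.toMatrix_apply, b]
  rw [e1, e1] at h2
  refine h2.trans ?_
  rw [ContinuousLinearMap.det, sq]
  simp only [B']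
  exact (mul_right_comm _ _ _)

variable [IsManifold (𝓡∂ (n + 1)) ∞ X]

theorem coordForm_eq_tangentCoordChange (g : FormField n X) (x₀ : X) {x : X}
    (hx : x ∈ (extChartAt (𝓡∂ (n + 1)) x₀).source) (v w : Model n) :
    coordForm g x₀ (extChartAt (𝓡∂ (n + 1)) x₀ x) v w =
      g x (tangentCoordChange (𝓡∂ (n + 1)) x₀ x x v)
        (tangentCoordChange (𝓡∂ (n + 1)) x₀ x x w) := by
  have h : ∀ y ∈ (extChartAt (𝓡∂ (n + 1)) x₀).target,
      ∀ x, x = (extChartAt (𝓡∂ (n + 1)) x₀).symm y → coordForm g x₀ y v w =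
      g x (tangentCoordChange (𝓡∂ (n + 1)) x₀ x x v)
        (tangentCoordChange (𝓡∂ (n + 1)) x₀ x x w) := by
    rintro y hy x rfl
    rw [coordForm_apply, coordFrame_eq_tangentCoordChange x₀ hy,
      coordFrame_eq_tangentCoordChange x₀ hy]
  exact h _ ((extChartAt (𝓡∂ (n + 1)) x₀).map_source hx) x
    ((extChartAt (𝓡∂ (n + 1)) x₀).left_inv hx).symm

/-- The volume density transforms by the absolute value of the Jacobian determinant of the change of
coordinates. -/
theorem volumeDensity_change (g : FormField n X) (x₀ x₁ : X) {x : X}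
    (hx₀ : x ∈ (extChartAt (𝓡∂ (n + 1)) x₀).source)
    (hx₁ : x ∈ (extChartAt (𝓡∂ (n + 1)) x₁).source) :
    volumeDensity g x₁ (extChartAt (𝓡∂ (n + 1)) x₁ x) =
      |(tangentCoordChange (𝓡∂ (n + 1)) x₁ x₀ x).det| *
        volumeDensity g x₀ (extChartAt (𝓡∂ (n + 1)) x₀ x) := by
  have hxx : x ∈ (extChartAt (𝓡∂ (n + 1)) x).source := mem_extChartAt_source x
  have h : ∀ v w : Model n, coordForm g x₁ (extChartAt (𝓡∂ (n + 1)) x₁ x) v w =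
      coordForm g x₀ (extChartAt (𝓡∂ (n + 1)) x₀ x)
        (tangentCoordChange (𝓡∂ (n + 1)) x₁ x₀ x v)
        (tangentCoordChange (𝓡∂ (n + 1)) x₁ x₀ x w) := by
    intro v w
    rw [coordForm_eq_tangentCoordChange g x₁ hx₁, coordForm_eq_tangentCoordChange g x₀ hx₀,
      tangentCoordChange_comp ⟨⟨hx₁, hx₀⟩, hxx⟩, tangentCoordChange_comp ⟨⟨hx₁, hx₀⟩, hxx⟩]
  rw [volumeDensity, volumeDensity]
  simp only [h]
  rw [gramDet_comp, Real.sqrt_mul (sq_nonneg _), Real.sqrt_sq_eq_abs]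

omit [IsManifold (𝓡∂ (n + 1)) ∞ X] in
theorem target_inter_interior_range (x₀ : X) :
    (extChartAt (𝓡∂ (n + 1)) x₀).target ∩ interior (range (𝓡∂ (n + 1))) = interiorTarget n x₀ := by
  rw [interior_range_model]; rfl

omit [IsManifold (𝓡∂ (n + 1)) ∞ X] in
theorem continuousOn_volumeDensity {g : FormField n X} {x₀ : X} {S : Set (Model n)}
    (hg : ContinuousOn (coordForm g x₀) S) : ContinuousOn (volumeDensity g x₀) S := by
  refine Real.continuous_sqrt.comp_continuousOn ?_
  refine (Continuous.matrix_det continuous_id).comp_continuousOn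
    (f := fun y => Matrix.of fun i j : Fin (n + 1) =>
      coordForm g x₀ y (EuclideanSpace.single i 1) (EuclideanSpace.single j 1)) ?_
  refine continuousOn_pi.2 fun i => continuousOn_pi.2 fun j => ?_
  exact (hg.clm_apply continuousOn_const).clm_apply continuousOn_const

variable [MeasurableSpace X] [BorelSpace X]

open Classical in
/-- The inverse chart at `x₀`, modified outside the open set `interiorTarget n x₀` so as to be
measurable. -/
noncomputable def measurableInvChart (n : ℕ) {X : Type*} [TopologicalSpace X]
    [ChartedSpace (EuclideanHalfSpace (n + 1)) X] (x₀ : X) : Model n → X :=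
  (interiorTarget n x₀).piecewise (extChartAt (𝓡∂ (n + 1)) x₀).symm fun _ => x₀

omit [IsManifold (𝓡∂ (n + 1)) ∞ X] in
theorem measurable_measurableInvChart (x₀ : X) : Measurable (measurableInvChart n x₀) := by
  classical
  have h : ContinuousOn (extChartAt (𝓡∂ (n + 1)) x₀).symm (interiorTarget n x₀) :=
    (continuousOn_extChartAt_symm x₀).mono inter_subset_left
  exact h.measurable_piecewise continuousOn_const (isOpen_interiorTarget x₀).measurableSet

omit [IsManifold (𝓡∂ (n + 1)) ∞ X] [MeasurableSpace X] [BorelSpace X] in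
theorem measurableInvChart_of_mem {x₀ : X} {y : Model n} (hy : y ∈ interiorTarget n x₀) :
    measurableInvChart n x₀ y = (extChartAt (𝓡∂ (n + 1)) x₀).symm y := by
  classical
  exact piecewise_eq_of_mem _ _ _ hy

omit [IsManifold (𝓡∂ (n + 1)) ∞ X] [BorelSpace X] in
/-- The inverse chart may be replaced by a measurable map, so the image measure in the definition of
`chartVolume` is not the junk value `0`. -/
theorem chartVolume_eq_map (g : FormField n X) (x₀ : X) :
    chartVolume g x₀ = Measure.map (measurableInvChart n x₀)
      ((volume.restrict (interiorTarget n x₀)).withDensity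
        fun y => ENNReal.ofReal (volumeDensity g x₀ y)) := by
  rw [chartVolume, target_inter_interior_range]
  refine Measure.map_congr ?_
  refine (withDensity_absolutelyContinuous _ _).ae_le ?_
  filter_upwards [ae_restrict_mem (isOpen_interiorTarget x₀).measurableSet] with y hy
  exact (measurableInvChart_of_mem hy).symm

omit [IsManifold (𝓡∂ (n + 1)) ∞ X] in
theorem setLIntegral_chartVolume {g : FormField n X} {x₀ : X}
    (hg : ContinuousOn (coordForm g x₀) (interiorTarget n x₀)) {S : Set X} (hS : MeasurableSet S)
    {F : X → ℝ≥0∞} (hF : Measurable F) :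
    ∫⁻ x in S, F x ∂(chartVolume g x₀) =
      ∫⁻ y in interiorTarget n x₀ ∩ measurableInvChart n x₀ ⁻¹' S,
        F (measurableInvChart n x₀ y) * ENNReal.ofReal (volumeDensity g x₀ y) := by
  have hm := measurable_measurableInvChart (n := n) x₀
  have hT := (isOpen_interiorTarget (n := n) x₀).measurableSet
  rw [chartVolume_eq_map, setLIntegral_map hS hF hm]
  rw [setLIntegral_withDensity_eq_setLIntegral_mul_non_measurable₀ _ _ _ (hm hS)]
  · rw [Measure.restrict_restrict (hm hS), inter_comm]
    simp only [Pi.mul_apply, mul_comm]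
  · exact Eventually.of_forall fun _ => ENNReal.ofReal_lt_top
  · rw [Measure.restrict_restrict (hm hS)]
    exact ((continuousOn_volumeDensity hg).mono inter_subset_right).aemeasurable
      ((hm hS).inter hT) |>.ennreal_ofReal

/-- On the domain of the chart at `x₀`, `chartVolume g x₀` is the largest of the measures
`chartVolume g x₁`, by the change of variables formula. -/
theorem chartVolume_le_of_subset {g : FormField n X} (x₀ x₁ : X)
    (hg : ∀ x, ContinuousOn (coordForm g x) (interiorTarget n x)) {S : Set X}
    (hS : MeasurableSet S) (hSx : S ⊆ (extChartAt (𝓡∂ (n + 1)) x₀).source) :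
    chartVolume g x₁ S ≤ chartVolume g x₀ S := by
  have h : ∀ x, chartVolume g x S = ∫⁻ y in interiorTarget n x ∩ measurableInvChart n x ⁻¹' S,
      ENNReal.ofReal (volumeDensity g x y) := by
    intro x
    have := setLIntegral_chartVolume (hg x) hS (F := fun _ => 1) measurable_const
    simpa using this
  rw [h, h]
  set B := interiorTarget n x₁ ∩ measurableInvChart n x₁ ⁻¹' S with hB
  have hBm : MeasurableSet B :=
    (isOpen_interiorTarget x₁).measurableSet.inter (measurable_measurableInvChart x₁ hS)
  have hB1 : ∀ y ∈ B, (extChartAt (𝓡∂ (n + 1)) x₁).symm y ∈ S := by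
    intro y hy
    have := hy.2
    rwa [mem_preimage, measurableInvChart_of_mem hy.1] at this
  have hs1 : ∀ y ∈ B, (extChartAt (𝓡∂ (n + 1)) x₁).symm y ∈
      (extChartAt (𝓡∂ (n + 1)) x₁).source := fun y hy =>
    (extChartAt (𝓡∂ (n + 1)) x₁).map_target hy.1.1
  let φ : Model n → Model n := extChartAt (𝓡∂ (n + 1)) x₀ ∘ (extChartAt (𝓡∂ (n + 1)) x₁).symm
  have hφ' : ∀ y ∈ B, HasFDerivWithinAt φ (tangentCoordChange (𝓡∂ (n + 1)) x₁ x₀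
      ((extChartAt (𝓡∂ (n + 1)) x₁).symm y)) B y := by
    intro y hy
    have h1 := hasFDerivWithinAt_tangentCoordChange (I := 𝓡∂ (n + 1)) (x := x₁) (y := x₀)
      (z := (extChartAt (𝓡∂ (n + 1)) x₁).symm y) ⟨hs1 y hy, hSx (hB1 y hy)⟩
    rw [(extChartAt (𝓡∂ (n + 1)) x₁).right_inv hy.1.1] at h1
    exact h1.mono fun z hz => extChartAt_target_subset_range x₁ hz.1.1
  have hinj : InjOn φ B := by
    intro y hy z hz hyz
    have h1 := (extChartAt (𝓡∂ (n + 1)) x₀).injOn (hSx (hB1 y hy)) (hSx (hB1 z hz)) hyz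
    exact (extChartAt (𝓡∂ (n + 1)) x₁).symm.injOn hy.1.1 hz.1.1 h1
  have key := lintegral_image_eq_lintegral_abs_det_fderiv_mul volume hBm hφ' hinj
    fun y => ENNReal.ofReal (volumeDensity g x₀ y)
  have hle : ∫⁻ y in B, ENNReal.ofReal (volumeDensity g x₁ y) =
      ∫⁻ y in φ '' B, ENNReal.ofReal (volumeDensity g x₀ y) := by
    rw [key]
    refine setLIntegral_congr_fun hBm fun y hy => ?_
    have := volumeDensity_change g x₀ x₁ (hSx (hB1 y hy)) (hs1 y hy)
    rw [(extChartAt (𝓡∂ (n + 1)) x₁).right_inv hy.1.1] at this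
    simp only [this]
    exact ENNReal.ofReal_mul (abs_nonneg _)
  rw [hle]
  refine lintegral_mono_set ?_
  rintro _ ⟨y, hy, rfl⟩
  have h2 : (extChartAt (𝓡∂ (n + 1)) x₀).symm (φ y) = (extChartAt (𝓡∂ (n + 1)) x₁).symm y :=
    (extChartAt (𝓡∂ (n + 1)) x₀).left_inv (hSx (hB1 y hy))
  have h3 : φ y ∈ (extChartAt (𝓡∂ (n + 1)) x₀).target :=
    (extChartAt (𝓡∂ (n + 1)) x₀).map_source (hSx (hB1 y hy))
  have h4 : φ y ∈ interiorTarget n x₀ := by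
    refine ⟨h3, (mem_interior_iff_coord x₀ h3).1 ?_⟩
    rw [h2]
    exact (mem_interior_iff_coord x₁ hy.1.1).2 hy.1.2
  refine ⟨h4, ?_⟩
  rw [mem_preimage, measurableInvChart_of_mem h4, h2]
  exact hB1 y hy

/-- On a chart domain the supremum in the definition of the Riemannian measure is attained. -/
theorem restrict_riemannianVolume {g : FormField n X} (x₀ : X)
    (hg : ∀ x, ContinuousOn (coordForm g x) (interiorTarget n x)) {S : Set X}
    (hS : MeasurableSet S) (hSx : S ⊆ (extChartAt (𝓡∂ (n + 1)) x₀).source) :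
    (riemannianVolume g).restrict S = (chartVolume g x₀).restrict S := by
  apply le_antisymm
  · have h : riemannianVolume g ≤
        (chartVolume g x₀).restrict S + (riemannianVolume g).restrict Sᶜ := by
      refine iSup_le fun x₁ => ?_
      rw [← Measure.restrict_add_restrict_compl (μ := chartVolume g x₁) hS]
      refine add_le_add (Measure.le_iff.2 fun A hA => ?_)
        (Measure.restrict_mono le_rfl (le_iSup (fun x => chartVolume g x) x₁))
      rw [Measure.restrict_apply hA, Measure.restrict_apply hA]
      exact chartVolume_le_of_subset x₀ x₁ hg (hA.inter hS) (inter_subset_right.trans hSx)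
    calc (riemannianVolume g).restrict S
        ≤ ((chartVolume g x₀).restrict S + (riemannianVolume g).restrict Sᶜ).restrict S :=
          Measure.restrict_mono le_rfl h
      _ = (chartVolume g x₀).restrict S := by
          rw [Measure.restrict_add, Measure.restrict_restrict hS, Measure.restrict_restrict hS]
          simp
  · exact Measure.restrict_mono le_rfl (le_iSup (fun x => chartVolume g x) x₀)

/-- Integration over a part of a chart domain with respect to the Riemannian measure. -/
theorem setLIntegral_riemannianVolume {g : FormField n X} (x₀ : X)
    (hg : ∀ x, ContinuousOn (coordForm g x) (interiorTarget n x)) {D : Set (Model n)}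
    (hD : D ⊆ interiorTarget n x₀)
    (hS : MeasurableSet ((extChartAt (𝓡∂ (n + 1)) x₀).symm '' D))
    {F : X → ℝ≥0∞} (hF : Measurable F) :
    ∫⁻ x in (extChartAt (𝓡∂ (n + 1)) x₀).symm '' D, F x ∂(riemannianVolume g) =
      ∫⁻ y in D, F ((extChartAt (𝓡∂ (n + 1)) x₀).symm y) *
        ENNReal.ofReal (volumeDensity g x₀ y) := by
  have hsub : (extChartAt (𝓡∂ (n + 1)) x₀).symm '' D ⊆ (extChartAt (𝓡∂ (n + 1)) x₀).source := by
    rintro _ ⟨y, hy, rfl⟩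
    exact (extChartAt (𝓡∂ (n + 1)) x₀).map_target (hD hy).1
  rw [restrict_riemannianVolume x₀ hg hS hsub, setLIntegral_chartVolume (hg x₀) hS hF]
  have hset : interiorTarget n x₀ ∩ measurableInvChart n x₀ ⁻¹'
      ((extChartAt (𝓡∂ (n + 1)) x₀).symm '' D) = D := by
    ext y
    constructor
    · rintro ⟨hy, hy2⟩
      rw [mem_preimage, measurableInvChart_of_mem hy] at hy2
      obtain ⟨z, hz, hzy⟩ := hy2
      rwa [← (extChartAt (𝓡∂ (n + 1)) x₀).symm.injOn (hD hz).1 hy.1 hzy]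
    · intro hy
      refine ⟨hD hy, ?_⟩
      rw [mem_preimage, measurableInvChart_of_mem (hD hy)]
      exact mem_image_of_mem _ hy
  have hDm : MeasurableSet D := by
    rw [← hset]
    exact (isOpen_interiorTarget x₀).measurableSet.inter (measurable_measurableInvChart x₀ hS)
  rw [hset]
  refine setLIntegral_congr_fun hDm fun y hy => ?_
  simp only [measurableInvChart_of_mem (hD hy)]

end Volume

/-! ### The curvature of a conformally compact metric near the boundary -/

section CurvatureLimit

variable {E : Type*} [NormedAddCommGroup E] [NormedSpace ℝ E]

theorem tendsto_clm_apply {ι V W : Type*} [NormedAddCommGroup V] [NormedSpace ℝ V]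
    [NormedAddCommGroup W] [NormedSpace ℝ W] {F : Filter ι} {L : ι → V →L[ℝ] W} {L₀ : V →L[ℝ] W}
    (h : Tendsto L F (𝓝 L₀)) (v : V) : Tendsto (fun i => L i v) F (𝓝 (L₀ v)) :=
  ((ContinuousLinearMap.apply ℝ W v).continuous.tendsto L₀).comp h

/-- The product rule for `a ρ⁻ᵏ H`. -/
theorem hasFDerivAt_conformal {ρ : E → ℝ} {H : E → E →L[ℝ] E →L[ℝ] ℝ} {y : E}
    {ρ' : E →L[ℝ] ℝ} {H' : E →L[ℝ] E →L[ℝ] E →L[ℝ] ℝ}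
    (hρ : HasFDerivAt ρ ρ' y) (hH : HasFDerivAt H H' y) (hy : ρ y ≠ 0) (a : ℝ) (k : ℕ) :
    HasFDerivAt (fun z => (a * (ρ z)⁻¹ ^ k) • H z)
      ((a * (ρ y)⁻¹ ^ k) • H' + ((-a * k * (ρ y)⁻¹ ^ (k + 1)) • ρ').smulRight (H y)) y := by
  have h1 : HasFDerivAt (fun z => (ρ z)⁻¹) (-((ρ y ^ 2)⁻¹) • ρ') y :=
    (hasDerivAt_inv hy).comp_hasFDerivAt y hρ
  have h2 := ((h1.pow k).const_mul a).smul hH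
  refine h2.congr_fderiv ?_
  ext u v w
  cases k with
  | zero => simp
  | succ k => simp; field_simp; left; ring

/-- The first derivative of the conformal metric `G = ρ⁻² H`. -/
theorem fderiv_conformal {ρ : E → ℝ} {H G : E → E →L[ℝ] E →L[ℝ] ℝ} {S : Set E}
    (hS : IsOpen S) (hρ : ContDiffOn ℝ 2 ρ S) (hH : ContDiffOn ℝ 2 H S) (h0 : ∀ y ∈ S, ρ y ≠ 0)
    (hG : ∀ y ∈ S, G y = (ρ y)⁻¹ ^ 2 • H y) {y : E} (hy : y ∈ S) (a : E) :
    fderiv ℝ G y a = (ρ y)⁻¹ ^ 2 • fderiv ℝ H y a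
      + (-2 * (ρ y)⁻¹ ^ 3 * fderiv ℝ ρ y a) • H y := by
  have hρ' := ((hρ.contDiffAt (hS.mem_nhds hy)).differentiableAt (by norm_num)).hasFDerivAt
  have hH' := ((hH.contDiffAt (hS.mem_nhds hy)).differentiableAt (by norm_num)).hasFDerivAt
  have h1 := hasFDerivAt_conformal hρ' hH' (h0 y hy) 1 2
  have h2 : G =ᶠ[𝓝 y] fun z => (1 * (ρ z)⁻¹ ^ 2) • H z := by
    filter_upwards [hS.mem_nhds hy] with z hz
    rw [hG z hz, one_mul]
  rw [h2.fderiv_eq, h1.fderiv]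
  ext v w
  simp

/-- The second derivative of the conformal metric `G = ρ⁻² H`; only the last term is not `O(ρ⁻³)`.
-/
theorem fderiv_fderiv_conformal {ρ : E → ℝ} {H G : E → E →L[ℝ] E →L[ℝ] ℝ} {S : Set E}
    (hS : IsOpen S) (hρ : ContDiffOn ℝ 2 ρ S) (hH : ContDiffOn ℝ 2 H S) (h0 : ∀ y ∈ S, ρ y ≠ 0)
    (hG : ∀ y ∈ S, G y = (ρ y)⁻¹ ^ 2 • H y) {y : E} (hy : y ∈ S) (a b c d : E) :
    fderiv ℝ (fderiv ℝ G) y b a c d = (ρ y)⁻¹ ^ 2 * fderiv ℝ (fderiv ℝ H) y b a c d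
      - 2 * (ρ y)⁻¹ ^ 3 * fderiv ℝ ρ y b * fderiv ℝ H y a c d
      - 2 * (ρ y)⁻¹ ^ 3 * fderiv ℝ ρ y a * fderiv ℝ H y b c d
      - 2 * (ρ y)⁻¹ ^ 3 * fderiv ℝ (fderiv ℝ ρ) y b a * H y c d
      + 6 * (ρ y)⁻¹ ^ 4 * fderiv ℝ ρ y a * fderiv ℝ ρ y b * H y c d := by
  have hρa := hρ.contDiffAt (hS.mem_nhds hy)
  have hHa := hH.contDiffAt (hS.mem_nhds hy)
  have hρ' := (hρa.differentiableAt (by norm_num)).hasFDerivAt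
  have hH' := (hHa.differentiableAt (by norm_num)).hasFDerivAt
  have hρ'' : HasFDerivAt (fun z => fderiv ℝ ρ z a) ((fderiv ℝ (fderiv ℝ ρ) y).flip a) y := by
    have := ((hρa.fderiv_right (m := 1) (by norm_num)).differentiableAt (by norm_num)).hasFDerivAt
    simpa using! this.clm_apply (hasFDerivAt_const a y)
  have hH'' : HasFDerivAt (fun z => fderiv ℝ H z a) ((fderiv ℝ (fderiv ℝ H) y).flip a) y := by
    have := ((hHa.fderiv_right (m := 1) (by norm_num)).differentiableAt (by norm_num)).hasFDerivAt
    simpa using! this.clm_apply (hasFDerivAt_const a y)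
  have hGd : DifferentiableAt ℝ (fderiv ℝ G) y := by
    have hGc : ContDiffAt ℝ 2 G y := by
      have : ContDiffAt ℝ 2 (fun z => (ρ z)⁻¹ ^ 2 • H z) y :=
        ((hρa.inv (h0 y hy)).pow 2).smul hHa
      refine this.congr_of_eventuallyEq ?_
      filter_upwards [hS.mem_nhds hy] with z hz using hG z hz
    exact (hGc.fderiv_right (m := 1) (by norm_num)).differentiableAt (by norm_num)
  have e1 : fderiv ℝ (fderiv ℝ G) y b a = fderiv ℝ (fun z => fderiv ℝ G z a) y b := by
    have := hGd.hasFDerivAt.clm_apply (hasFDerivAt_const a y)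
    rw [this.fderiv]; simp
  have e2 : (fun z => fderiv ℝ G z a) =ᶠ[𝓝 y] fun z => (1 * (ρ z)⁻¹ ^ 2) • fderiv ℝ H z a
      + (-2 * (ρ z)⁻¹ ^ 3) • (fderiv ℝ ρ z a • H z) := by
    filter_upwards [hS.mem_nhds hy] with z hz
    rw [fderiv_conformal hS hρ hH h0 hG hz, one_mul, smul_smul]
  have h3 := (hasFDerivAt_conformal hρ' hH'' (h0 y hy) 1 2).add
    (hasFDerivAt_conformal hρ' (hρ''.smul hH') (h0 y hy) (-2) 3)
  rw [e1, e2.fderiv_eq]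
  refine (congrArg (fun L : E →L[ℝ] E →L[ℝ] E →L[ℝ] ℝ => L b c d) h3.fderiv).trans ?_
  simp
  ring

variable [FiniteDimensional ℝ E]

/-- The leading term of the Christoffel symbols of `G = ρ⁻² H` where `ρ → 0`: the derivatives of
`H` do not contribute to it. Here `ν` is the gradient of `ρ` with respect to the limit form `H₀`. -/
theorem tendsto_christoffel_conformal {ρ : E → ℝ} {H G : E → E →L[ℝ] E →L[ℝ] ℝ} {S : Set E}
    (hS : IsOpen S) (hρ : ContDiffOn ℝ 2 ρ S) (hH : ContDiffOn ℝ 2 H S) (h0 : ∀ y ∈ S, ρ y ≠ 0)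
    (hG : ∀ y ∈ S, G y = (ρ y)⁻¹ ^ 2 • H y) {F : Filter E} (hF : S ∈ F)
    {ρ₁ : E →L[ℝ] ℝ} {H₀ : E →L[ℝ] E →L[ℝ] ℝ} {H₁ : E →L[ℝ] E →L[ℝ] E →L[ℝ] ℝ}
    (tρ : Tendsto ρ F (𝓝 0)) (tρ₁ : Tendsto (fderiv ℝ ρ) F (𝓝 ρ₁))
    (tH : Tendsto H F (𝓝 H₀)) (tH₁ : Tendsto (fderiv ℝ H) F (𝓝 H₁))
    (hpos : ∀ v, v ≠ 0 → 0 < H₀ v v) {ν : E} (hν : H₀ ν = ρ₁) (u v : E) :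
    Tendsto (fun y => ρ y • christoffel G y u v) F
      (𝓝 (H₀ u v • ν - ρ₁ u • v - ρ₁ v • u)) := by
  have hinv := isInvertible_of_pos hpos
  have tinv : Tendsto (fun y => (H y).inverse) F (𝓝 H₀.inverse) := by
    obtain ⟨e, he⟩ := hinv
    have := (contDiffAt_map_inverse (𝕜 := ℝ) (n := 0) e).continuousAt
    rw [he] at this
    exact this.tendsto.comp tH
  have evinv : ∀ᶠ y in F, (H y).IsInvertible := by
    obtain ⟨e, he⟩ := hinv
    have := e.nhds
    rw [he] at this
    exact tH this
  have tflip : Tendsto (fun y => ((fderiv ℝ H y).flip u).flip v) F (𝓝 ((H₁.flip u).flip v)) := by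
    have t1 := ((ContinuousLinearMap.flipₗᵢ ℝ E E (E →L[ℝ] ℝ)).continuous.tendsto H₁).comp tH₁
    exact ((ContinuousLinearMap.flipₗᵢ ℝ E E ℝ).continuous.tendsto _).comp
      (tendsto_clm_apply t1 u) |> (tendsto_clm_apply · v)
  have tuv := tendsto_clm_apply (tendsto_clm_apply tH₁ u) v
  have tvu := tendsto_clm_apply (tendsto_clm_apply tH₁ v) u
  have tθ : Tendsto (fun y => (H y u v • fderiv ℝ ρ y - fderiv ℝ ρ y u • H y v
      - fderiv ℝ ρ y v • H y u) + (ρ y / 2) • (fderiv ℝ H y u v + fderiv ℝ H y v u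
      - ((fderiv ℝ H y).flip u).flip v)) F
      (𝓝 ((H₀ u v • ρ₁ - ρ₁ u • H₀ v - ρ₁ v • H₀ u) + ((0 : ℝ) / 2) • (H₁ u v + H₁ v u
      - (H₁.flip u).flip v))) := by
    have t1 := tendsto_clm_apply tH u
    have t2 := tendsto_clm_apply tH v
    exact ((((tendsto_clm_apply t1 v).smul tρ₁).sub
      ((tendsto_clm_apply tρ₁ u).smul t2)).sub
      ((tendsto_clm_apply tρ₁ v).smul t1)).add
      ((tρ.div_const 2).smul ((tuv.add tvu).sub tflip))
  have key := (isBoundedBilinearMap_apply (𝕜 := ℝ) (E := E →L[ℝ] ℝ) (F := E)).continuous.tendsto _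
    |>.comp (tinv.prodMk_nhds tθ)
  have e1 : H₀.inverse ((H₀ u v • ρ₁ - ρ₁ u • H₀ v - ρ₁ v • H₀ u) + ((0 : ℝ) / 2) •
      (H₁ u v + H₁ v u - (H₁.flip u).flip v)) = H₀ u v • ν - ρ₁ u • v - ρ₁ v • u := by
    rw [hinv.inverse_apply_eq]
    simp [hν]
  change Tendsto _ F (𝓝 (H₀.inverse _)) at key
  rw [e1] at key
  refine key.congr' ?_
  filter_upwards [hF, evinv] with y hy hyinv
  have hGinv : (G y).IsInvertible := by
    refine isInvertible_of_injective_bilin fun a b hab => hyinv.injective ?_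
    rw [hG y hy] at hab
    exact smul_right_injective _ (pow_ne_zero 2 (inv_ne_zero (h0 y hy))) hab
  refine hyinv.inverse_apply_eq.2 ?_
  have e2 : H y = ρ y ^ 2 • G y := by
    rw [hG y hy, smul_smul]
    have := h0 y hy
    field_simp
    simp
  have e3 : G y (christoffel G y u v) = (1 / 2 : ℝ) •
    (fderiv ℝ G y u v + fderiv ℝ G y v u - ((fderiv ℝ G y).flip u).flip v) :=
    (hGinv.inverse_apply_eq.1 rfl).symm
  conv_rhs => rw [map_smul, e2, smul_apply, e3]
  ext w
  have hr := h0 y hy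
  have f1 := fun a => fderiv_conformal hS hρ hH h0 hG hy a
  simp [f1]
  field_simp
  ring

/-- The leading term of the curvature of a conformally compact metric `G = ρ⁻² H` where `ρ → 0`: as
`G ∧ G` is of order `ρ⁻⁴`, the sectional curvatures of `G` tend to `-|dρ|²`, the squared length
being that with respect to the limit form `H₀`. -/
theorem tendsto_riemannBiquadratic_conformal {ρ : E → ℝ} {H G : E → E →L[ℝ] E →L[ℝ] ℝ} {S : Set E}
    (hS : IsOpen S) (hρ : ContDiffOn ℝ 2 ρ S) (hH : ContDiffOn ℝ 2 H S) (h0 : ∀ y ∈ S, ρ y ≠ 0)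
    (hG : ∀ y ∈ S, G y = (ρ y)⁻¹ ^ 2 • H y) {F : Filter E} (hF : S ∈ F)
    {ρ₁ : E →L[ℝ] ℝ} {ρ₂ : E →L[ℝ] E →L[ℝ] ℝ}
    {H₀ : E →L[ℝ] E →L[ℝ] ℝ} {H₁ : E →L[ℝ] E →L[ℝ] E →L[ℝ] ℝ}
    {H₂ : E →L[ℝ] E →L[ℝ] E →L[ℝ] E →L[ℝ] ℝ}
    (tρ : Tendsto ρ F (𝓝 0)) (tρ₁ : Tendsto (fderiv ℝ ρ) F (𝓝 ρ₁))
    (tρ₂ : Tendsto (fderiv ℝ (fderiv ℝ ρ)) F (𝓝 ρ₂))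
    (tH : Tendsto H F (𝓝 H₀)) (tH₁ : Tendsto (fderiv ℝ H) F (𝓝 H₁))
    (tH₂ : Tendsto (fderiv ℝ (fderiv ℝ H)) F (𝓝 H₂))
    (hpos : ∀ v, v ≠ 0 → 0 < H₀ v v) (hsymm : ∀ v w, H₀ v w = H₀ w v)
    {ν : E} (hν : H₀ ν = ρ₁) (u v : E) :
    Tendsto (fun y => ρ y ^ 4 * riemannBiquadratic G y u v) F
      (𝓝 (-(ρ₁ ν) * (H₀ u u * H₀ v v - H₀ u v ^ 2))) := by
  have tD : ∀ a b c d : E, Tendsto (fun y => ρ y ^ 4 * fderiv ℝ (fderiv ℝ G) y b a c d) F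
      (𝓝 (6 * ρ₁ a * ρ₁ b * H₀ c d)) := by
    intro a b c d
    have s1 : ∀ a, Tendsto (fun y => fderiv ℝ ρ y a) F (𝓝 (ρ₁ a)) := fun a =>
      tendsto_clm_apply tρ₁ a
    have s2 : Tendsto (fun y => fderiv ℝ (fderiv ℝ ρ) y b a) F (𝓝 (ρ₂ b a)) :=
      tendsto_clm_apply (tendsto_clm_apply tρ₂ b) a
    have s3 : Tendsto (fun y => H y c d) F (𝓝 (H₀ c d)) :=
      tendsto_clm_apply (tendsto_clm_apply tH c) d
    have s4 : ∀ a, Tendsto (fun y => fderiv ℝ H y a c d) F (𝓝 (H₁ a c d)) := fun a =>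
      tendsto_clm_apply (tendsto_clm_apply (tendsto_clm_apply tH₁ a) c) d
    have s5 : Tendsto (fun y => fderiv ℝ (fderiv ℝ H) y b a c d) F (𝓝 (H₂ b a c d)) :=
      tendsto_clm_apply (tendsto_clm_apply (tendsto_clm_apply (tendsto_clm_apply tH₂ b) a) c) d
    have := (((((tρ.pow 2).mul s5).sub (((tρ.const_mul 2).mul (s1 b)).mul (s4 a))).sub
      (((tρ.const_mul 2).mul (s1 a)).mul (s4 b))).sub (((tρ.const_mul 2).mul s2).mul s3)).add
      ((((s1 a).const_mul 6).mul (s1 b)).mul s3)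
    simp only [ne_eq, OfNat.ofNat_ne_zero, not_false_eq_true, zero_pow, zero_mul, mul_zero,
      sub_zero, zero_add] at this
    refine this.congr' ?_
    filter_upwards [hF] with y hy
    rw [fderiv_fderiv_conformal hS hρ hH h0 hG hy]
    have hr := h0 y hy
    field_simp
  have tΓ := tendsto_christoffel_conformal hS hρ hH h0 hG hF tρ tρ₁ tH tH₁ hpos hν
  have tq : ∀ a b c d : E, Tendsto (fun y => ρ y ^ 4 * G y (christoffel G y a b)
      (christoffel G y c d)) F (𝓝 (H₀ (H₀ a b • ν - ρ₁ a • b - ρ₁ b • a)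
        (H₀ c d • ν - ρ₁ c • d - ρ₁ d • c))) := by
    intro a b c d
    have ap := (isBoundedBilinearMap_apply (𝕜 := ℝ) (E := E) (F := E →L[ℝ] ℝ)).continuous.tendsto _
      |>.comp (tH.prodMk_nhds (tΓ a b))
    have ap2 := (isBoundedBilinearMap_apply (𝕜 := ℝ) (E := E) (F := ℝ)).continuous.tendsto _
      |>.comp (ap.prodMk_nhds (tΓ c d))
    refine ap2.congr' ?_
    filter_upwards [hF] with y hy
    rw [hG y hy]
    have hr := h0 y hy
    simp
    field_simp
  have := ((((tD v u u v).sub ((tD u u v v).const_mul (1 / 2))).sub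
    ((tD v v u u).const_mul (1 / 2))).add (tq u v u v)).sub (tq u u v v)
  have hν' : ∀ w, H₀ w ν = ρ₁ w := fun w => by rw [hsymm, hν]
  refine (this.congr' (Eventually.of_forall fun y => ?_)).trans (le_of_eq ?_)
  · simp only [riemannBiquadratic]; ring
  · congr 1
    simp [hν, hν', hsymm v u]
    ring

end CurvatureLimit

/-! ### Estimates for positive definite forms -/

section FormEstimates

variable {E : Type*} [NormedAddCommGroup E] [NormedSpace ℝ E]

/-- The Cauchy-Schwarz inequality. -/
theorem bilin_sq_le {B : E →L[ℝ] E →L[ℝ] ℝ} (hs : ∀ v w, B v w = B w v)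
    (hp : ∀ v, v ≠ 0 → 0 < B v v) (u v : E) : B u v ^ 2 ≤ B u u * B v v := by
  rcases eq_or_ne v 0 with rfl | hv
  · simp
  have h1 : 0 ≤ B (B v v • u - B u v • v) (B v v • u - B u v • v) := by
    rcases eq_or_ne (B v v • u - B u v • v) 0 with h | h
    · rw [h]; simp
    · exact (hp _ h).le
  have h2 := hp v hv
  have h3 : B (B v v • u - B u v • v) (B v v • u - B u v • v) =
      B v v * (B u u * B v v - B u v ^ 2) := by
    simp [hs v u]; ring
  rw [h3] at h1
  have := nonneg_of_mul_nonneg_right h1 h2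
  linarith

/-- The strict Cauchy-Schwarz inequality for linearly independent vectors. -/
theorem bilin_sq_lt {B : E →L[ℝ] E →L[ℝ] ℝ} (hs : ∀ v w, B v w = B w v)
    (hp : ∀ v, v ≠ 0 → 0 < B v v) {u v : E} (h : LinearIndependent ℝ ![u, v]) :
    B u v ^ 2 < B u u * B v v := by
  have hv : v ≠ 0 := by simpa using h.ne_zero 1
  have h2 := hp v hv
  have hne : B v v • u - B u v • v ≠ 0 := by
    intro h0
    have := LinearIndependent.pair_iff.1 h (B v v) (-(B u v))
      (by rw [neg_smul, ← sub_eq_add_neg, h0])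
    exact h2.ne' this.1
  have h1 := hp _ hne
  have h3 : B (B v v • u - B u v • v) (B v v • u - B u v • v) =
      B v v * (B u u * B v v - B u v ^ 2) := by
    simp [hs v u]; ring
  rw [h3] at h1
  have := (mul_pos_iff_of_pos_left h2).1 h1
  linarith

theorem exists_coercive [FiniteDimensional ℝ E] {B : E →L[ℝ] E →L[ℝ] ℝ}
    (hp : ∀ v, v ≠ 0 → 0 < B v v) : ∃ c > 0, ∀ v, c * ‖v‖ ^ 2 ≤ B v v := by
  have hcont : Continuous fun v => B v v := by fun_prop
  rcases (Metric.sphere (0 : E) 1).eq_empty_or_nonempty with he | hne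
  · refine ⟨1, one_pos, fun v => ?_⟩
    rcases eq_or_ne v 0 with rfl | hv
    · simp
    · exfalso
      have : ‖v‖⁻¹ • v ∈ Metric.sphere (0 : E) 1 := by
        simp [norm_smul, hv]
      rw [he] at this
      exact this
  obtain ⟨w, hw, hmin⟩ := (isCompact_sphere (0 : E) 1).exists_isMinOn hne hcont.continuousOn
  have hw0 : w ≠ 0 := by
    rintro rfl; simp at hw
  refine ⟨B w w, hp w hw0, fun v => ?_⟩
  rcases eq_or_ne v 0 with rfl | hv
  · simp
  have h1 : ‖v‖⁻¹ • v ∈ Metric.sphere (0 : E) 1 := by simp [norm_smul, hv]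
  have h2 : B w w ≤ B (‖v‖⁻¹ • v) (‖v‖⁻¹ • v) := hmin h1
  have h3 : 0 < ‖v‖ := norm_pos_iff.2 hv
  simp only [map_smul, smul_apply, smul_eq_mul] at h2
  calc B w w * ‖v‖ ^ 2 ≤ (‖v‖⁻¹ * (‖v‖⁻¹ * B v v)) * ‖v‖ ^ 2 := by gcongr
    _ = B v v := by field_simp

/-- A positive definite form is comparable, with constant close to one, to any nearby form. -/
theorem eventually_form_le [FiniteDimensional ℝ E] {ι : Type*} {F : Filter ι}
    {B : ι → E →L[ℝ] E →L[ℝ] ℝ} {B₀ : E →L[ℝ] E →L[ℝ] ℝ} (hB : Tendsto B F (𝓝 B₀))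
    (hp : ∀ v, v ≠ 0 → 0 < B₀ v v) {η : ℝ} (hη : 0 < η) :
    ∀ᶠ i in F, ∀ v, B₀ v v ≤ (1 + η) * B i v v := by
  obtain ⟨c, hc, hcv⟩ := exists_coercive hp
  have hδ : 0 < c * (η / (1 + η)) := by positivity
  filter_upwards [hB (Metric.ball_mem_nhds B₀ hδ)] with i hi v
  have h1 : ‖B i - B₀‖ < c * (η / (1 + η)) := by simpa [dist_eq_norm] using hi
  have h2 : |B i v v - B₀ v v| ≤ c * (η / (1 + η)) * ‖v‖ ^ 2 := by
    calc |B i v v - B₀ v v| = ‖(B i - B₀) v v‖ := by simp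
      _ ≤ ‖B i - B₀‖ * ‖v‖ * ‖v‖ := (B i - B₀).le_opNorm₂ v v
      _ ≤ c * (η / (1 + η)) * ‖v‖ * ‖v‖ := by gcongr
      _ = _ := by ring
  have h3 : c * (η / (1 + η)) * ‖v‖ ^ 2 ≤ (η / (1 + η)) * B₀ v v := by
    calc c * (η / (1 + η)) * ‖v‖ ^ 2 = (η / (1 + η)) * (c * ‖v‖ ^ 2) := by ring
      _ ≤ _ := by gcongr; exact hcv v
  have h4 := (abs_le.1 (h2.trans h3)).1
  have h5 : B₀ v v * (1 - η / (1 + η)) ≤ B i v v := by linarith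
  have h6 : (1 - η / (1 + η)) = 1 / (1 + η) := by field_simp; ring
  rw [h6, mul_one_div, div_le_iff₀ (by positivity)] at h5
  linarith

end FormEstimates

/-! ### Defining functions near the boundary -/

section BoundaryLimits

variable {E F : Type*} [NormedAddCommGroup E] [NormedSpace ℝ E] [NormedAddCommGroup F]
  [NormedSpace ℝ F]

/-- The first two derivatives of a function of class `C^2` up to the boundary have limits at
boundary points. -/
theorem tendsto_fderiv_boundary {f : E → F} {t T : Set E} (ht : UniqueDiffOn ℝ t) (hT : IsOpen T)
    (hTt : T ⊆ t) (hf : ContDiffOn ℝ 2 f t) {b : E} (hb : b ∈ t) :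
    Tendsto (fderiv ℝ f) (𝓝[T] b) (𝓝 (fderivWithin ℝ f t b)) ∧
    Tendsto (fderiv ℝ (fderiv ℝ f)) (𝓝[T] b)
      (𝓝 (fderivWithin ℝ (fderivWithin ℝ f t) t b)) := by
  have h1 : ContDiffOn ℝ 1 (fderivWithin ℝ f t) t := hf.fderivWithin ht (by norm_num)
  have h2 : ContDiffOn ℝ 0 (fderivWithin ℝ (fderivWithin ℝ f t) t) t :=
    h1.fderivWithin ht (by norm_num)
  have e1 : ∀ y ∈ T, fderivWithin ℝ f t y = fderiv ℝ f y := fun y hy =>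
    fderivWithin_of_mem_nhds (mem_of_superset (hT.mem_nhds hy) hTt)
  have e2 : ∀ y ∈ T, fderivWithin ℝ (fderivWithin ℝ f t) t y = fderiv ℝ (fderiv ℝ f) y := by
    intro y hy
    rw [fderivWithin_of_mem_nhds (mem_of_superset (hT.mem_nhds hy) hTt)]
    refine Filter.EventuallyEq.fderiv_eq ?_
    filter_upwards [hT.mem_nhds hy] with z hz using e1 z hz
  constructor
  · refine ((h1.continuousOn b hb).mono_left (nhdsWithin_mono b hTt)).congr' ?_
    filter_upwards [self_mem_nhdsWithin] with y hy using e1 y hy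
  · refine ((h2.continuousOn b hb).mono_left (nhdsWithin_mono b hTt)).congr' ?_
    filter_upwards [self_mem_nhdsWithin] with y hy using e2 y hy

end BoundaryLimits

section Boundary

theorem two_le_infty : (2 : WithTop ℕ∞) ≤ (∞ : WithTop ℕ∞) := by
  rw [show (2 : WithTop ℕ∞) = ((2 : ℕ∞) : WithTop ℕ∞) from rfl]
  exact WithTop.coe_le_coe.2 le_top

variable {n : ℕ} {X : Type*} [TopologicalSpace X] [ChartedSpace (EuclideanHalfSpace (n + 1)) X]
  [IsManifold (𝓡∂ (n + 1)) ∞ X]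

theorem contDiffOn_definingFunction {r : X → ℝ} (hr : IsDefiningFunction n r) (x₀ : X) :
    ContDiffOn ℝ 2 (r ∘ (extChartAt (𝓡∂ (n + 1)) x₀).symm)
      (extChartAt (𝓡∂ (n + 1)) x₀).target := by
  rw [← contMDiffOn_iff_contDiffOn]
  have h : ContMDiff (𝓡∂ (n + 1)) 𝓘(ℝ) 2 r := hr.smooth.of_le two_le_infty
  exact h.comp_contMDiffOn ((contMDiffOn_extChartAt_symm x₀).of_le (n := ∞) two_le_infty)

/-- In every chart the metric is conformal to the compactified one. -/
theorem coordForm_eq_conformal {r : X → ℝ} (hr : IsDefiningFunction n r) {g h : FormField n X}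
    (hgh : ∀ x ∈ (𝓡∂ (n + 1)).interior X, h x = r x ^ 2 • g x) (x₀ : X) :
    ∀ y ∈ interiorTarget n x₀, 0 < r ((extChartAt (𝓡∂ (n + 1)) x₀).symm y) ∧
    coordForm g x₀ y =
      (r ((extChartAt (𝓡∂ (n + 1)) x₀).symm y))⁻¹ ^ 2 • coordForm h x₀ y := by
  intro y hy
  have hx := (mem_interior_iff_coord x₀ hy.1).2 hy.2
  have hr0 := hr.pos _ hx
  refine ⟨hr0, ?_⟩
  ext v w
  simp only [smul_apply, smul_eq_mul]
  rw [coordForm_apply, coordForm_apply, hgh _ hx]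
  simp only [smul_apply, smul_eq_mul]
  field_simp

/-- At a boundary point the differential of a defining function is a positive multiple of the
first coordinate. -/
theorem exists_fderivWithin_definingFunction {r : X → ℝ} (hr : IsDefiningFunction n r) {x₀ : X}
    (hx₀ : x₀ ∈ (𝓡∂ (n + 1)).boundary X) :
    ∃ s > 0, ∀ v, fderivWithin ℝ (r ∘ (extChartAt (𝓡∂ (n + 1)) x₀).symm)
      (extChartAt (𝓡∂ (n + 1)) x₀).target (extChartAt (𝓡∂ (n + 1)) x₀ x₀) v = s * v 0 := by
  set t := (extChartAt (𝓡∂ (n + 1)) x₀).target with ht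
  set b := extChartAt (𝓡∂ (n + 1)) x₀ x₀ with hb
  set ρ := r ∘ (extChartAt (𝓡∂ (n + 1)) x₀).symm with hρ
  have hbt : b ∈ t := mem_extChartAt_target x₀
  have hb0 : b 0 = 0 := (mem_boundary_iff_coord x₀ hbt).1 (by rwa [hb, extChartAt_to_inv])
  have htn : t ∈ 𝓝[range (𝓡∂ (n + 1))] b := extChartAt_target_mem_nhdsWithin x₀
  have hρ0 : ∀ y ∈ t, y 0 = 0 → ρ y = 0 := fun y hy h0 =>
    hr.zero _ ((mem_boundary_iff_coord x₀ hy).2 h0)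
  have hρd : HasFDerivWithinAt ρ (fderivWithin ℝ ρ t b) t b :=
    (((contDiffOn_definingFunction hr x₀) b hbt).differentiableWithinAt
      (by norm_num)).hasFDerivWithinAt
  have hρnn : ∀ y ∈ t, 0 ≤ ρ y := by
    intro y hy
    have h1 : y ∈ range (𝓡∂ (n + 1)) := extChartAt_target_subset_range x₀ hy
    rw [range_model] at h1
    rcases (show (0 : ℝ) ≤ y 0 from h1).eq_or_lt with h | h
    · exact (hρ0 y hy h.symm).ge
    · exact (hr.pos _ ((mem_interior_iff_coord x₀ hy).2 h)).le
  have hρb : ρ b = 0 := hρ0 b hbt hb0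
  -- the line through `b` in the direction `v`
  have hline : ∀ v : Model n, 0 ≤ v 0 → ∀ᶠ τ : ℝ in 𝓝[>] 0, b + τ • v ∈ t := by
    intro v hv
    have hc : Tendsto (fun τ : ℝ => b + τ • v) (𝓝[>] 0) (𝓝[range (𝓡∂ (n + 1))] b) := by
      refine tendsto_nhdsWithin_iff.2 ⟨?_, ?_⟩
      · have : Continuous fun τ : ℝ => b + τ • v := by fun_prop
        simpa using (this.tendsto 0).mono_left nhdsWithin_le_nhds
      · filter_upwards [self_mem_nhdsWithin] with τ hτ
        rw [range_model]
        have : (0 : ℝ) < τ := hτ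
        simp only [mem_ofPred_eq, PiLp.add_apply, PiLp.smul_apply, hb0, smul_eq_mul]
        positivity
    exact hc htn
  have hlim : ∀ v : Model n, 0 ≤ v 0 →
      Tendsto (fun τ : ℝ => τ⁻¹ * ρ (b + τ • v)) (𝓝[>] 0) (𝓝 (fderivWithin ℝ ρ t b v)) := by
    intro v hv
    have h1 := hρd.lim (α := ℝ) (l := 𝓝[>] 0) (c := fun τ => τ⁻¹) (d := fun τ => τ • v) (v := v)
      ?_ (hline v hv) ?_
    · simpa only [hρb, sub_zero, smul_eq_mul] using h1
    · have : Continuous fun τ : ℝ => τ • v := by fun_prop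
      simpa using (this.tendsto 0).mono_left nhdsWithin_le_nhds
    · refine tendsto_const_nhds.congr' ?_
      filter_upwards [self_mem_nhdsWithin] with τ hτ
      have : (0 : ℝ) < τ := hτ
      rw [smul_smul, inv_mul_cancel₀ this.ne', one_smul]
  have htan : ∀ v : Model n, v 0 = 0 → fderivWithin ℝ ρ t b v = 0 := by
    intro v hv
    refine tendsto_nhds_unique (hlim v hv.ge) (tendsto_const_nhds.congr' ?_)
    filter_upwards [hline v hv.ge] with τ hτ
    rw [hρ0 _ hτ (by simp [hb0, hv]), mul_zero]
  set e₀ : Model n := EuclideanSpace.single 0 1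
  have hall : ∀ v : Model n, fderivWithin ℝ ρ t b v = fderivWithin ℝ ρ t b e₀ * v 0 := by
    intro v
    have h1 := htan (v - v 0 • e₀) (by simp [e₀])
    rw [map_sub, map_smul, sub_eq_zero] at h1
    rw [h1, smul_eq_mul, mul_comm]
  have hnn : 0 ≤ fderivWithin ℝ ρ t b e₀ := by
    refine ge_of_tendsto (hlim e₀ (by simp [e₀])) ?_
    filter_upwards [hline e₀ (by simp [e₀]), self_mem_nhdsWithin] with τ hτ hτ0
    have : (0 : ℝ) < τ := hτ0
    exact mul_nonneg (by positivity) (hρnn _ hτ)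
  have hne : fderivWithin ℝ ρ t b e₀ ≠ 0 := by
    intro h0
    refine hr.diff_ne_zero x₀ hx₀ ?_
    have hz : fderivWithin ℝ ρ t b = 0 := by
      ext v; rw [hall, h0, zero_mul]; rfl
    have hmd : MDifferentiableAt (𝓡∂ (n + 1)) 𝓘(ℝ) r x₀ :=
      hr.smooth.mdifferentiable (by simp) x₀
    have h1 : mfderiv (𝓡∂ (n + 1)) 𝓘(ℝ) r x₀ = fderivWithin ℝ ρ (range (𝓡∂ (n + 1))) b := by
      exact hmd.mfderiv
    have h2 : fderivWithin ℝ ρ (range (𝓡∂ (n + 1))) b = fderivWithin ℝ ρ t b :=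
      (fderivWithin_congr_set extChartAt_target_eventuallyEq).symm
    ext v
    change mfderiv (𝓡∂ (n + 1)) 𝓘(ℝ) r x₀ v = 0
    rw [h1, h2, hz]
    rfl
  exact ⟨_, lt_of_le_of_ne hnn hne.symm, hall⟩

/-- Near a boundary point a defining function is comparable to the first coordinate. -/
theorem eventually_definingFunction {r : X → ℝ} (hr : IsDefiningFunction n r) {x₀ : X}
    (hx₀ : x₀ ∈ (𝓡∂ (n + 1)).boundary X) {s : ℝ}
    (hs : ∀ v, fderivWithin ℝ (r ∘ (extChartAt (𝓡∂ (n + 1)) x₀).symm)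
      (extChartAt (𝓡∂ (n + 1)) x₀).target (extChartAt (𝓡∂ (n + 1)) x₀ x₀) v = s * v 0)
    {η : ℝ} (hη : 0 < η) :
    ∀ᶠ y in 𝓝[range (𝓡∂ (n + 1))] (extChartAt (𝓡∂ (n + 1)) x₀ x₀),
      |r ((extChartAt (𝓡∂ (n + 1)) x₀).symm y) - s * y 0| ≤ η * y 0 := by
  set t := (extChartAt (𝓡∂ (n + 1)) x₀).target with ht
  set b := extChartAt (𝓡∂ (n + 1)) x₀ x₀ with hb
  set ρ := r ∘ (extChartAt (𝓡∂ (n + 1)) x₀).symm with hρ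
  have hbt : b ∈ t := mem_extChartAt_target x₀
  have hb0 : b 0 = 0 := (mem_boundary_iff_coord x₀ hbt).1 (by rwa [hb, extChartAt_to_inv])
  have htn : t ∈ 𝓝[range (𝓡∂ (n + 1))] b := extChartAt_target_mem_nhdsWithin x₀
  have hρc := contDiffOn_definingFunction hr x₀
  have hut : UniqueDiffOn ℝ t := uniqueDiffOn_extChartAt_target x₀
  have hcont := (hρc.continuousOn_fderivWithin hut (by norm_num)) b hbt
  have hev : ∀ᶠ y in 𝓝[range (𝓡∂ (n + 1))] b,
      y ∈ t ∧ ‖fderivWithin ℝ ρ t y - fderivWithin ℝ ρ t b‖ ≤ η := by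
    have h1 : ∀ᶠ y in 𝓝[t] b, ‖fderivWithin ℝ ρ t y - fderivWithin ℝ ρ t b‖ ≤ η := by
      filter_upwards [hcont (Metric.closedBall_mem_nhds _ hη)] with y hy
      rw [← dist_eq_norm]
      exact Metric.mem_closedBall.1 hy
    rw [nhdsWithin_extChartAt_target_eq] at h1
    exact (eventually_of_mem htn fun y hy => hy).and h1
  obtain ⟨R, hR, hball⟩ := Metric.mem_nhdsWithin_iff.1 hev
  refine Metric.mem_nhdsWithin_iff.2 ⟨R, hR, ?_⟩
  intro y hy
  have hconv : Convex ℝ (Metric.ball b R ∩ range (𝓡∂ (n + 1))) :=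
    (convex_ball b R).inter (𝓡∂ (n + 1)).convex_range
  -- compare `y` with its projection `z` to the boundary, where the defining function vanishes
  let z : Model n := y - y 0 • EuclideanSpace.single 0 1
  have hz0 : z 0 = 0 := by simp [z]
  have hzi : ∀ i, i ≠ 0 → z i = y i := by intro i hi; simp [z, hi]
  have hz : z ∈ Metric.ball b R ∩ range (𝓡∂ (n + 1)) := by
    refine ⟨?_, by rw [range_model]; exact hz0.ge⟩
    have h1 := hy.1
    rw [Metric.mem_ball, EuclideanSpace.dist_eq] at h1 ⊢
    refine lt_of_le_of_lt (Real.sqrt_le_sqrt (Finset.sum_le_sum fun i _ => ?_)) h1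
    rcases eq_or_ne i 0 with rfl | hi
    · rw [hz0, hb0, dist_self]; exact le_of_eq_of_le (by simp) (sq_nonneg _)
    · rw [hzi i hi]
  have h1 := hconv.norm_image_sub_le_of_norm_hasFDerivWithin_le' (f := ρ)
    (f' := fderivWithin ℝ ρ t) (φ := fderivWithin ℝ ρ t b) (C := η) (x := z) (y := y)
    (fun w hw => ((hρc w (hball hw).1).differentiableWithinAt
      (by norm_num)).hasFDerivWithinAt.mono fun v hv => (hball hv).1)
    (fun w hw => (hball hw).2) hz hy
  have hy0 : 0 ≤ y 0 := by
    have := hy.2; rw [range_model] at this; exact this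
  have hρz : ρ z = 0 := hr.zero _ ((mem_boundary_iff_coord x₀ (hball hz).1).2 hz0)
  have hyz : y - z = y 0 • EuclideanSpace.single 0 1 := by simp [z]
  rw [hs, hρz, hyz, norm_smul] at h1
  have h2 : |ρ y - s * y 0| ≤ η * y 0 := by
    simpa only [sub_zero, PiLp.smul_apply, PiLp.single_apply, if_true, smul_eq_mul,
      mul_one, Real.norm_eq_abs, abs_of_nonneg hy0, PiLp.norm_single, norm_one,
      abs_one] using h1
  exact h2

end Boundary

/-! ### Asymptotically hyperbolic metrics on half balls -/

section LocalModel

variable {n : ℕ} {X : Type*} [TopologicalSpace X] [ChartedSpace (EuclideanHalfSpace (n + 1)) X]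
  [IsManifold (𝓡∂ (n + 1)) ∞ X]

theorem coordForm_pos {h : FormField n X}
    (hpos : ∀ x (v : TangentSpace (𝓡∂ (n + 1)) x), v ≠ 0 → 0 < h x v v) (x₀ : X) {y : Model n}
    (hy : y ∈ (extChartAt (𝓡∂ (n + 1)) x₀).target) {v : Model n} (hv : v ≠ 0) :
    0 < coordForm h x₀ y v v := by
  refine hpos _ _ fun h0 => hv ((coordFrame_bijective x₀ hy).1 (h0.trans ?_))
  exact (map_zero _).symm

/-- The sectional curvatures of `g = r⁻² h` tend to `-|dr|²_h` at the boundary, so these are `-κ²`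
for an asymptotically hyperbolic metric. The conclusion is the inequality `|dr(v)| ≤ κ |v|_h` in
coordinates. -/
theorem fderivWithin_sq_le_of_curvature (hn : n ≠ 0) {r : X → ℝ} (hr : IsDefiningFunction n r)
    {g h : FormField n X} (hgh : ∀ x ∈ (𝓡∂ (n + 1)).interior X, h x = r x ^ 2 • g x) {κ : ℝ}
    {x₀ : X} (hx₀ : x₀ ∈ (𝓡∂ (n + 1)).boundary X)
    (hpos : ∀ x (v : TangentSpace (𝓡∂ (n + 1)) x), v ≠ 0 → 0 < h x v v)
    (hsymm : ∀ x (v w : TangentSpace (𝓡∂ (n + 1)) x), h x v w = h x w v)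
    (hh : ContDiffOn ℝ 3 (coordForm h x₀) (extChartAt (𝓡∂ (n + 1)) x₀).target)
    (hK : ∀ ε > 0, ∀ᶠ y in 𝓝[interior (range (𝓡∂ (n + 1)))] (extChartAt (𝓡∂ (n + 1)) x₀ x₀),
      ∀ u v : Model n, LinearIndependent ℝ ![u, v] →
        |sectionalCurvature (coordForm g x₀) y u v - (-κ ^ 2)| < ε) (v : Model n) :
    (fderivWithin ℝ (r ∘ (extChartAt (𝓡∂ (n + 1)) x₀).symm)
      (extChartAt (𝓡∂ (n + 1)) x₀).target (extChartAt (𝓡∂ (n + 1)) x₀ x₀) v) ^ 2 ≤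
      κ ^ 2 * coordForm h x₀ (extChartAt (𝓡∂ (n + 1)) x₀ x₀) v v := by
  set t := (extChartAt (𝓡∂ (n + 1)) x₀).target with ht
  set b := extChartAt (𝓡∂ (n + 1)) x₀ x₀ with hb
  set ρ := r ∘ (extChartAt (𝓡∂ (n + 1)) x₀).symm with hρ
  set H := coordForm h x₀
  set T := interiorTarget n x₀
  have hbt : b ∈ t := mem_extChartAt_target x₀
  have hb0 : b 0 = 0 := (mem_boundary_iff_coord x₀ hbt).1 (by rwa [hb, extChartAt_to_inv])
  have hTo : IsOpen T := isOpen_interiorTarget x₀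
  have hTt : T ⊆ t := inter_subset_left
  have hut : UniqueDiffOn ℝ t := uniqueDiffOn_extChartAt_target x₀
  have hρc : ContDiffOn ℝ 2 ρ t := contDiffOn_definingFunction hr x₀
  have hHc : ContDiffOn ℝ 2 H t := hh.of_le (by norm_num)
  obtain ⟨tρ₁, tρ₂⟩ := tendsto_fderiv_boundary hut hTo hTt hρc hbt
  obtain ⟨tH₁, tH₂⟩ := tendsto_fderiv_boundary hut hTo hTt hHc hbt
  have hρb : ρ b = 0 := hr.zero _ ((mem_boundary_iff_coord x₀ hbt).2 hb0)
  have tρ : Tendsto ρ (𝓝[T] b) (𝓝 0) := by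
    rw [← hρb]; exact (hρc.continuousOn b hbt).mono_left (nhdsWithin_mono b hTt)
  have tH : Tendsto H (𝓝[T] b) (𝓝 (H b)) :=
    (hHc.continuousOn b hbt).mono_left (nhdsWithin_mono b hTt)
  have hHpos : ∀ y ∈ t, ∀ v, v ≠ 0 → 0 < H y v v := fun y hy v hv => coordForm_pos hpos x₀ hy hv
  have hHs : ∀ y v w, H y v w = H y w v := fun y v w => hsymm _ _ _
  have hconf := coordForm_eq_conformal hr hgh x₀
  set ρ₁ := fderivWithin ℝ ρ t b
  obtain ⟨ν, hν⟩ := (isInvertible_of_pos (hHpos b hbt)).bijective.2 ρ₁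
  -- a plane to which the curvature hypothesis applies
  obtain ⟨u, w, huw⟩ : ∃ u w : Model n, LinearIndependent ℝ ![u, w] := by
    refine ⟨EuclideanSpace.single 0 1, EuclideanSpace.single (Fin.last n) 1, ?_⟩
    rw [LinearIndependent.pair_iff]
    intro a c hac
    have hne : Fin.last n ≠ 0 := by
      rw [Ne, Fin.ext_iff]; simpa using hn
    have h0 := congrArg (fun z : Model n => z 0) hac
    have h1 := congrArg (fun z : Model n => z (Fin.last n)) hac
    simp [hne, hne.symm] at h0 h1
    exact ⟨h0, h1⟩
  have hTmem : T ∈ 𝓝[T] b := self_mem_nhdsWithin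
  have hR := tendsto_riemannBiquadratic_conformal (ρ := ρ) (H := H) (G := coordForm g x₀) hTo
    (hρc.mono hTt) (hHc.mono hTt) (fun y hy => (hconf y hy).1.ne') (fun y hy => (hconf y hy).2)
    hTmem tρ tρ₁ tρ₂ tH tH₁ tH₂ (hHpos b hbt) (hHs b) hν u w
  have hD : Tendsto (fun y => H y u u * H y w w - H y u w ^ 2) (𝓝[T] b)
      (𝓝 (H b u u * H b w w - H b u w ^ 2)) := by
    have s : ∀ a c, Tendsto (fun y => H y a c) (𝓝[T] b) (𝓝 (H b a c)) := fun a c =>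
      tendsto_clm_apply (tendsto_clm_apply tH a) c
    exact ((s u u).mul (s w w)).sub ((s u w).pow 2)
  have hD0 : H b u u * H b w w - H b u w ^ 2 ≠ 0 :=
    (sub_pos.2 (bilin_sq_lt (hHs b) (hHpos b hbt) huw)).ne'
  have hsec : Tendsto (fun y => sectionalCurvature (coordForm g x₀) y u w) (𝓝[T] b)
      (𝓝 (-(ρ₁ ν))) := by
    have := hR.div hD hD0
    rw [mul_div_cancel_right₀ _ hD0] at this
    refine this.congr' ?_
    filter_upwards [hTmem] with y hy
    have hρy : ρ y ≠ 0 := (hconf y hy).1.ne'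
    have hDy : H y u u * H y w w - H y u w ^ 2 ≠ 0 :=
      (sub_pos.2 (bilin_sq_lt (hHs y) (hHpos y (hTt hy)) huw)).ne'
    rw [sectionalCurvature, (hconf y hy).2]
    change _ = _ / ((ρ y)⁻¹ ^ 2 * H y u u * ((ρ y)⁻¹ ^ 2 * H y w w) - ((ρ y)⁻¹ ^ 2 * H y u w) ^ 2)
    have e : (ρ y)⁻¹ ^ 2 * H y u u * ((ρ y)⁻¹ ^ 2 * H y w w) - ((ρ y)⁻¹ ^ 2 * H y u w) ^ 2 =
      (H y u u * H y w w - H y u w ^ 2) / ρ y ^ 4 := by field_simp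
    rw [e]
    simp only [Pi.div_apply]
    field_simp
  have hTr : 𝓝[T] b = 𝓝[interior (range (𝓡∂ (n + 1)))] b := by
    rw [interior_range_model]
    have h1 : T = t ∩ {y : Model n | 0 < y 0} := rfl
    have h2 : t ∈ 𝓝[{y : Model n | 0 < y 0}] b := by
      refine nhdsWithin_mono b ?_ (extChartAt_target_mem_nhdsWithin (I := 𝓡∂ (n + 1)) x₀)
      rw [range_model]
      intro y hy
      exact (show (0 : ℝ) < y 0 from hy).le
    rw [h1, inter_comm]
    exact nhdsWithin_inter_of_mem' h2
  have hlim : Tendsto (fun y => sectionalCurvature (coordForm g x₀) y u w) (𝓝[T] b)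
      (𝓝 (-κ ^ 2)) := by
    rw [Metric.tendsto_nhds]
    intro ε hε
    have := hK ε hε
    rw [← hTr] at this
    filter_upwards [this] with y hy using hy u w huw
  have hne : (𝓝[T] b).NeBot := by
    rw [hTr, ← mem_closure_iff_nhdsWithin_neBot,
      (𝓡∂ (n + 1)).range_eq_closure_interior.symm]
    exact extChartAt_target_subset_range x₀ hbt
  have hκ : ρ₁ ν = κ ^ 2 := by
    have := tendsto_nhds_unique hsec hlim
    linarith
  -- `ν` is the gradient of `ρ` at `b`, so this is the Cauchy-Schwarz inequality for `dρ(v)`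
  have hcs := bilin_sq_le (hHs b) (hHpos b hbt) ν v
  rw [hν, hκ] at hcs
  exact hcs

theorem gramDet_pos {B : Model n →L[ℝ] Model n →L[ℝ] ℝ} (hs : ∀ v w, B v w = B w v)
    (hp : ∀ v, v ≠ 0 → 0 < B v v) :
    0 < (Matrix.of fun i j : Fin (n + 1) =>
      B (EuclideanSpace.single i 1) (EuclideanSpace.single j 1)).det := by
  refine Matrix.PosDef.det_pos (Matrix.PosDef.of_dotProduct_mulVec_pos ?_ ?_)
  · ext i j; simp [Matrix.conjTranspose_apply, hs]
  · intro x hx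
    have hx' : (WithLp.toLp 2 x : Model n) ≠ 0 := by
      intro h; exact hx (by simpa using h)
    have h1 := hp _ hx'
    have h2 : (WithLp.toLp 2 x : Model n) = ∑ i, x i • EuclideanSpace.single i (1 : ℝ) := by
      ext j; simp [Finset.sum_apply, Pi.single_apply]
    have h3 : star x ⬝ᵥ (Matrix.of (fun i j : Fin (n + 1) =>
        B (EuclideanSpace.single i 1) (EuclideanSpace.single j 1))).mulVec x =
        B (WithLp.toLp 2 x) (WithLp.toLp 2 x) := by
      rw [h2]
      simp only [map_sum, map_smul, sum_apply, smul_apply, smul_eq_mul,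
        dotProduct, Matrix.mulVec, Matrix.of_apply, star_trivial, Finset.mul_sum]
      rw [Finset.sum_comm]
      refine Finset.sum_congr rfl fun i _ => Finset.sum_congr rfl fun j _ => ?_
      ring
    rw [h3]
    exact h1

omit [IsManifold (𝓡∂ (n + 1)) ∞ X] in
theorem volumeDensity_smul (g h : FormField n X) (x₀ : X) {y : Model n} {c : ℝ} (hc : 0 ≤ c)
    (hgh : coordForm g x₀ y = c ^ 2 • coordForm h x₀ y) :
    volumeDensity g x₀ y = c ^ (n + 1) * volumeDensity h x₀ y := by
  rw [volumeDensity, volumeDensity, hgh]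
  have : (Matrix.of fun i j : Fin (n + 1) => (c ^ 2 • coordForm h x₀ y)
      (EuclideanSpace.single i 1) (EuclideanSpace.single j 1)) =
      c ^ 2 • (Matrix.of fun i j : Fin (n + 1) => coordForm h x₀ y
      (EuclideanSpace.single i 1) (EuclideanSpace.single j 1)) := by
    ext i j; simp
  rw [this, Matrix.det_smul, Fintype.card_fin, ← pow_mul, mul_comm 2, pow_mul,
    Real.sqrt_mul (sq_nonneg _), Real.sqrt_sq (by positivity)]

/-- Uniform bounds for a metric given in coordinates, with volume density `dens`, on the half ball
of radius `R` about a boundary point `b` of the half space: the length of `d(log y₀)` is at most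
`k`, and lengths of vectors and volumes are comparable to those of the metric `|dy|²/y₀²`. Only the
constant `k` has to be sharp. -/
structure HalfBallBounds (G : Model n → Model n →L[ℝ] Model n →L[ℝ] ℝ) (dens : Model n → ℝ)
    (b : Model n) (R k c C : ℝ) : Prop where
  pos : ∀ y ∈ Metric.ball b R, 0 < y 0 → ∀ v, v ≠ 0 → 0 < G y v v
  coord : ∀ y ∈ Metric.ball b R, 0 < y 0 → ∀ v, |v 0| ≤ k * y 0 * √(G y v v)
  norm : ∀ y ∈ Metric.ball b R, 0 < y 0 → ∀ v, ‖v‖ ≤ C * y 0 * √(G y v v)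
  dens_lower : ∀ y ∈ Metric.ball b R, 0 < y 0 → c * (y 0)⁻¹ ^ (n + 1) ≤ dens y
  dens_upper : ∀ y ∈ Metric.ball b R, 0 < y 0 → dens y ≤ C * (y 0)⁻¹ ^ (n + 1)

/-- A conformal metric `ρ⁻² H` satisfies such bounds where `ρ` is comparable to `y₀` and `H` to a
fixed inner product `H₀`. If `ρ` is close to `s * y₀` and `H` is close to `H₀`, that is for small
`η`, the length of `d(log y₀)` is almost that of `s⁻¹ dy₀` with respect to `H₀`. -/
theorem halfBallBounds_of_conformal {G H : Model n → Model n →L[ℝ] Model n →L[ℝ] ℝ}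
    {H₀ : Model n →L[ℝ] Model n →L[ℝ] ℝ} {dens densH ρ : Model n → ℝ} {b : Model n}
    {R s η c₀ d A : ℝ} (hs0 : 0 < s) (hη0 : 0 < η) (hc₀ : 0 < c₀) (hd0 : 0 < d) (hA : 0 ≤ A)
    (hco : ∀ v, c₀ * ‖v‖ ^ 2 ≤ H₀ v v) (hcoord : ∀ v, s * |v 0| ≤ A * √(H₀ v v))
    (hρ : ∀ y ∈ Metric.ball b R, 0 < y 0 → s / 2 * y 0 ≤ ρ y ∧ ρ y ≤ s * (1 + η) * y 0)
    (hρ' : ∀ y ∈ Metric.ball b R, 0 < y 0 → ρ y ≤ 2 * s * y 0)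
    (hG : ∀ y ∈ Metric.ball b R, 0 < y 0 → G y = (ρ y)⁻¹ ^ 2 • H y)
    (hH : ∀ y ∈ Metric.ball b R, 0 < y 0 → ∀ v, H₀ v v ≤ (1 + η) * H y v v)
    (hdens : ∀ y ∈ Metric.ball b R, 0 < y 0 → dens y = (ρ y)⁻¹ ^ (n + 1) * densH y)
    (hd : ∀ y ∈ Metric.ball b R, 0 < y 0 → d / 2 ≤ densH y ∧ densH y ≤ 2 * d) :
    HalfBallBounds G dens b R (A * (1 + η) ^ 2) ((1 / (2 * s)) ^ (n + 1) * (d / 2))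
      (max ((√c₀)⁻¹ * (s * (1 + η) ^ 2)) ((2 / s) ^ (n + 1) * (2 * d))) := by
  have hρ0 : ∀ y ∈ Metric.ball b R, 0 < y 0 → 0 < ρ y := fun y hy hy0 =>
    lt_of_lt_of_le (by positivity) (hρ y hy hy0).1
  have hGv : ∀ y ∈ Metric.ball b R, 0 < y 0 → ∀ v, G y v v = (ρ y)⁻¹ ^ 2 * H y v v := by
    intro y hy hy0 v
    rw [hG y hy hy0]; rfl
  have hH0 : ∀ v, 0 ≤ H₀ v v := fun v => le_trans (by positivity) (hco v)
  have hlen : ∀ y ∈ Metric.ball b R, 0 < y 0 → ∀ v,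
      √(H₀ v v) ≤ s * (1 + η) ^ 2 * y 0 * √(G y v v) := by
    intro y hy hy0 v
    have hρy := hρ0 y hy hy0
    have h4 : √(G y v v) = (ρ y)⁻¹ * √(H y v v) := by
      rw [hGv y hy hy0, Real.sqrt_mul (sq_nonneg _), Real.sqrt_sq (by positivity)]
    have hp : 0 ≤ (1 + η) * H y v v := (hH0 v).trans (hH y hy hy0 v)
    have h5 : √(H₀ v v) ≤ (1 + η) * √(H y v v) := by
      rw [Real.sqrt_le_left (by positivity), mul_pow, Real.sq_sqrt]
      · nlinarith [hH y hy hy0 v]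
      · exact nonneg_of_mul_nonneg_right hp (by positivity)
    have h6 : √(H y v v) = ρ y * √(G y v v) := by
      rw [h4, mul_inv_cancel_left₀ hρy.ne']
    have h7 := (hρ y hy hy0).2
    calc √(H₀ v v) ≤ (1 + η) * (ρ y * √(G y v v)) := by rw [← h6]; exact h5
      _ ≤ (1 + η) * ((s * (1 + η) * y 0) * √(G y v v)) := by gcongr
      _ = _ := by ring
  have hc₀' : 0 < √c₀ := Real.sqrt_pos.2 hc₀
  refine ⟨fun y hy hy0 v hv => ?_, fun y hy hy0 v => ?_, fun y hy hy0 v => ?_,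
    fun y hy hy0 => ?_, fun y hy hy0 => ?_⟩
  · have hρy := hρ0 y hy hy0
    have hv0 : 0 < ‖v‖ := norm_pos_iff.2 hv
    have h1 : 0 < (1 + η) * H y v v :=
      lt_of_lt_of_le (by positivity) ((hco v).trans (hH y hy hy0 v))
    have h2 : 0 < H y v v := pos_of_mul_pos_right h1 (by positivity)
    rw [hGv y hy hy0]
    positivity
  · have h3 := hlen y hy hy0 v
    refine le_of_mul_le_mul_left ?_ hs0
    calc s * |v 0| ≤ A * √(H₀ v v) := hcoord v
      _ ≤ A * (s * (1 + η) ^ 2 * y 0 * √(G y v v)) := by gcongr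
      _ = _ := by ring
  · have h1 : √c₀ * ‖v‖ ≤ √(H₀ v v) := by
      rw [← Real.sqrt_sq (norm_nonneg v), ← Real.sqrt_mul hc₀.le]
      exact Real.sqrt_le_sqrt (hco v)
    have h2 := h1.trans (hlen y hy hy0 v)
    calc ‖v‖ = (√c₀)⁻¹ * (√c₀ * ‖v‖) := by rw [inv_mul_cancel_left₀ hc₀'.ne']
      _ ≤ (√c₀)⁻¹ * (s * (1 + η) ^ 2 * y 0 * √(G y v v)) := by gcongr
      _ = (√c₀)⁻¹ * (s * (1 + η) ^ 2) * y 0 * √(G y v v) := by ring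
      _ ≤ _ := by gcongr; exact le_max_left _ _
  · have h6 : (1 / (2 * s)) * (y 0)⁻¹ ≤ (ρ y)⁻¹ := by
      rw [one_div, ← mul_inv]
      exact inv_anti₀ (hρ0 y hy hy0) (hρ' y hy hy0)
    rw [hdens y hy hy0]
    calc (1 / (2 * s)) ^ (n + 1) * (d / 2) * (y 0)⁻¹ ^ (n + 1)
        = ((1 / (2 * s)) * (y 0)⁻¹) ^ (n + 1) * (d / 2) := by rw [mul_pow]; ring
      _ ≤ (ρ y)⁻¹ ^ (n + 1) * densH y :=
        mul_le_mul (pow_le_pow_left₀ (by positivity) h6 _) (hd y hy hy0).1 (by positivity)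
          (pow_nonneg (inv_nonneg.2 (hρ0 y hy hy0).le) _)
  · have h6 : (ρ y)⁻¹ ≤ (2 / s) * (y 0)⁻¹ := by
      rw [← inv_div, ← mul_inv]
      exact inv_anti₀ (by positivity) (hρ y hy hy0).1
    have h7 : 0 ≤ densH y := le_trans (by positivity) (hd y hy hy0).1
    rw [hdens y hy hy0]
    calc (ρ y)⁻¹ ^ (n + 1) * densH y
        ≤ ((2 / s) * (y 0)⁻¹) ^ (n + 1) * (2 * d) :=
        mul_le_mul (pow_le_pow_left₀ (inv_nonneg.2 (hρ0 y hy hy0).le) h6 _) (hd y hy hy0).2 h7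
          (by positivity)
      _ = ((2 / s) ^ (n + 1) * (2 * d)) * (y 0)⁻¹ ^ (n + 1) := by rw [mul_pow]; ring
      _ ≤ _ := by gcongr; exact le_max_right _ _

/-- Near a boundary point, in the chart at that point, an asymptotically hyperbolic metric satisfies
uniform bounds on a half ball, with `k` as close to `κ` as desired. For `n = 0` there are no
curvatures, and the bound for `k` is void. -/
theorem exists_halfBallBounds {g : FormField n X} {κ : ℝ} (hκ : 0 < κ) (hg : IsAH g κ) {x₀ : X}
    (hx₀ : x₀ ∈ (𝓡∂ (n + 1)).boundary X) {ε : ℝ} (hε : 0 < ε) :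
    ∃ R k c C, 0 < R ∧ 0 ≤ k ∧ n * k ≤ n * κ + ε ∧ 0 < c ∧ 0 < C ∧
      Metric.ball (extChartAt (𝓡∂ (n + 1)) x₀ x₀) R ∩ {y | 0 < y 0} ⊆ interiorTarget n x₀ ∧
      HalfBallBounds (coordForm g x₀) (volumeDensity g x₀) (extChartAt (𝓡∂ (n + 1)) x₀ x₀)
        R k c C := by
  obtain ⟨⟨r, α, gbar, hr, -, -, -, hgh⟩, hcurv⟩ := hg
  set h : FormField n X := gbar.inner
  have hhc : ContDiffOn ℝ 3 (coordForm h x₀) (extChartAt (𝓡∂ (n + 1)) x₀).target :=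
    contDiffOn_coordForm gbar.contMDiff x₀
  set t := (extChartAt (𝓡∂ (n + 1)) x₀).target with ht
  set b := extChartAt (𝓡∂ (n + 1)) x₀ x₀ with hb
  set H := coordForm h x₀ with hH
  have hbt : b ∈ t := mem_extChartAt_target x₀
  have hHpos : ∀ v, v ≠ 0 → 0 < H b v v := fun v hv => coordForm_pos gbar.pos x₀ hbt hv
  have hHs : ∀ v w, H b v w = H b w v := fun v w => gbar.symm _ _ _
  obtain ⟨s, hs0, hs⟩ := exists_fderivWithin_definingFunction hr hx₀
  obtain ⟨c₀, hc₀, hco⟩ := exists_coercive hHpos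
  -- `η` is such that `κ (1 + η)² ≤ κ + ε / (n + 1)`
  obtain ⟨η, hη0, hη1, hηε⟩ : ∃ η > 0, η ≤ 1 ∧ κ * (1 + η) ^ 2 ≤ κ + ε / (n + 1) := by
    refine ⟨min 1 (ε / (n + 1) / (3 * κ)), by positivity, min_le_left _ _, ?_⟩
    set m := min 1 (ε / (n + 1) / (3 * κ))
    have h1 : m ≤ 1 := min_le_left _ _
    have h2 : m ≤ ε / (n + 1) / (3 * κ) := min_le_right _ _
    have h3 : 0 < m := by positivity
    rw [le_div_iff₀ (by positivity)] at h2
    nlinarith [mul_nonneg hκ.le (mul_nonneg h3.le (sub_nonneg.2 h1))]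
  have htn : ∀ᶠ y in 𝓝[range (𝓡∂ (n + 1))] b, y ∈ t := extChartAt_target_mem_nhdsWithin x₀
  have tH : Tendsto H (𝓝[range (𝓡∂ (n + 1))] b) (𝓝 (H b)) := by
    have := hhc.continuousOn b hbt
    rw [ContinuousWithinAt, nhdsWithin_extChartAt_target_eq] at this
    exact this
  have hdens : Tendsto (volumeDensity h x₀) (𝓝[range (𝓡∂ (n + 1))] b)
      (𝓝 (volumeDensity h x₀ b)) := by
    have := continuousOn_volumeDensity hhc.continuousOn b hbt
    rw [ContinuousWithinAt, nhdsWithin_extChartAt_target_eq] at this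
    exact this
  set d := volumeDensity h x₀ b with hd
  have hd0 : 0 < d := Real.sqrt_pos.2 (gramDet_pos hHs hHpos)
  have ev1 := eventually_form_le tH hHpos hη0
  have ev2 := eventually_definingFunction hr hx₀ hs (η := s * min η (1 / 2)) (by positivity)
  have ev3 : ∀ᶠ y in 𝓝[range (𝓡∂ (n + 1))] b, d / 2 ≤ volumeDensity h x₀ y ∧
      volumeDensity h x₀ y ≤ 2 * d :=
    (hdens.eventually (eventually_ge_nhds (by linarith))).and
      (hdens.eventually (eventually_le_nhds (by linarith)))
  obtain ⟨R, hR, hball⟩ := Metric.mem_nhdsWithin_iff.1 (htn.and (ev1.and (ev2.and ev3)))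
  replace hball : ∀ y ∈ Metric.ball b R, 0 < y 0 → _ := fun y hy hy0 =>
    hball ⟨hy, by rw [range_model]; exact hy0.le⟩
  have hT : ∀ y ∈ Metric.ball b R, 0 < y 0 → y ∈ interiorTarget n x₀ := fun y hy hy0 =>
    ⟨(hball y hy hy0).1, hy0⟩
  have hconf := coordForm_eq_conformal hr hgh x₀
  -- the length of `dy₀` at the boundary point, which for `n = 0` is bounded by coercivity only
  obtain ⟨A, hA0, hAκ, hA⟩ : ∃ A, 0 ≤ A ∧ (n ≠ 0 → A = κ) ∧
      ∀ v : Model n, s * |v 0| ≤ A * √(H b v v) := by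
    rcases eq_or_ne n 0 with h0 | h0
    · refine ⟨s * (√c₀)⁻¹, by positivity, fun h => absurd h0 h, fun v => ?_⟩
      have h1 : √c₀ * ‖v‖ ≤ √(H b v v) := by
        rw [← Real.sqrt_sq (norm_nonneg v), ← Real.sqrt_mul hc₀.le]
        exact Real.sqrt_le_sqrt (hco v)
      have h2 : |v 0| ≤ (√c₀)⁻¹ * √(H b v v) := by
        rw [← div_eq_inv_mul, le_div_iff₀' (Real.sqrt_pos.2 hc₀)]
        exact (mul_le_mul_of_nonneg_left (PiLp.norm_apply_le v 0) (Real.sqrt_nonneg _)).trans h1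
      rw [mul_assoc]
      exact mul_le_mul_of_nonneg_left h2 hs0.le
    · refine ⟨κ, hκ.le, fun _ => rfl, fun v => ?_⟩
      have h1 := fderivWithin_sq_le_of_curvature h0 hr hgh hx₀ gbar.pos gbar.symm hhc
        (hcurv x₀ hx₀) v
      rw [hs] at h1
      refine abs_le_of_sq_le_sq' ?_ (by positivity) |>.2
      rw [mul_pow, mul_pow, sq_abs, Real.sq_sqrt (le_trans (by positivity) (hco v)), ← mul_pow]
      exact h1
  refine ⟨R, _, _, _, hR, ?_, ?_, ?_, ?_, fun y hy => hT y hy.1 hy.2,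
    halfBallBounds_of_conformal (H₀ := H b) hs0 hη0 hc₀ hd0 hA0 hco hA (fun y hy hy0 => ?_)
      (fun y hy hy0 => ?_) (fun y hy hy0 => (hconf y (hT y hy hy0)).2)
      (fun y hy hy0 => (hball y hy hy0).2.1)
      (fun y hy hy0 => volumeDensity_smul g h x₀ (inv_nonneg.2 (hconf y (hT y hy hy0)).1.le)
        (hconf y (hT y hy hy0)).2)
      (fun y hy hy0 => (hball y hy hy0).2.2.2)⟩
  · positivity
  · rcases eq_or_ne n 0 with h0 | h0
    · simp [h0, hε.le]
    · rw [hAκ h0]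
      calc n * (κ * (1 + η) ^ 2) ≤ n * (κ + ε / (n + 1)) := by gcongr
        _ = n * κ + ε * (n / (n + 1)) := by ring
        _ ≤ n * κ + ε * 1 := by
          gcongr
          rw [div_le_one (by positivity)]; linarith
        _ = _ := by ring
  · positivity
  · positivity
  · have h3 := abs_le.1 (hball y hy hy0).2.2.1
    have h7 : s * min η (1 / 2) * y 0 ≤ s * η * y 0 := by gcongr; exact min_le_left _ _
    have h8 : s * min η (1 / 2) * y 0 ≤ s * (1 / 2) * y 0 := by gcongr; exact min_le_right _ _
    constructor
    · linarith [h3.1]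
    · linarith [h3.2]
  · have h3 := abs_le.1 (hball y hy hy0).2.2.1
    have h8 : s * min η (1 / 2) * y 0 ≤ s * (1 / 2) * y 0 := by gcongr; exact min_le_right _ _
    nlinarith [h3.2, mul_pos hs0 hy0]

theorem continuousOn_coordForm_of_isAH {g : FormField n X} {κ : ℝ} (hg : IsAH g κ) (x : X) :
    ContinuousOn (coordForm g x) (interiorTarget n x) := by
  obtain ⟨⟨r, α, gbar, hr, -, -, -, hgh⟩, -⟩ := hg
  have hconf := coordForm_eq_conformal hr hgh x
  have h1 := (contDiffOn_coordForm gbar.contMDiff x).continuousOn.mono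
    (inter_subset_left : interiorTarget n x ⊆ _)
  have h2 := (contDiffOn_definingFunction hr x).continuousOn.mono
    (inter_subset_left : interiorTarget n x ⊆ _)
  refine (((h2.inv₀ fun y hy => (hconf y hy).1.ne').pow 2).smul h1).congr fun y hy => ?_
  exact (hconf y hy).2

end LocalModel

/-! ### Smooth domains in the half space -/

section HalfSpaceDomain

variable {n : ℕ}

/-- The unit vector in the direction normal to the boundary of the half space. -/
noncomputable def normalVec (n : ℕ) : Model n := EuclideanSpace.single 0 1

@[simp] theorem normalVec_zero : normalVec n 0 = 1 := by simp [normalVec]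

/-- The component of `y - b` tangent to the boundary of the half space (where `b 0 = 0`). -/
noncomputable def tangPart (b y : Model n) : Model n := y - b - (y - b) 0 • normalVec n

/-- The Pythagorean theorem for the normal and tangential components. -/
theorem norm_sq_eq (w : Model n) (c : ℝ) :
    ‖c • normalVec n + (w - w 0 • normalVec n)‖ ^ 2 = c ^ 2 + ‖w - w 0 • normalVec n‖ ^ 2 := by
  have h : inner ℝ (normalVec n) (w - w 0 • normalVec n) = 0 := by
    simp [normalVec, EuclideanSpace.inner_single_left]
  have h1 : ‖normalVec n‖ = 1 := by simp [normalVec]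
  rw [norm_add_sq_real, inner_smul_left, h, norm_smul, h1]
  simp

theorem norm_tangPart_le (b y : Model n) : ‖tangPart b y‖ ≤ ‖y - b‖ := by
  have h := norm_sq_eq (y - b) ((y - b) 0)
  rw [add_sub_cancel] at h
  refine le_of_sq_le_sq ?_ (norm_nonneg _)
  rw [h]
  simp only [tangPart]
  nlinarith [sq_nonneg ((y - b) 0)]

/-- The quadratic function of `(log y₀, y')` whose unit sublevel set is `logEllipsoid`. -/
noncomputable def logQuadric (b : Model n) (δ L : ℝ) (y : Model n) : ℝ :=
  ((Real.log (y 0) + 3 * L) / (2 * L)) ^ 2 + (‖tangPart b y‖ / (2 * δ)) ^ 2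

/-- The domain in the half space which is an ellipsoid in the coordinates `(log y₀, y')`, with
`log y₀` ranging over `(-5L, -L)` and `y' - b'` over the ball of radius `2δ`. -/
def logEllipsoid (b : Model n) (δ L : ℝ) : Set (Model n) := {y | 0 < y 0 ∧ logQuadric b δ L y < 1}

/-- The parametrization of `logEllipsoid` by the unit ball. -/
noncomputable def logEllipsoidParam (b : Model n) (δ L : ℝ) (w : Model n) : Model n :=
  b + Real.exp (2 * L * w 0 - 3 * L) • normalVec n + (2 * δ) • (w - w 0 • normalVec n)

variable {b : Model n} {δ L : ℝ}

theorem logEllipsoidParam_zero (hb : b 0 = 0) (w : Model n) :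
    logEllipsoidParam b δ L w 0 = Real.exp (2 * L * w 0 - 3 * L) := by
  simp [logEllipsoidParam, hb]

theorem logQuadric_param (hb : b 0 = 0) (hδ : 0 < δ) (hL : 0 < L) (w : Model n) :
    logQuadric b δ L (logEllipsoidParam b δ L w) = ‖w‖ ^ 2 := by
  have h1 : tangPart b (logEllipsoidParam b δ L w) = (2 * δ) • (w - w 0 • normalVec n) := by
    have h2 : (logEllipsoidParam b δ L w - b) 0 = Real.exp (2 * L * w 0 - 3 * L) := by
      rw [PiLp.sub_apply, logEllipsoidParam_zero hb, hb, sub_zero]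
    rw [tangPart, h2, logEllipsoidParam]
    abel
  have h3 := norm_sq_eq w (w 0)
  rw [add_sub_cancel] at h3
  rw [logQuadric, logEllipsoidParam_zero hb, Real.log_exp, h1, norm_smul, h3,
    Real.norm_of_nonneg (by positivity : 0 ≤ 2 * δ)]
  congr 1
  · congr 1; field_simp; ring
  · congr 1; field_simp

theorem exists_param (hb : b 0 = 0) (hδ : 0 < δ) (hL : 0 < L) {y : Model n} (hy : 0 < y 0) :
    ∃ w, logEllipsoidParam b δ L w = y := by
  refine ⟨((Real.log (y 0) + 3 * L) / (2 * L)) • normalVec n + (2 * δ)⁻¹ • tangPart b y, ?_⟩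
  have h0 : tangPart b y 0 = 0 := by simp [tangPart]
  have hyb : (y - b) 0 = y 0 := by simp [hb]
  have h1 : (((Real.log (y 0) + 3 * L) / (2 * L)) • normalVec n + (2 * δ)⁻¹ • tangPart b y) 0 =
      (Real.log (y 0) + 3 * L) / (2 * L) := by
    simp [h0]
  rw [logEllipsoidParam, h1, add_sub_cancel_left, smul_smul, mul_inv_cancel₀ (by positivity),
    one_smul, show 2 * L * ((Real.log (y 0) + 3 * L) / (2 * L)) - 3 * L = Real.log (y 0) by
      field_simp; ring, Real.exp_log hy, tangPart, hyb]
  abel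

theorem logEllipsoid_eq_image (hb : b 0 = 0) (hδ : 0 < δ) (hL : 0 < L) :
    logEllipsoid b δ L = logEllipsoidParam b δ L '' Metric.ball 0 1 := by
  ext y
  constructor
  · rintro ⟨h0, h1⟩
    obtain ⟨w, rfl⟩ := exists_param hb hδ hL h0
    refine ⟨w, ?_, rfl⟩
    rw [logQuadric_param hb hδ hL] at h1
    rw [mem_ball_zero_iff]
    exact (sq_lt_one_iff₀ (norm_nonneg _)).1 h1
  · rintro ⟨w, hw, rfl⟩
    refine ⟨?_, ?_⟩
    · rw [logEllipsoidParam_zero hb]; exact Real.exp_pos _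
    · rw [logQuadric_param hb hδ hL]
      exact (sq_lt_one_iff₀ (norm_nonneg _)).2 (mem_ball_zero_iff.1 hw)

theorem continuous_logEllipsoidParam : Continuous (logEllipsoidParam b δ L) := by
  unfold logEllipsoidParam; fun_prop

theorem isConnected_logEllipsoid (hb : b 0 = 0) (hδ : 0 < δ) (hL : 0 < L) :
    IsConnected (logEllipsoid b δ L) := by
  rw [logEllipsoid_eq_image hb hδ hL]
  exact ((Metric.isConnected_ball one_pos)).image _ continuous_logEllipsoidParam.continuousOn

/-- The compact set which is the closure of `logEllipsoid`. -/
noncomputable def closedLogEllipsoid (b : Model n) (δ L : ℝ) : Set (Model n) :=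
  logEllipsoidParam b δ L '' Metric.closedBall 0 1

theorem isCompact_closedLogEllipsoid : IsCompact (closedLogEllipsoid b δ L) :=
  (isCompact_closedBall _ _).image continuous_logEllipsoidParam

theorem logEllipsoid_subset_closed (hb : b 0 = 0) (hδ : 0 < δ) (hL : 0 < L) :
    logEllipsoid b δ L ⊆ closedLogEllipsoid b δ L := by
  rw [logEllipsoid_eq_image hb hδ hL]
  exact image_mono Metric.ball_subset_closedBall

theorem closedLogEllipsoid_pos (hb : b 0 = 0) {y : Model n} (hy : y ∈ closedLogEllipsoid b δ L) :
    0 < y 0 := by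
  obtain ⟨w, -, rfl⟩ := hy
  rw [logEllipsoidParam_zero hb]; exact Real.exp_pos _

theorem closedLogEllipsoid_subset_ball (hδ : 0 < δ) (hL : 0 < L) {R : ℝ}
    (hR : Real.exp (-L) + 2 * δ < R) : closedLogEllipsoid b δ L ⊆ Metric.ball b R := by
  rintro _ ⟨w, hw, rfl⟩
  rw [mem_closedBall_zero_iff] at hw
  have hw0 : w 0 ≤ 1 := (le_abs_self _).trans ((PiLp.norm_apply_le w 0).trans hw)
  have h3 := norm_sq_eq w (w 0)
  rw [add_sub_cancel] at h3
  have h4 : ‖w - w 0 • normalVec n‖ ≤ 1 := by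
    refine (sq_le_one_iff₀ (norm_nonneg _)).1 ?_
    have := (sq_le_one_iff₀ (norm_nonneg w)).2 hw
    nlinarith [sq_nonneg (w 0)]
  have h1 : ‖normalVec n‖ = 1 := by simp [normalVec]
  rw [Metric.mem_ball, dist_eq_norm]
  have h5 : logEllipsoidParam b δ L w - b = Real.exp (2 * L * w 0 - 3 * L) • normalVec n +
      (2 * δ) • (w - w 0 • normalVec n) := by rw [logEllipsoidParam]; abel
  rw [h5]
  refine lt_of_le_of_lt (norm_add_le _ _) (lt_of_le_of_lt (add_le_add ?_ ?_) hR)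
  · rw [norm_smul, h1, mul_one, Real.norm_of_nonneg (Real.exp_pos _).le]
    exact Real.exp_le_exp.2 (by nlinarith)
  · rw [norm_smul, Real.norm_of_nonneg (by positivity : 0 ≤ 2 * δ)]
    nlinarith

theorem contDiffAt_logQuadric {y : Model n} (hy : 0 < y 0) :
    ContDiffAt ℝ ∞ (logQuadric b δ L) y := by
  have h0 : ContDiffAt ℝ ∞ (fun y : Model n => y 0) y := by fun_prop
  have h1 : ContDiffAt ℝ ∞ (fun y : Model n => Real.log (y 0)) y := h0.log hy.ne'
  have h2 : ContDiffAt ℝ ∞ (fun y : Model n => ‖tangPart b y‖ ^ 2) y := by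
    refine ContDiffAt.norm_sq ℝ ?_
    unfold tangPart; fun_prop
  have h3 : logQuadric b δ L = fun y => ((Real.log (y 0) + 3 * L) / (2 * L)) ^ 2 +
      ‖tangPart b y‖ ^ 2 / (2 * δ) ^ 2 := by
    ext y; rw [logQuadric, div_pow ‖tangPart b y‖]
  rw [h3]
  exact (((h1.add contDiffAt_const).div_const _).pow 2).add (h2.div_const _)

theorem isOpen_logEllipsoid : IsOpen (logEllipsoid b δ L) := by
  rw [isOpen_iff_mem_nhds]
  rintro y ⟨h0, h1⟩
  have hc : Continuous fun y : Model n => y 0 := by fun_prop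
  exact (hc.continuousAt.eventually (lt_mem_nhds h0)).and
    ((contDiffAt_logQuadric h0).continuousAt.eventually (gt_mem_nhds h1))

/-- The derivative of `logQuadric` along its radial vector field is `2 * logQuadric`, so it vanishes
only at the center. -/
theorem fderiv_logQuadric_ne_zero (hb : b 0 = 0) (hδ : 0 < δ) (hL : 0 < L) {y : Model n}
    (hy : 0 < y 0) (h : 0 < logQuadric b δ L y) : fderiv ℝ (logQuadric b δ L) y ≠ 0 := by
  intro h0
  obtain ⟨w, rfl⟩ := exists_param hb hδ hL hy
  have hd := ((contDiffAt_logQuadric (b := b) (δ := δ) (L := L) hy).differentiableAt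
    (by simp)).hasFDerivAt
  have hp : DifferentiableAt ℝ (fun τ : ℝ => logEllipsoidParam b δ L (τ • w)) 1 := by
    unfold logEllipsoidParam; fun_prop
  have h1 : HasDerivAt (fun τ : ℝ => logQuadric b δ L (logEllipsoidParam b δ L (τ • w)))
      (fderiv ℝ (logQuadric b δ L) (logEllipsoidParam b δ L w)
        (deriv (fun τ : ℝ => logEllipsoidParam b δ L (τ • w)) 1)) 1 := by
    have hd' : HasFDerivAt (logQuadric b δ L)
      (fderiv ℝ (logQuadric b δ L) (logEllipsoidParam b δ L w))
      ((fun τ : ℝ => logEllipsoidParam b δ L (τ • w)) 1) := by simpa using hd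
    exact hd'.comp_hasDerivAt 1 hp.hasDerivAt
  rw [h0] at h1
  have h2 : (fun τ : ℝ => logQuadric b δ L (logEllipsoidParam b δ L (τ • w))) =
      fun τ => τ ^ 2 * ‖w‖ ^ 2 := by
    ext τ
    rw [logQuadric_param hb hδ hL, norm_smul, mul_pow, Real.norm_eq_abs, sq_abs]
  rw [h2] at h1
  have h3 : HasDerivAt (fun τ : ℝ => τ ^ 2 * ‖w‖ ^ 2) (2 * ‖w‖ ^ 2) 1 := by
    simpa using (hasDerivAt_pow 2 (1 : ℝ)).mul_const (‖w‖ ^ 2)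
  have h4 := h1.unique h3
  rw [logQuadric_param hb hδ hL] at h
  simp only [zero_apply] at h4
  linarith

end HalfSpaceDomain

/-! ### Test functions on the half space -/

section BoxIntegral

variable {n : ℕ}

/-- A box in the half space: `y₀` lies in `[α, β]`, and the other coordinates are within `δ` of
those of `b`. -/
def box (b : Model n) (α β δ : ℝ) : Set (Model n) :=
  {y | y 0 ∈ Icc α β ∧ ∀ j : Fin n, y j.succ ∈ Icc (b j.succ - δ) (b j.succ + δ)}

theorem lintegral_inv_Icc {α β : ℝ} (hα : 0 < α) (hαβ : α ≤ β) :
    ∫⁻ s in Icc α β, ENNReal.ofReal s⁻¹ = ENNReal.ofReal (Real.log (β / α)) := by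
  have hc : ContinuousOn (fun s : ℝ => s⁻¹) (Icc α β) :=
    continuousOn_id.inv₀ fun s hs => (hα.trans_le hs.1).ne'
  rw [← integral_inv_of_pos hα (hα.trans_le hαβ), intervalIntegral.integral_of_le hαβ,
    ← integral_Icc_eq_integral_Ioc, ofReal_integral_eq_lintegral_ofReal]
  · exact hc.integrableOn_Icc
  · filter_upwards [ae_restrict_mem measurableSet_Icc] with s hs
    exact inv_nonneg.2 (hα.le.trans hs.1)

theorem isClosed_box (b : Model n) (α β δ : ℝ) : IsClosed (box b α β δ) := by
  have h : box b α β δ = (fun y : Model n => y 0) ⁻¹' Icc α β ∩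
      ⋂ j : Fin n, (fun y : Model n => y j.succ) ⁻¹' Icc (b j.succ - δ) (b j.succ + δ) := by
    ext y; simp [box]
  rw [h]
  refine (isClosed_Icc.preimage (by fun_prop)).inter (isClosed_iInter fun j => ?_)
  exact isClosed_Icc.preimage (by fun_prop)

/-- The measure `y₀⁻¹ dy` of a box. Its dependence on `β / α` only through the logarithm makes
`y₀ ^ (n / p)` the critical power for the hyperbolic volume `y₀⁻⁽ⁿ⁺¹⁾ dy`. -/
theorem lintegral_box (b : Model n) {α β δ : ℝ} (hα : 0 < α) (hαβ : α ≤ β) (hδ : 0 ≤ δ) :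
    ∫⁻ y in box b α β δ, ENNReal.ofReal (y 0)⁻¹ =
      ENNReal.ofReal (Real.log (β / α) * (2 * δ) ^ n) := by
  have e1 := EuclideanSpace.volume_preserving_symm_measurableEquiv_toLp (Fin (n + 1))
  have e2 := volume_preserving_piFinSuccAbove (fun _ : Fin (n + 1) => ℝ) 0
  have e := e2.comp e1
  set Φ := (MeasurableEquiv.toLp 2 (Fin (n + 1) → ℝ)).symm.trans
    (MeasurableEquiv.piFinSuccAbove (fun _ : Fin (n + 1) => ℝ) 0) with hΦ
  have e' : MeasurePreserving Φ volume volume := e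
  have hΦ1 : ∀ y, (Φ y).1 = y 0 := fun y => rfl
  have hΦ2 : ∀ y j, (Φ y).2 j = y j.succ := fun y j => by
    simp [hΦ, MeasurableEquiv.piFinSuccAbove]
    rfl
  set P : Set (Fin n → ℝ) := univ.pi fun j => Icc (b j.succ - δ) (b j.succ + δ)
  have hbox : box b α β δ = Φ ⁻¹' (Icc α β ×ˢ P) := by
    ext y
    rw [mem_preimage, mem_prod, hΦ1, Set.mem_univ_pi]
    simp only [hΦ2]
    rfl
  have h1 : ∫⁻ y in box b α β δ, ENNReal.ofReal (y 0)⁻¹ =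
      ∫⁻ z in Icc α β ×ˢ P, ENNReal.ofReal z.1⁻¹ := by
    rw [hbox, ← e'.setLIntegral_comp_preimage_emb Φ.measurableEmbedding]
    rfl
  have hP : volume P = ENNReal.ofReal ((2 * δ) ^ n) := by
    rw [volume_pi_pi]
    have hw : ∀ j : Fin n, b j.succ + δ - (b j.succ - δ) = 2 * δ := fun j => by ring
    simp only [Real.volume_Icc, hw]
    rw [Finset.prod_const, Finset.card_univ, Fintype.card_fin, ← ENNReal.ofReal_pow]
    · linarith
  rw [h1, Measure.volume_eq_prod, ← Measure.prod_restrict]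
  rw [lintegral_prod _ (by fun_prop)]
  simp only [lintegral_const, Measure.restrict_apply MeasurableSet.univ, univ_inter]
  rw [lintegral_mul_const _ (by fun_prop), lintegral_inv_Icc hα hαβ, hP, ← ENNReal.ofReal_mul]
  exact Real.log_nonneg ((one_le_div hα).2 hαβ)

end BoxIntegral

section TestFunction

variable {n : ℕ} {b : Model n} {δ L : ℝ}

/-- A cutoff function in the variable `log y₀ / L`, supported in `[-4, -2]`. -/
noncomputable def logCutoff : ContDiffBump (-3 : ℝ) := ⟨1 / 2, 1, by norm_num, by norm_num⟩

theorem exists_deriv_logCutoff_le : ∃ K > 0, ∀ s, |deriv logCutoff s| ≤ K := by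
  have h1 : ContDiff ℝ 1 (logCutoff : ℝ → ℝ) := logCutoff.contDiff
  obtain ⟨K, hK⟩ := (h1.continuous_deriv le_rfl).bounded_above_of_compact_support
    logCutoff.hasCompactSupport.deriv
  exact ⟨max K 1, by positivity, fun s => (hK s).trans (le_max_left _ _)⟩

theorem exists_fderiv_bump_le (χ : ContDiffBump b) :
    ∃ K > 0, ∀ y, ‖fderiv ℝ χ y‖ ≤ K := by
  have h1 : ContDiff ℝ 1 (χ : Model n → ℝ) := χ.contDiff
  obtain ⟨K, hK⟩ := (h1.continuous_fderiv one_ne_zero).bounded_above_of_compact_support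
    (χ.hasCompactSupport.fderiv ℝ)
  exact ⟨max K 1, by positivity, fun s => (hK s).trans (le_max_left _ _)⟩

/-- The test function `y₀ ^ a` times cutoff functions in `log y₀` and in `y`. Only its values for
`y₀ > 0` are meaningful. -/
noncomputable def testFun (a L : ℝ) (χ : ContDiffBump b) (y : Model n) : ℝ :=
  y 0 ^ a * logCutoff (Real.log (y 0) / L) * χ y

/-- A compact set which contains the support of the test function. -/
def testCore (b : Model n) (δ L : ℝ) : Set (Model n) :=
  {y | y 0 ∈ Icc (Real.exp (-(4 * L))) (Real.exp (-(2 * L))) ∧ y ∈ Metric.closedBall b δ}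

theorem isCompact_testCore : IsCompact (testCore b δ L) := by
  have h : testCore b δ L = (fun y : Model n => y 0) ⁻¹'
    Icc (Real.exp (-(4 * L))) (Real.exp (-(2 * L))) ∩ Metric.closedBall b δ := rfl
  rw [h]
  exact (isCompact_closedBall b δ).inter_left (isClosed_Icc.preimage (by fun_prop))

theorem testCore_subset (hδ : 0 < δ) (hL : 0 < L) : testCore b δ L ⊆ logEllipsoid b δ L := by
  rintro y ⟨⟨h1, h2⟩, h3⟩
  have h0 : 0 < y 0 := (Real.exp_pos _).trans_le h1
  have h4 := (Real.le_log_iff_exp_le h0).2 h1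
  have h5 := (Real.log_le_iff_le_exp h0).2 h2
  refine ⟨h0, ?_⟩
  rw [mem_closedBall_iff_norm] at h3
  have h6 : ((Real.log (y 0) + 3 * L) / (2 * L)) ^ 2 ≤ (1 / 2) ^ 2 := by
    refine sq_le_sq' ?_ ?_
    · rw [le_div_iff₀ (by positivity)]; linarith
    · rw [div_le_iff₀ (by positivity)]; linarith
  have h7 : (‖tangPart b y‖ / (2 * δ)) ^ 2 ≤ (1 / 2) ^ 2 := by
    refine pow_le_pow_left₀ (by positivity) ?_ 2
    rw [div_le_iff₀ (by positivity)]
    linarith [norm_tangPart_le b y]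
  rw [logQuadric]
  linarith

variable {a : ℝ} {χ : ContDiffBump b}

/-- The radius `χ.rOut` of the support of `χ` is `δ`, and `logCutoff` restricts `log y₀` to
`[-4L, -2L]`. -/
theorem testFun_eq_zero (hχ : χ.rOut = δ) (hL : 0 < L) {y : Model n} (hy : 0 < y 0)
    (hyc : y ∉ testCore b δ L) : testFun a L χ y = 0 := by
  by_contra h
  refine hyc ⟨⟨?_, ?_⟩, ?_⟩
  all_goals
    simp only [testFun, mul_eq_zero, not_or] at h
  · have h1 := h.1.2
    have h2 : Real.log (y 0) / L ∈ Metric.ball (-3 : ℝ) 1 := by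
      have h3 : Function.support logCutoff = Metric.ball (-3 : ℝ) 1 := logCutoff.support_eq
      rw [← h3]; exact h1
    rw [Real.ball_eq_Ioo] at h2
    rw [← Real.le_log_iff_exp_le hy]
    have := (lt_div_iff₀ hL).1 h2.1
    linarith
  · have h1 := h.1.2
    have h2 : Real.log (y 0) / L ∈ Metric.ball (-3 : ℝ) 1 := by
      have h3 : Function.support logCutoff = Metric.ball (-3 : ℝ) 1 := logCutoff.support_eq
      rw [← h3]; exact h1
    rw [Real.ball_eq_Ioo] at h2
    rw [← Real.log_le_iff_le_exp hy]
    have := (div_lt_iff₀ hL).1 h2.2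
    linarith
  · have h2 : y ∈ Metric.ball b χ.rOut := by
      rw [← χ.support_eq]; exact h.2
    rw [hχ] at h2
    exact Metric.ball_subset_closedBall h2

theorem testFun_nonneg {y : Model n} (hy : 0 < y 0) : 0 ≤ testFun a L χ y := by
  have := logCutoff.nonneg' (Real.log (y 0) / L)
  have := χ.nonneg' y
  unfold testFun
  positivity

theorem contDiffAt_testFun {y : Model n} (hy : 0 < y 0) : ContDiffAt ℝ ∞ (testFun a L χ) y := by
  have h0 : ContDiffAt ℝ ∞ (fun y : Model n => y 0) y := by fun_prop
  have h1 : ContDiffAt ℝ ∞ (fun y : Model n => Real.log (y 0) / L) y := (h0.log hy.ne').div_const _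
  exact ((h0.rpow_const_of_ne hy.ne').mul (logCutoff.contDiff.contDiffAt.comp y h1)).mul
    χ.contDiff.contDiffAt

theorem measurable_testFun : Measurable (testFun a L χ) := by
  have h0 : Measurable fun y : Model n => y 0 := (by fun_prop : Continuous _).measurable
  exact ((h0.pow_const a).mul (logCutoff.continuous.measurable.comp
    ((Real.measurable_log.comp h0).div_const L))).mul χ.continuous.measurable

theorem fderiv_testFun {y : Model n} (hy : 0 < y 0) (hL : L ≠ 0) (v : Model n) :
    fderiv ℝ (testFun a L χ) y v =
      y 0 ^ a * (y 0)⁻¹ * (a * logCutoff (Real.log (y 0) / L) +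
        deriv logCutoff (Real.log (y 0) / L) / L) * χ y * v 0 +
      y 0 ^ a * logCutoff (Real.log (y 0) / L) * fderiv ℝ χ y v := by
  have h0 : HasFDerivAt (fun y : Model n => y 0)
      (EuclideanSpace.proj (0 : Fin (n + 1)) : Model n →L[ℝ] ℝ) y :=
    (EuclideanSpace.proj (0 : Fin (n + 1)) : Model n →L[ℝ] ℝ).hasFDerivAt
  have hc : HasDerivAt (logCutoff : ℝ → ℝ) (deriv logCutoff (Real.log (y 0) / L))
      (Real.log (y 0) / L) :=
    ((logCutoff.contDiff (n := 1)).differentiable one_ne_zero).differentiableAt.hasDerivAt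
  have h1 : HasDerivAt (fun s : ℝ => s ^ a * logCutoff (Real.log s / L))
      (a * y 0 ^ (a - 1) * logCutoff (Real.log (y 0) / L) +
        y 0 ^ a * (deriv logCutoff (Real.log (y 0) / L) * ((y 0)⁻¹ / L))) (y 0) :=
    (Real.hasDerivAt_rpow_const (Or.inl hy.ne')).mul
      (HasDerivAt.comp (h₂ := (logCutoff : ℝ → ℝ)) (y 0) hc
        ((Real.hasDerivAt_log hy.ne').div_const L))
  have hχ : HasFDerivAt (χ : Model n → ℝ) (fderiv ℝ χ y) y :=
    (((χ.contDiff (n := 1)).differentiable one_ne_zero).differentiableAt).hasFDerivAt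
  have h2 := (h1.comp_hasFDerivAt y h0).mul hχ
  have h3 : fderiv ℝ (testFun a L χ) y = _ := h2.fderiv
  rw [h3, Real.rpow_sub_one hy.ne']
  simp
  field_simp
  ring

end TestFunction

/-! ### The Rayleigh quotient of the test functions -/

section RayleighQuotient

variable {n : ℕ} {b : Model n} {δ L : ℝ} {χ : ContDiffBump b}
  {G : Model n → Model n →L[ℝ] Model n →L[ℝ] ℝ} {dens : Model n → ℝ} {R k c C : ℝ}

/-- The pointwise bound for the length of the gradient of the test function, in which `η` is the
size of the error term relative to `y₀ ^ a`. -/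
noncomputable def gradBound (a k η δ L : ℝ) (χ : ContDiffBump b) (y : Model n) : ℝ :=
  a * k * testFun a L χ y + (testCore b δ L).indicator (fun y => η * y 0 ^ a) y

/-- The main term `a * k * testFun` comes from the derivative of `y₀ ^ a`. The error term collects
the derivatives of the cutoff functions; both are small for large `L`, the first because the cutoff
in `log y₀` is spread over an interval of length `2L`, the second because vectors of unit length
have Euclidean length at most `C y₀`. -/
theorem abs_fderiv_testFun_le (hG : HalfBallBounds G dens b R k c C) {a K Kχ : ℝ} (ha : 0 ≤ a)
    (hk : 0 ≤ k) (hC : 0 < C) (hL : 0 < L) (hK : ∀ s, |deriv logCutoff s| ≤ K)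
    (hKχ : ∀ y, ‖fderiv ℝ χ y‖ ≤ Kχ) {y : Model n} (hy : y ∈ Metric.ball b R)
    (hyc : y ∈ testCore b δ L) (v : Model n) :
    |fderiv ℝ (testFun a L χ) y v| ≤
      gradBound a k (k * K / L + C * Kχ * Real.exp (-(2 * L))) δ L χ y * √(G y v v) := by
  have h0 : 0 < y 0 := (Real.exp_pos _).trans_le hyc.1.1
  set S := √(G y v v) with hS
  have hS0 : 0 ≤ S := Real.sqrt_nonneg _
  have h1 := hG.coord y hy h0 v
  have h2 := hG.norm y hy h0 v
  set φ := logCutoff (Real.log (y 0) / L) with hφ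
  have hφ0 : 0 ≤ φ := logCutoff.nonneg' _
  have hφ1 : φ ≤ 1 := logCutoff.le_one
  have hχ0 : 0 ≤ χ y := χ.nonneg' _
  have hχ1 : χ y ≤ 1 := χ.le_one
  have hK0 : 0 ≤ K := (abs_nonneg _).trans (hK 0)
  have hKχ0 : 0 ≤ Kχ := (norm_nonneg _).trans (hKχ 0)
  have hpow : 0 < y 0 ^ a := Real.rpow_pos_of_pos h0 a
  rw [fderiv_testFun h0 hL.ne', gradBound, indicator_of_mem hyc]
  have e1 : |a * φ + deriv logCutoff (Real.log (y 0) / L) / L| ≤ a * φ + K / L := by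
    refine (abs_add_le _ _).trans (add_le_add (abs_of_nonneg (by positivity)).le ?_)
    rw [abs_div, abs_of_pos hL]
    gcongr
    exact hK _
  have e2 : |fderiv ℝ χ y v| ≤ Kχ * ‖v‖ :=
    ((fderiv ℝ χ y).le_opNorm v).trans (by gcongr; exact hKχ y)
  have e3 : |y 0 ^ a * (y 0)⁻¹ * (a * φ + deriv logCutoff (Real.log (y 0) / L) / L) * χ y * v 0| ≤
      (a * k * testFun a L χ y + k * K / L * y 0 ^ a) * S := by
    rw [abs_mul, abs_mul, abs_mul, abs_of_nonneg hχ0,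
      abs_of_nonneg (by positivity : 0 ≤ y 0 ^ a * (y 0)⁻¹)]
    calc y 0 ^ a * (y 0)⁻¹ * |a * φ + deriv logCutoff (Real.log (y 0) / L) / L| * χ y * |v 0|
        ≤ y 0 ^ a * (y 0)⁻¹ * (a * φ + K / L) * χ y * (k * y 0 * S) := by gcongr
      _ = (a * k * (y 0 ^ a * φ * χ y) + k * K / L * y 0 ^ a * χ y) * S := by field_simp
      _ ≤ (a * k * (y 0 ^ a * φ * χ y) + k * K / L * y 0 ^ a * 1) * S := by gcongr
      _ = _ := by rw [mul_one]; rfl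
  have e4 : |y 0 ^ a * φ * fderiv ℝ χ y v| ≤ C * Kχ * Real.exp (-(2 * L)) * y 0 ^ a * S := by
    rw [abs_mul, abs_of_nonneg (by positivity : 0 ≤ y 0 ^ a * φ)]
    calc y 0 ^ a * φ * |fderiv ℝ χ y v| ≤ y 0 ^ a * 1 * (Kχ * (C * y 0 * S)) := by
          gcongr
          exact e2.trans (by gcongr)
      _ ≤ y 0 ^ a * 1 * (Kχ * (C * Real.exp (-(2 * L)) * S)) := by gcongr; exact hyc.1.2
      _ = _ := by ring
  calc _ ≤ _ := abs_add_le _ _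
    _ ≤ (a * k * testFun a L χ y + k * K / L * y 0 ^ a) * S +
        C * Kχ * Real.exp (-(2 * L)) * y 0 ^ a * S := add_le_add e3 e4
    _ = _ := by ring

theorem testCore_subset_box : testCore b δ L ⊆
    box b (Real.exp (-(4 * L))) (Real.exp (-(2 * L))) δ := by
  rintro y ⟨h1, h2⟩
  refine ⟨h1, fun j => ?_⟩
  rw [mem_closedBall_iff_norm] at h2
  have := abs_le.1 ((PiLp.norm_apply_le (y - b) j.succ).trans h2)
  simp only [PiLp.sub_apply] at this
  constructor <;> linarith

theorem norm_sub_le_of_mem_box (hb : b 0 = 0) {α β δ' : ℝ} (hα : 0 ≤ α) {y : Model n}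
    (hy : y ∈ box b α β δ') : ‖y - b‖ ≤ β + n * δ' := by
  have h1 : y - b = ∑ i, (y - b) i • EuclideanSpace.single i (1 : ℝ) := by
    ext j; simp [Finset.sum_apply, Pi.single_apply]
  rw [h1]
  refine (norm_sum_le _ _).trans ?_
  have h2 : ∀ i, ‖(y - b) i • (EuclideanSpace.single i (1 : ℝ) : Model n)‖ = |(y - b) i| := by
    intro i; rw [norm_smul]; simp
  simp only [h2]
  rw [Fin.sum_univ_succ]
  refine add_le_add ?_ ?_
  · rw [PiLp.sub_apply, hb, sub_zero, abs_of_nonneg (hα.trans hy.1.1)]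
    exact hy.1.2
  · calc ∑ j : Fin n, |(y - b) j.succ| ≤ ∑ _j : Fin n, δ' := by
          refine Finset.sum_le_sum fun j _ => abs_le.2 ?_
          have := hy.2 j
          simp only [PiLp.sub_apply]
          constructor <;> linarith [this.1, this.2]
      _ = n * δ' := by simp

/-- The `p`-th power of `y₀ ^ (n / p)` times the hyperbolic volume density is `y₀⁻¹`. -/
theorem rpow_mul_dens_cancel {s : ℝ} (hs : 0 < s) {p : ℝ} (hp : 0 < p) :
    (s ^ ((n : ℝ) / p)) ^ p * s⁻¹ ^ (n + 1) = s⁻¹ := by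
  rw [← Real.rpow_mul hs.le, div_mul_cancel₀ _ hp.ne', Real.rpow_natCast, pow_succ, ← mul_assoc,
    ← mul_pow, mul_inv_cancel₀ hs.ne', one_pow, one_mul]

/-- The `L^p` norm of the error term of `gradBound` is controlled by the measure of a box. -/
theorem lintegral_core_le (hG : HalfBallBounds G dens b R k c C) (hC : 0 < C) (hL : 0 < L)
    (hδ : 0 < δ) (hDR : logEllipsoid b δ L ⊆ Metric.ball b R) {p η : ℝ} (hp : 0 < p)
    (hη : 0 ≤ η) :
    ∫⁻ y in logEllipsoid b δ L, ENNReal.ofReal ((testCore b δ L).indicator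
      (fun y => η * y 0 ^ ((n : ℝ) / p)) y ^ p) * ENNReal.ofReal (dens y) ≤
      ENNReal.ofReal (η ^ p * C * (2 * L * (2 * δ) ^ n)) := by
  have hcore : MeasurableSet (testCore b δ L) := isCompact_testCore.isClosed.measurableSet
  have hexp : Real.exp (-(4 * L)) ≤ Real.exp (-(2 * L)) := Real.exp_le_exp.2 (by linarith)
  calc _ ≤ ∫⁻ y in logEllipsoid b δ L, (testCore b δ L).indicator
        (fun y => ENNReal.ofReal (η ^ p * C) * ENNReal.ofReal (y 0)⁻¹) y := by
        refine setLIntegral_mono' isOpen_logEllipsoid.measurableSet fun y hy => ?_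
        by_cases hyc : y ∈ testCore b δ L
        · have h0 : 0 < y 0 := hy.1
          rw [indicator_of_mem hyc, indicator_of_mem hyc, ← ENNReal.ofReal_mul (by positivity),
            ← ENNReal.ofReal_mul (by positivity)]
          refine ENNReal.ofReal_le_ofReal ?_
          have h1 := hG.dens_upper y (hDR hy) h0
          rw [Real.mul_rpow hη (by positivity)]
          calc η ^ p * (y 0 ^ ((n : ℝ) / p)) ^ p * dens y
              ≤ η ^ p * (y 0 ^ ((n : ℝ) / p)) ^ p * (C * (y 0)⁻¹ ^ (n + 1)) := by gcongr
            _ = η ^ p * C * ((y 0 ^ ((n : ℝ) / p)) ^ p * (y 0)⁻¹ ^ (n + 1)) := by ring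
            _ = _ := by rw [rpow_mul_dens_cancel h0 hp]
        · rw [indicator_of_notMem hyc, indicator_of_notMem hyc, Real.zero_rpow hp.ne']
          simp
    _ ≤ ∫⁻ y, (testCore b δ L).indicator
        (fun y => ENNReal.ofReal (η ^ p * C) * ENNReal.ofReal (y 0)⁻¹) y :=
        setLIntegral_le_lintegral _ _
    _ = ∫⁻ y in testCore b δ L, ENNReal.ofReal (η ^ p * C) * ENNReal.ofReal (y 0)⁻¹ :=
        lintegral_indicator hcore _
    _ ≤ ∫⁻ y in box b (Real.exp (-(4 * L))) (Real.exp (-(2 * L))) δ,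
        ENNReal.ofReal (η ^ p * C) * ENNReal.ofReal (y 0)⁻¹ :=
          lintegral_mono_set testCore_subset_box
    _ = _ := by
        rw [lintegral_const_mul' _ _ ENNReal.ofReal_ne_top,
          lintegral_box b (Real.exp_pos _) hexp hδ.le,
          ← ENNReal.ofReal_mul (by positivity), ← Real.exp_sub, Real.log_exp]
        congr 3
        ring

/-- The test function is `y₀ ^ (n / p)` on a box whose measure grows linearly in `L`. -/
theorem le_lintegral_testFun (hG : HalfBallBounds G dens b R k c C) (hc : 0 < c) (hL : 0 < L)
    (hb : b 0 = 0) (hδ : 0 < δ) (hχi : χ.rIn = δ / 2)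
    (hLδ : Real.exp (-L) ≤ δ / 4) (hDR : logEllipsoid b δ L ⊆ Metric.ball b R) {p : ℝ}
    (hp : 0 < p) :
    ENNReal.ofReal (c * (L * (2 * (δ / (4 * (n + 1)))) ^ n)) ≤
    ∫⁻ y in logEllipsoid b δ L, ENNReal.ofReal (|testFun ((n : ℝ) / p) L χ y| ^ p) *
      ENNReal.ofReal (dens y) := by
  set δ' := δ / (4 * (n + 1)) with hδ'
  have hδ'0 : 0 < δ' := by positivity
  set α := Real.exp (-(7 / 2 * L))
  set β := Real.exp (-(5 / 2 * L))
  have hα : 0 < α := Real.exp_pos _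
  have hαβ : α ≤ β := Real.exp_le_exp.2 (by linarith)
  have hβ : β ≤ δ / 4 := le_trans (Real.exp_le_exp.2 (by linarith)) hLδ
  have hnδ : n * δ' ≤ δ / 4 := by
    rw [hδ', mul_div_assoc', div_le_div_iff₀ (by positivity) (by positivity)]
    nlinarith
  have hnorm : ∀ y ∈ box b α β δ', ‖y - b‖ ≤ δ / 2 := fun y hy => by
    have := norm_sub_le_of_mem_box hb hα.le hy
    linarith
  have hlog : ∀ y ∈ box b α β δ',
      -(7 / 2) ≤ Real.log (y 0) / L ∧ Real.log (y 0) / L ≤ -(5 / 2) := by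
    intro y hy
    have h0 : 0 < y 0 := hα.trans_le hy.1.1
    have h1 := (Real.le_log_iff_exp_le h0).2 hy.1.1
    have h2 := (Real.log_le_iff_le_exp h0).2 hy.1.2
    constructor
    · rw [le_div_iff₀ hL]; linarith
    · rw [div_le_iff₀ hL]; linarith
  have hsub : box b α β δ' ⊆ logEllipsoid b δ L := by
    intro y hy
    refine testCore_subset hδ hL ⟨⟨?_, ?_⟩, ?_⟩
    · exact le_trans (Real.exp_le_exp.2 (by linarith)) hy.1.1
    · exact hy.1.2.trans (Real.exp_le_exp.2 (by linarith))
    · rw [mem_closedBall_iff_norm]; linarith [hnorm y hy]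
  have hval : ∀ y ∈ box b α β δ', testFun ((n : ℝ) / p) L χ y = y 0 ^ ((n : ℝ) / p) := by
    intro y hy
    obtain ⟨h1, h2⟩ := hlog y hy
    have e1 : logCutoff (Real.log (y 0) / L) = 1 := by
      refine logCutoff.one_of_mem_closedBall ?_
      have h3 : logCutoff.rIn = 1 / 2 := rfl
      rw [h3, Real.closedBall_eq_Icc]
      constructor <;> linarith
    have e2 : χ y = 1 := by
      refine χ.one_of_mem_closedBall ?_
      rw [hχi, mem_closedBall_iff_norm]
      exact hnorm y hy
    rw [testFun, e1, e2, mul_one, mul_one]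
  calc ENNReal.ofReal (c * (L * (2 * δ') ^ n))
      = ∫⁻ y in box b α β δ', ENNReal.ofReal c * ENNReal.ofReal (y 0)⁻¹ := by
        rw [lintegral_const_mul' _ _ ENNReal.ofReal_ne_top, lintegral_box b hα hαβ hδ'0.le,
          ← ENNReal.ofReal_mul hc.le, ← Real.exp_sub, Real.log_exp]
        congr 3
        ring
    _ ≤ ∫⁻ y in box b α β δ', ENNReal.ofReal (|testFun ((n : ℝ) / p) L χ y| ^ p) *
        ENNReal.ofReal (dens y) := by
        refine setLIntegral_mono' (isClosed_box b α β δ').measurableSet fun y hy => ?_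
        have h0 : 0 < y 0 := hα.trans_le hy.1.1
        rw [hval y hy, abs_of_pos (by positivity), ← ENNReal.ofReal_mul hc.le,
          ← ENNReal.ofReal_mul (by positivity)]
        refine ENNReal.ofReal_le_ofReal ?_
        have h1 := hG.dens_lower y (hDR (hsub hy)) h0
        calc c * (y 0)⁻¹ = (y 0 ^ ((n : ℝ) / p)) ^ p * (c * (y 0)⁻¹ ^ (n + 1)) := by
              rw [mul_left_comm, rpow_mul_dens_cancel h0 hp]
          _ ≤ _ := by gcongr
    _ ≤ _ := lintegral_mono_set hsub

/-- The constant in the comparison of the `L^p` norms of the error term and of the test function,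
which does not depend on the scale `L`. -/
noncomputable def errorConst (n : ℕ) (p c C : ℝ) : ℝ :=
  (C / c * (2 * (4 * (n + 1)) ^ n)) ^ p⁻¹

/-- Minkowski's inequality for the two terms of `gradBound`. Both `y₀ ^ (n / p)` on `testCore` and
the test function have `L^p` norms comparable to `L ^ (1 / p)`, so `η` is the relative size of the
error term. -/
theorem lintegral_gradBound_le (hG : HalfBallBounds G dens b R k c C) (hc : 0 < c) (hC : 0 < C)
    (hk : 0 ≤ k) (hL : 0 < L) (hb : b 0 = 0) (hδ : 0 < δ) (hχi : χ.rIn = δ / 2)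
    (hLδ : Real.exp (-L) ≤ δ / 4) (hDR : logEllipsoid b δ L ⊆ Metric.ball b R)
    (hdens : AEMeasurable dens (volume.restrict (logEllipsoid b δ L))) {p η : ℝ} (hp : 1 < p)
    (hη : 0 ≤ η) :
    ∫⁻ y in logEllipsoid b δ L, ENNReal.ofReal (gradBound ((n : ℝ) / p) k η δ L χ y ^ p) *
      ENNReal.ofReal (dens y) ≤
    ENNReal.ofReal (((n : ℝ) / p * k + η * errorConst n p c C) ^ p) *
      ∫⁻ y in logEllipsoid b δ L, ENNReal.ofReal (|testFun ((n : ℝ) / p) L χ y| ^ p) *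
        ENNReal.ofReal (dens y) := by
  have hp0 : 0 < p := one_pos.trans hp
  set a := (n : ℝ) / p with ha
  have ha0 : 0 ≤ a := by positivity
  set D := logEllipsoid b δ L
  have hD : MeasurableSet D := isOpen_logEllipsoid.measurableSet
  have hcore : MeasurableSet (testCore b δ L) := isCompact_testCore.isClosed.measurableSet
  set I := ∫⁻ y in D, ENNReal.ofReal (|testFun a L χ y| ^ p) * ENNReal.ofReal (dens y) with hI
  set M := errorConst n p c C with hM
  have hM0 : 0 ≤ M := by rw [hM, errorConst]; positivity
  set μ := (volume.restrict D).withDensity fun y => ENNReal.ofReal (dens y) with hμ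
  have hint : ∀ f : Model n → ℝ≥0∞, ∫⁻ y, f y ∂μ = ∫⁻ y in D, f y * ENNReal.ofReal (dens y) := by
    intro f
    rw [hμ, lintegral_withDensity_eq_lintegral_mul_non_measurable₀ _ hdens.ennreal_ofReal
      (Eventually.of_forall fun _ => ENNReal.ofReal_lt_top)]
    simp only [Pi.mul_apply, mul_comm]
  have hmU : Measurable (testFun a L χ) := measurable_testFun
  set E : Model n → ℝ := (testCore b δ L).indicator (fun y => η * y 0 ^ a)
  have hmE : Measurable E := by
    refine Measurable.indicator ?_ hcore
    have h0 : Measurable fun y : Model n => y 0 := (by fun_prop : Continuous _).measurable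
    exact (h0.pow_const a).const_mul η
  have hE0 : ∀ y ∈ D, 0 ≤ E y := fun y hy => by
    have h0 : 0 < y 0 := hy.1
    exact Set.indicator_apply_nonneg fun _ => by positivity
  -- the two terms of `gradBound`
  set f₁ : Model n → ℝ≥0∞ := fun y => ENNReal.ofReal (a * k * testFun a L χ y)
  set f₂ : Model n → ℝ≥0∞ := fun y => ENNReal.ofReal (E y)
  have hf₁ : Measurable f₁ := (hmU.const_mul _).ennreal_ofReal
  have hf₂ : Measurable f₂ := hmE.ennreal_ofReal
  have hmink := ENNReal.lintegral_Lp_add_le (μ := μ) hf₁.aemeasurable hf₂.aemeasurable hp.le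
  have h₁ : ∫⁻ y, f₁ y ^ p ∂μ = ENNReal.ofReal ((a * k) ^ p) * I := by
    rw [hint, hI, ← lintegral_const_mul' _ _ ENNReal.ofReal_ne_top]
    refine setLIntegral_congr_fun hD fun y hy => ?_
    have h0 : 0 < y 0 := hy.1
    have hU := testFun_nonneg (a := a) (L := L) (χ := χ) h0
    simp only [f₁]
    rw [ENNReal.ofReal_rpow_of_nonneg (by positivity) hp0.le, Real.mul_rpow (by positivity) hU,
      ENNReal.ofReal_mul (by positivity), mul_assoc, abs_of_nonneg hU]
  have h₂ : ∫⁻ y, f₂ y ^ p ∂μ ≤ ENNReal.ofReal ((η * M) ^ p) * I := by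
    rw [hint]
    calc _ = ∫⁻ y in D, ENNReal.ofReal (E y ^ p) * ENNReal.ofReal (dens y) := by
          refine setLIntegral_congr_fun hD fun y hy => ?_
          simp only [f₂]
          rw [ENNReal.ofReal_rpow_of_nonneg (hE0 y hy) hp0.le]
      _ ≤ _ := lintegral_core_le hG hC hL hδ hDR hp0 hη
      _ = ENNReal.ofReal ((η * M) ^ p) *
          ENNReal.ofReal (c * (L * (2 * (δ / (4 * (n + 1)))) ^ n)) := by
          rw [← ENNReal.ofReal_mul (by positivity), Real.mul_rpow hη hM0, hM, errorConst,
            ← Real.rpow_mul (by positivity), inv_mul_cancel₀ hp0.ne', Real.rpow_one]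
          congr 1
          have e : 2 * δ = (4 * (n + 1)) * (2 * (δ / (4 * (n + 1)))) := by field_simp
          conv_lhs => rw [e, mul_pow]
          field_simp
      _ ≤ _ := by
          gcongr
          exact le_lintegral_testFun hG hc hL hb hδ hχi hLδ hDR hp0
  have hsum : ∫⁻ y in D, ENNReal.ofReal (gradBound a k η δ L χ y ^ p) * ENNReal.ofReal (dens y) =
      ∫⁻ y, (f₁ + f₂) y ^ p ∂μ := by
    rw [hint]
    refine setLIntegral_congr_fun hD fun y hy => ?_
    have h0 : 0 < y 0 := hy.1
    have hU := testFun_nonneg (a := a) (L := L) (χ := χ) h0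
    have hE := hE0 y hy
    simp only [f₁, f₂, Pi.add_apply]
    rw [← ENNReal.ofReal_add (by positivity) hE,
      ENNReal.ofReal_rpow_of_nonneg (by positivity) hp0.le]
    rfl
  have hroot : ∀ x : ℝ, 0 ≤ x → (ENNReal.ofReal (x ^ p) * I) ^ (1 / p) =
      ENNReal.ofReal x * I ^ (1 / p) := by
    intro x hx
    rw [ENNReal.mul_rpow_of_nonneg _ _ (by positivity), ENNReal.ofReal_rpow_of_nonneg
      (by positivity) (by positivity), ← Real.rpow_mul hx, mul_one_div_cancel hp0.ne',
      Real.rpow_one]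
  rw [hsum]
  have hfin : (∫⁻ y, (f₁ + f₂) y ^ p ∂μ) ^ (1 / p) ≤
      ENNReal.ofReal (a * k + η * M) * I ^ (1 / p) := by
    refine hmink.trans ?_
    rw [ENNReal.ofReal_add (by positivity) (by positivity), add_mul, ← hroot _ (by positivity),
      ← hroot _ (by positivity), h₁]
    gcongr
  have := ENNReal.rpow_le_rpow hfin hp0.le
  rwa [← ENNReal.rpow_mul, one_div_mul_cancel hp0.ne', ENNReal.rpow_one,
    ENNReal.mul_rpow_of_nonneg _ _ hp0.le, ← ENNReal.rpow_mul, one_div_mul_cancel hp0.ne',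
    ENNReal.rpow_one, ENNReal.ofReal_rpow_of_nonneg (by positivity) hp0.le] at this

end RayleighQuotient

/-! ### Functions supported in a chart domain -/

section Transfer

variable {n : ℕ} {X : Type*} [TopologicalSpace X] [ChartedSpace (EuclideanHalfSpace (n + 1)) X]

theorem symm_image_eq (x₀ : X) {D : Set (Model n)} (hD : D ⊆ interiorTarget n x₀) :
    (extChartAt (𝓡∂ (n + 1)) x₀).symm '' D =
      (extChartAt (𝓡∂ (n + 1)) x₀).source ∩ extChartAt (𝓡∂ (n + 1)) x₀ ⁻¹' D :=
  (extChartAt (𝓡∂ (n + 1)) x₀).symm_image_eq_source_inter_preimage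
    (hD.trans inter_subset_left)

theorem isOpen_symm_image (x₀ : X) {D : Set (Model n)} (hD : D ⊆ interiorTarget n x₀)
    (ho : IsOpen D) : IsOpen ((extChartAt (𝓡∂ (n + 1)) x₀).symm '' D) := by
  rw [symm_image_eq x₀ hD]
  exact isOpen_extChartAt_preimage' x₀ ho

theorem isCompact_symm_image (x₀ : X) {K : Set (Model n)} (hK : K ⊆ interiorTarget n x₀)
    (hc : IsCompact K) : IsCompact ((extChartAt (𝓡∂ (n + 1)) x₀).symm '' K) :=
  hc.image_of_continuousOn ((continuousOn_extChartAt_symm x₀).mono (hK.trans inter_subset_left))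

/-- A function given in the chart at `x₀` on the set `D`, extended by zero. -/
noncomputable def chartExtend (x₀ : X) (D : Set (Model n)) (U : Model n → ℝ) : X → ℝ :=
  ((extChartAt (𝓡∂ (n + 1)) x₀).symm '' D).indicator fun x => U (extChartAt (𝓡∂ (n + 1)) x₀ x)

variable {x₀ : X} {D K : Set (Model n)} {U : Model n → ℝ}

theorem chartExtend_eventuallyEq (hD : D ⊆ interiorTarget n x₀) (ho : IsOpen D) {x : X}
    (hx : x ∈ (extChartAt (𝓡∂ (n + 1)) x₀).symm '' D) :
    chartExtend x₀ D U =ᶠ[𝓝 x] fun x => U (extChartAt (𝓡∂ (n + 1)) x₀ x) := by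
  filter_upwards [(isOpen_symm_image x₀ hD ho).mem_nhds hx] with z hz
  exact indicator_of_mem hz _

theorem chartExtend_eq_zero (hD : D ⊆ interiorTarget n x₀) (hU : ∀ y ∈ D, y ∉ K → U y = 0) {x : X}
    (hx : x ∉ (extChartAt (𝓡∂ (n + 1)) x₀).symm '' K) : chartExtend x₀ D U x = 0 := by
  rw [chartExtend, indicator_apply_eq_zero]
  rintro ⟨y, hy, rfl⟩
  rw [(extChartAt (𝓡∂ (n + 1)) x₀).right_inv (hD hy).1]
  exact hU y hy fun h => hx (mem_image_of_mem _ h)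

variable [T2Space X]

theorem chartExtend_eventuallyEq_zero (hD : D ⊆ interiorTarget n x₀) (hK : IsCompact K)
    (hKD : K ⊆ D) (hU : ∀ y ∈ D, y ∉ K → U y = 0) {x : X}
    (hx : x ∉ (extChartAt (𝓡∂ (n + 1)) x₀).symm '' K) : chartExtend x₀ D U =ᶠ[𝓝 x] 0 := by
  have h := (isCompact_symm_image x₀ (hKD.trans hD) hK).isClosed.isOpen_compl
  filter_upwards [h.mem_nhds hx] with z hz
  exact chartExtend_eq_zero hD hU hz

variable [IsManifold (𝓡∂ (n + 1)) ∞ X]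

theorem isTestFunction_chartExtend (hD : D ⊆ interiorTarget n x₀) (ho : IsOpen D)
    (hK : IsCompact K) (hKD : K ⊆ D) (hU : ∀ y ∈ D, y ∉ K → U y = 0)
    (hUs : ∀ y ∈ D, ContDiffAt ℝ ∞ U y) :
    IsTestFunction n ((extChartAt (𝓡∂ (n + 1)) x₀).symm '' D) (chartExtend x₀ D U) := by
  have hKc := isCompact_symm_image x₀ (hKD.trans hD) hK
  have hsupp : tsupport (chartExtend x₀ D U) ⊆ (extChartAt (𝓡∂ (n + 1)) x₀).symm '' K := by
    refine closure_minimal (fun x hx => ?_) hKc.isClosed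
    by_contra h
    exact hx (chartExtend_eq_zero hD hU h)
  refine ⟨fun x => ?_, hKc.of_isClosed_subset (isClosed_tsupport _) hsupp,
    hsupp.trans (image_mono hKD)⟩
  by_cases hx : x ∈ (extChartAt (𝓡∂ (n + 1)) x₀).symm '' D
  · refine ContMDiffAt.congr_of_eventuallyEq ?_ (chartExtend_eventuallyEq hD ho hx)
    obtain ⟨y, hy, rfl⟩ := hx
    have hs : (extChartAt (𝓡∂ (n + 1)) x₀).symm y ∈
        (chartAt (EuclideanHalfSpace (n + 1)) x₀).source := by
      simpa using (extChartAt (𝓡∂ (n + 1)) x₀).map_target (hD hy).1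
    refine ContMDiffAt.comp (g := U) _ ?_ (contMDiffAt_extChartAt' hs)
    rw [(extChartAt (𝓡∂ (n + 1)) x₀).right_inv (hD hy).1]
    exact (hUs y hy).contMDiffAt
  · refine ContMDiffAt.congr_of_eventuallyEq (contMDiffAt_const (c := (0 : ℝ)))
      (chartExtend_eventuallyEq_zero hD hK hKD hU fun h => hx (image_mono hKD h))

omit [T2Space X] [IsManifold (𝓡∂ (n + 1)) ∞ X] in
theorem grad_of_eventuallyEq_zero (g : FormField n X) {u : X → ℝ} {x : X} (h : u =ᶠ[𝓝 x] 0) :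
    grad g u x = 0 := by
  have h1 : mvfderiv (𝓡∂ (n + 1)) u x = 0 := by
    have h2 : mfderiv (𝓡∂ (n + 1)) 𝓘(ℝ, ℝ) u x = 0 := by
      rw [h.mfderiv_eq]; exact mfderiv_const
    exact h2
  rw [grad, h1, map_zero]

/-- The gradient, as a section of the tangent bundle, of a function compactly supported in a chart
domain is continuous. -/
theorem continuous_grad_chartExtend (hD : D ⊆ interiorTarget n x₀) (ho : IsOpen D)
    (hK : IsCompact K) (hKD : K ⊆ D) (hU : ∀ y ∈ D, y ∉ K → U y = 0)
    (hUs : ∀ y ∈ D, ContDiffAt ℝ ∞ U y) {g : FormField n X}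
    (hg : ContinuousOn (coordForm g x₀) D)
    (hpos : ∀ y ∈ D, ∀ v : Model n, v ≠ 0 → 0 < coordForm g x₀ y v v) :
    Continuous fun x : X =>
      (⟨x, grad g (chartExtend x₀ D U) x⟩ : TangentBundle (𝓡∂ (n + 1)) X) := by
  refine continuous_iff_continuousAt.2 fun x => ?_
  by_cases hx : x ∈ (extChartAt (𝓡∂ (n + 1)) x₀).symm '' D
  · let t := trivializationAt (Model n) (TangentSpace (𝓡∂ (n + 1)) : X → Type _) x₀
    -- the gradient in coordinates
    set W : Model n → Model n := fun y => (coordForm g x₀ y).inverse (fderiv ℝ U y) with hW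
    have hWc : ContinuousOn W D := by
      intro y hy
      have hi := (isInvertible_of_pos (hpos y hy)).contDiffAt_map_inverse (n := 0)
      have h1 : ContinuousWithinAt (fun y => (coordForm g x₀ y).inverse) D y :=
        hi.continuousAt.comp_continuousWithinAt (hg y hy)
      have h2 : ContinuousAt (fderiv ℝ U) y :=
        ((hUs y hy).fderiv_right (m := 0) (by simp)).continuousAt
      exact h1.clm_apply h2.continuousWithinAt
    have hkey : ∀ z ∈ (extChartAt (𝓡∂ (n + 1)) x₀).symm '' D,
        (⟨z, grad g (chartExtend x₀ D U) z⟩ : TangentBundle (𝓡∂ (n + 1)) X) =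
          t.toOpenPartialHomeomorph.symm (z, W (extChartAt (𝓡∂ (n + 1)) x₀ z)) := by
      rintro _ ⟨y, hy, rfl⟩
      have hyt := (hD hy).1
      have hs : (extChartAt (𝓡∂ (n + 1)) x₀).symm y ∈
          (chartAt (EuclideanHalfSpace (n + 1)) x₀).source := by
        simpa using (extChartAt (𝓡∂ (n + 1)) x₀).map_target hyt
      have h1 := TangentBundle.symmL_trivializationAt (I := 𝓡∂ (n + 1)) hs
      rw [(extChartAt (𝓡∂ (n + 1)) x₀).right_inv hyt] at h1 ⊢
      have h2 : coordFrame x₀ y (W y) =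
          t.symmL ℝ ((extChartAt (𝓡∂ (n + 1)) x₀).symm y) (W y) :=
        congrArg (fun L : Model n →L[ℝ] Model n => L (W y)) h1.symm
      have hinv := isInvertible_of_pos (hpos y hy)
      have hWy : coordForm g x₀ y (W y) = fderiv ℝ U y := hinv.self_apply_inverse _
      have h3 := grad_eq_coordFrame g x₀ hyt ((hUs y hy).differentiableAt (by simp))
        (chartExtend_eventuallyEq (U := U) hD ho (mem_image_of_mem _ hy)) (hpos y hy) hWy
      have hb : (extChartAt (𝓡∂ (n + 1)) x₀).symm y ∈ t.baseSet := by simpa [t] using hs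
      rw [h3, h2, t.symmL_apply hb]
      exact t.mk_symm hb (W y)
    have hop := isOpen_symm_image x₀ hD ho
    have hc : ContinuousOn (fun z : X => t.toOpenPartialHomeomorph.symm
        (z, W (extChartAt (𝓡∂ (n + 1)) x₀ z))) ((extChartAt (𝓡∂ (n + 1)) x₀).symm '' D) := by
      refine t.toOpenPartialHomeomorph.continuousOn_symm.comp (continuousOn_id.prodMk
        (hWc.comp ((continuousOn_extChartAt x₀).mono ?_) ?_)) ?_
      · rw [symm_image_eq x₀ hD]; exact inter_subset_left
      · rw [symm_image_eq x₀ hD]; exact inter_subset_right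
      · intro z hz
        rw [symm_image_eq x₀ hD] at hz
        have : z ∈ t.baseSet := by simpa [t] using hz.1
        rw [t.target_eq]
        exact ⟨this, mem_univ _⟩
    refine (hc.continuousAt (hop.mem_nhds hx)).congr ?_
    filter_upwards [hop.mem_nhds hx] with z hz
    exact (hkey z hz).symm
  · have hxK : x ∉ (extChartAt (𝓡∂ (n + 1)) x₀).symm '' K := fun h => hx (image_mono hKD h)
    have hz := (Bundle.contMDiff_zeroSection ℝ (TangentSpace (𝓡∂ (n + 1)) : X → Type _)
      (F := Model n) (IB := 𝓡∂ (n + 1)) (n := 0)).continuous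
    refine hz.continuousAt.congr ?_
    filter_upwards [(isCompact_symm_image x₀ (hKD.trans hD) hK).isClosed.isOpen_compl.mem_nhds hxK]
      with z hz
    rw [grad_of_eventuallyEq_zero g (chartExtend_eventuallyEq_zero hD hK hKD hU hz)]
    rfl

end Transfer

section ChartDomain

variable {n : ℕ} {X : Type*} [TopologicalSpace X] [ChartedSpace (EuclideanHalfSpace (n + 1)) X]
  [IsManifold (𝓡∂ (n + 1)) ∞ X] {x₀ : X}

/-- Integration over a part of a chart domain of a function given in the chart. -/
theorem setLIntegral_riemannianVolume_comp_chart [MeasurableSpace X] [BorelSpace X]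
    {g : FormField n X} (hg : ∀ x, ContinuousOn (coordForm g x) (interiorTarget n x))
    {D : Set (Model n)} (hD : D ⊆ interiorTarget n x₀) (ho : IsOpen D)
    {F : Model n → ℝ≥0∞} (hF : Measurable F) :
    ∫⁻ x in (extChartAt (𝓡∂ (n + 1)) x₀).symm '' D, F (extChartAt (𝓡∂ (n + 1)) x₀ x)
        ∂(riemannianVolume g) =
      ∫⁻ y in D, F y * ENNReal.ofReal (volumeDensity g x₀ y) := by
  classical
  have hS := (isOpen_symm_image x₀ hD ho).measurableSet
  set S := (extChartAt (𝓡∂ (n + 1)) x₀).symm '' D with hSdef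
  have hm : Measurable (S.piecewise (extChartAt (𝓡∂ (n + 1)) x₀) fun _ => 0) := by
    refine ContinuousOn.measurable_piecewise ((continuousOn_extChartAt x₀).mono ?_)
      continuousOn_const hS
    rw [hSdef, symm_image_eq x₀ hD]; exact inter_subset_left
  have h1 := setLIntegral_riemannianVolume x₀ hg hD hS (hF.comp hm)
  rw [← hSdef] at h1
  calc _ = ∫⁻ x in S, (F ∘ S.piecewise (extChartAt (𝓡∂ (n + 1)) x₀) fun _ => 0) x
        ∂(riemannianVolume g) := setLIntegral_congr_fun hS fun x hx => by
          simp only [Function.comp_apply, piecewise_eq_of_mem _ _ _ hx]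
    _ = _ := h1
    _ = _ := setLIntegral_congr_fun ho.measurableSet fun y hy => by
          simp only [Function.comp_apply, hSdef,
            piecewise_eq_of_mem _ _ _ (mem_image_of_mem _ hy),
            (extChartAt (𝓡∂ (n + 1)) x₀).right_inv (hD hy).1]

/-- The image of `logEllipsoid` under the inverse of a chart is a bounded domain with smooth
boundary. -/
theorem isBoundedSmoothDomain_logEllipsoid [T2Space X] {b : Model n} {δ L : ℝ} (hb : b 0 = 0)
    (hδ : 0 < δ) (hL : 0 < L) (hD : closedLogEllipsoid b δ L ⊆ interiorTarget n x₀) :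
    IsBoundedSmoothDomain n ((extChartAt (𝓡∂ (n + 1)) x₀).symm '' logEllipsoid b δ L) := by
  have hsub := logEllipsoid_subset_closed (n := n) hb hδ hL
  have hDo := hsub.trans hD
  have hop := isOpen_symm_image x₀ hDo isOpen_logEllipsoid
  have hK := isCompact_symm_image x₀ hD isCompact_closedLogEllipsoid
  have hcl : closure ((extChartAt (𝓡∂ (n + 1)) x₀).symm '' logEllipsoid b δ L) ⊆
      (extChartAt (𝓡∂ (n + 1)) x₀).symm '' closedLogEllipsoid b δ L :=
    closure_minimal (image_mono hsub) hK.isClosed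
  refine ⟨hop, ?_, hK.of_isClosed_subset isClosed_closure hcl, ?_, fun x hx => ?_⟩
  · exact (isConnected_logEllipsoid hb hδ hL).image _
      ((continuousOn_extChartAt_symm x₀).mono (hDo.trans inter_subset_left))
  · refine hcl.trans ?_
    rintro _ ⟨y, hy, rfl⟩
    exact (mem_interior_iff_coord x₀ (hD hy).1).2 (hD hy).2
  · rw [hop.frontier_eq] at hx
    obtain ⟨⟨y, hy, rfl⟩, hy2⟩ : x ∈ _ ∧ _ := ⟨hcl hx.1, hx.2⟩
    obtain ⟨hyt, hy0⟩ := hD hy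
    have hq : 1 ≤ logQuadric b δ L y := by
      by_contra! h
      exact hy2 (mem_image_of_mem _ ⟨hy0, h⟩)
    refine ⟨(extChartAt (𝓡∂ (n + 1)) x₀).symm '' interiorTarget n x₀,
      fun z => logQuadric b δ L (extChartAt (𝓡∂ (n + 1)) x₀ z) - 1,
      isOpen_symm_image x₀ Subset.rfl (isOpen_interiorTarget x₀),
      mem_image_of_mem _ (hD hy), ?_, ?_, ?_⟩
    · rintro _ ⟨z, hz, rfl⟩
      have hs : (extChartAt (𝓡∂ (n + 1)) x₀).symm z ∈
          (chartAt (EuclideanHalfSpace (n + 1)) x₀).source := by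
        simpa using (extChartAt (𝓡∂ (n + 1)) x₀).map_target hz.1
      refine ContMDiffAt.contMDiffWithinAt (ContMDiffAt.comp
        (g := fun y => logQuadric b δ L y - 1) _ ?_ (contMDiffAt_extChartAt' hs))
      rw [(extChartAt (𝓡∂ (n + 1)) x₀).right_inv hz.1]
      exact ((contDiffAt_logQuadric hz.2).sub contDiffAt_const).contMDiffAt
    · intro h
      refine fderiv_logQuadric_ne_zero hb hδ hL hy0 (one_pos.trans_le hq) ?_
      ext w
      have h1 := mvfderiv_coordFrame x₀ hyt
        (((contDiffAt_logQuadric (b := b) (δ := δ) (L := L) hy0).sub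
          (contDiffAt_const (c := (1 : ℝ)))).differentiableAt (by simp))
        (Eventually.of_forall fun _ => rfl) w
      rw [h, fderiv_sub_const] at h1
      exact h1.symm
    · rintro _ ⟨z, hz, rfl⟩
      rw [sub_neg, (extChartAt (𝓡∂ (n + 1)) x₀).right_inv hz.1, symm_image_eq x₀ hDo]
      simp only [mem_inter_iff, mem_preimage, (extChartAt (𝓡∂ (n + 1)) x₀).right_inv hz.1,
        (extChartAt (𝓡∂ (n + 1)) x₀).map_target hz.1, true_and, logEllipsoid]
      exact ⟨fun h => h.2, fun h => ⟨hz.2, h⟩⟩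

/-- A test function is an admissible function in the definition of the first eigenvalue. -/
theorem IsTestFunction.memSobolevZero [MeasurableSpace X] [BorelSpace X] {g : FormField n X}
    {p : ℝ} (hp : 0 < p) {Ω : Set X} {u : X → ℝ} (hu : IsTestFunction n Ω u)
    (hc : Continuous fun x : X => (⟨x, grad g u x⟩ : TangentBundle (𝓡∂ (n + 1)) X)) :
    MemSobolevZero g p Ω u (grad g u) where
  measurable_fun := hu.1.continuous.measurable
  measurable_grad := by
    let : MeasurableSpace (TangentBundle (𝓡∂ (n + 1)) X) := borel _
    have : BorelSpace (TangentBundle (𝓡∂ (n + 1)) X) := ⟨rfl⟩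
    exact hc.measurable
  approx := by
    refine ⟨fun _ => u, fun _ => hu, ?_, ?_⟩
    · simp [Real.zero_rpow hp.ne']
    · have h : ∀ x, formNorm g x (grad g u x - grad g u x) = 0 := fun x => by
        rw [sub_self, formNorm]; simp
      simp only [h, Real.zero_rpow hp.ne']
      simp

/-- The length of the gradient is bounded by any bound for the norm of the differential. -/
theorem formNorm_grad_le (g : FormField n X) {y : Model n}
    (hy : y ∈ (extChartAt (𝓡∂ (n + 1)) x₀).target) {u : X → ℝ} {U : Model n → ℝ}
    (hU : DifferentiableAt ℝ U y)
    (hu : u =ᶠ[𝓝 ((extChartAt (𝓡∂ (n + 1)) x₀).symm y)] fun x => U (extChartAt (𝓡∂ (n + 1)) x₀ x))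
    (hpos : ∀ v : Model n, v ≠ 0 → 0 < coordForm g x₀ y v v) {B : ℝ} (hB : 0 ≤ B)
    (h : ∀ v, |fderiv ℝ U y v| ≤ B * √(coordForm g x₀ y v v)) :
    formNorm g ((extChartAt (𝓡∂ (n + 1)) x₀).symm y)
      (grad g u ((extChartAt (𝓡∂ (n + 1)) x₀).symm y)) ≤ B := by
  set W := (coordForm g x₀ y).inverse (fderiv ℝ U y)
  have hW : coordForm g x₀ y W = fderiv ℝ U y := (isInvertible_of_pos hpos).self_apply_inverse _
  rw [grad_eq_coordFrame g x₀ hy hU hu hpos hW, formNorm_coordFrame]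
  have h1 := h W
  rw [← hW] at h1
  rcases (Real.sqrt_nonneg (coordForm g x₀ y W W)).eq_or_lt with h0 | h0
  · rw [← h0]; exact hB
  · have h2 := Real.sq_sqrt (Real.sqrt_pos.1 h0).le
    have h3 := (le_abs_self _).trans h1
    nlinarith

end ChartDomain

/-! ### The upper bound for the first eigenvalue -/

section Conclusion

variable {n : ℕ} {X : Type*} [TopologicalSpace X] [ChartedSpace (EuclideanHalfSpace (n + 1)) X]
  [IsManifold (𝓡∂ (n + 1)) ∞ X] {x₀ : X}

/-- The first eigenvalue is at most any bound for the Rayleigh quotient of one test function. -/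
theorem firstEigenvalue_le [MeasurableSpace X] {g : FormField n X} {p : ℝ} {Ω : Set X}
    (hΩ : IsBoundedSmoothDomain n Ω) {f : X → ℝ} {V : ∀ x : X, TangentSpace (𝓡∂ (n + 1)) x}
    (hf : MemSobolevZero g p Ω f V) (hp : 0 < p)
    (h0 : ∫⁻ x in Ω, ENNReal.ofReal (|f x| ^ p) ∂(riemannianVolume g) ≠ 0) {A : ℝ≥0∞}
    (hA : ∫⁻ x in Ω, ENNReal.ofReal (formNorm g x (V x) ^ p) ∂(riemannianVolume g) ≤
      A * ∫⁻ x in Ω, ENNReal.ofReal (|f x| ^ p) ∂(riemannianVolume g)) :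
    firstEigenvalue g p ≤ A := by
  have hne : ¬ f =ᵐ[(riemannianVolume g).restrict Ω] 0 := by
    intro h
    refine h0 ((lintegral_congr_ae ?_).trans lintegral_zero)
    filter_upwards [h] with x hx
    rw [hx]
    simp [Real.zero_rpow hp.ne']
  exact (iInf₂_le Ω hΩ).trans ((iInf₂_le f V).trans ((iInf₂_le hf hne).trans
    (ENNReal.div_le_of_le_mul hA)))

/-- The Rayleigh quotient of the test function at scale `L`, transplanted to the manifold by a
chart. -/
theorem firstEigenvalue_le_of_halfBallBounds [T2Space X] [MeasurableSpace X] [BorelSpace X]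
    {g : FormField n X}
    (hg : ∀ x, ContinuousOn (coordForm g x) (interiorTarget n x))
    {b : Model n} (hb : b 0 = 0) {R k c C : ℝ}
    (hG : HalfBallBounds (coordForm g x₀) (volumeDensity g x₀) b R k c C)
    (hR : Metric.ball b R ∩ {y | 0 < y 0} ⊆ interiorTarget n x₀)
    (hk : 0 ≤ k) (hc : 0 < c) (hC : 0 < C) {δ L K Kχ p : ℝ} (hδ : 0 < δ) (hL : 0 < L)
    (hK0 : 0 ≤ K) (hKχ0 : 0 ≤ Kχ) (hp : 1 < p)
    {χ : ContDiffBump b} (hχi : χ.rIn = δ / 2) (hχo : χ.rOut = δ)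
    (hK : ∀ s, |deriv logCutoff s| ≤ K) (hKχ : ∀ y, ‖fderiv ℝ χ y‖ ≤ Kχ)
    (hLδ : Real.exp (-L) ≤ δ / 4) (hδR : Real.exp (-L) + 2 * δ < R) :
    firstEigenvalue g p ≤ ENNReal.ofReal (((n : ℝ) / p * k +
      (k * K / L + C * Kχ * Real.exp (-(2 * L))) * errorConst n p c C) ^ p) := by
  have hp0 : 0 < p := one_pos.trans hp
  set a := (n : ℝ) / p with ha
  have ha0 : 0 ≤ a := by positivity
  set η := k * K / L + C * Kχ * Real.exp (-(2 * L)) with hη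
  have hη0 : 0 ≤ η := by positivity
  set D := logEllipsoid b δ L with hDdef
  have hDo : IsOpen D := isOpen_logEllipsoid
  have hclR := closedLogEllipsoid_subset_ball (b := b) hδ hL hδR
  have hcl : closedLogEllipsoid b δ L ⊆ interiorTarget n x₀ :=
    fun y hy => hR ⟨hclR hy, closedLogEllipsoid_pos hb hy⟩
  have hDcl : D ⊆ closedLogEllipsoid b δ L := logEllipsoid_subset_closed hb hδ hL
  have hDR : D ⊆ Metric.ball b R := hDcl.trans hclR
  have hD := hDcl.trans hcl
  have hgD := (hg x₀).mono hD
  have hpos : ∀ y ∈ D, ∀ v : Model n, v ≠ 0 → 0 < coordForm g x₀ y v v :=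
    fun y hy => hG.pos y (hDR hy) hy.1
  have hcore : testCore b δ L ⊆ D := testCore_subset hδ hL
  have hU0 : ∀ y ∈ D, y ∉ testCore b δ L → testFun a L χ y = 0 :=
    fun y hy hyc => testFun_eq_zero hχo hL hy.1 hyc
  have hUs : ∀ y ∈ D, ContDiffAt ℝ ∞ (testFun a L χ) y := fun y hy => contDiffAt_testFun hy.1
  set u := chartExtend x₀ D (testFun a L χ) with hu
  have htest := isTestFunction_chartExtend hD hDo isCompact_testCore hcore hU0 hUs
  have hcont := continuous_grad_chartExtend hD hDo isCompact_testCore hcore hU0 hUs hgD hpos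
  have hmU : Measurable (testFun a L χ) := measurable_testFun
  have hden : ∫⁻ x in (extChartAt (𝓡∂ (n + 1)) x₀).symm '' D, ENNReal.ofReal (|u x| ^ p)
      ∂(riemannianVolume g) =
      ∫⁻ y in D, ENNReal.ofReal (|testFun a L χ y| ^ p) *
        ENNReal.ofReal (volumeDensity g x₀ y) := by
    rw [← setLIntegral_riemannianVolume_comp_chart hg hD hDo
      (F := fun y => ENNReal.ofReal (|testFun a L χ y| ^ p))
      ((hmU.abs.pow_const p).ennreal_ofReal)]
    refine setLIntegral_congr_fun (isOpen_symm_image x₀ hD hDo).measurableSet fun x hx => ?_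
    simp only [hu, chartExtend, indicator_of_mem hx]
  refine firstEigenvalue_le (isBoundedSmoothDomain_logEllipsoid hb hδ hL hcl)
    (htest.memSobolevZero hp0 hcont) hp0 ?_ ?_
  · rw [hden]
    refine (lt_of_lt_of_le ?_ (le_lintegral_testFun hG hc hL hb hδ hχi hLδ hDR hp0)).ne'
    rw [ENNReal.ofReal_pos]
    positivity
  · have hdens := ((continuousOn_volumeDensity hgD).aemeasurable (μ := volume) hDo.measurableSet)
    rw [hden]
    refine le_trans ?_ (lintegral_gradBound_le hG hc hC hk hL hb hδ hχi hLδ hDR hdens hp hη0)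
    have hmG : Measurable (gradBound a k η δ L χ) := by
      refine (hmU.const_mul _).add (Measurable.indicator ?_
        isCompact_testCore.isClosed.measurableSet)
      have h0 : Measurable fun y : Model n => y 0 := (by fun_prop : Continuous _).measurable
      exact (h0.pow_const a).const_mul η
    rw [← setLIntegral_riemannianVolume_comp_chart hg hD hDo
      (F := fun y => ENNReal.ofReal (gradBound a k η δ L χ y ^ p))
      ((hmG.pow_const p).ennreal_ofReal)]
    refine setLIntegral_mono' (isOpen_symm_image x₀ hD hDo).measurableSet fun x hx => ?_
    have hB : 0 ≤ gradBound a k η δ L χ (extChartAt (𝓡∂ (n + 1)) x₀ x) := by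
      rw [symm_image_eq x₀ hD] at hx
      have h0 : 0 < extChartAt (𝓡∂ (n + 1)) x₀ x 0 := hx.2.1
      have h1 := testFun_nonneg (a := a) (L := L) (χ := χ) h0
      exact add_nonneg (by positivity) (Set.indicator_apply_nonneg fun _ => by positivity)
    refine ENNReal.ofReal_le_ofReal (Real.rpow_le_rpow (Real.sqrt_nonneg _) ?_ hp0.le)
    by_cases hxc : x ∈ (extChartAt (𝓡∂ (n + 1)) x₀).symm '' testCore b δ L
    · obtain ⟨y, hyc, rfl⟩ := hxc
      have hy := hcore hyc
      rw [(extChartAt (𝓡∂ (n + 1)) x₀).right_inv (hD hy).1] at hB ⊢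
      exact formNorm_grad_le g (hD hy).1 ((hUs y hy).differentiableAt (by simp))
        (chartExtend_eventuallyEq hD hDo hx) (hpos y hy) hB
        (abs_fderiv_testFun_le hG ha0 hk hC hL hK hKχ (hDR hy) hyc)
    · rw [grad_of_eventuallyEq_zero g
        (chartExtend_eventuallyEq_zero hD isCompact_testCore hcore hU0 hxc)]
      refine le_trans (le_of_eq ?_) hB
      rw [formNorm]; simp

/-- Letting `L` tend to infinity makes the error term of the Rayleigh quotient disappear. -/
theorem firstEigenvalue_le_add [T2Space X] [MeasurableSpace X] [BorelSpace X]
    {g : FormField n X} {κ : ℝ} (hκ : 0 < κ) (hg : IsAH g κ)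
    (hx₀ : x₀ ∈ (𝓡∂ (n + 1)).boundary X) {p : ℝ} (hp : 1 < p) {ε : ℝ} (hε : 0 < ε) :
    firstEigenvalue g p ≤ ENNReal.ofReal ((n * κ / p + ε) ^ p) := by
  have hp0 : 0 < p := one_pos.trans hp
  obtain ⟨R, k, c, C, hR, hk, hkκ, hc, hC, hsub, hG⟩ :=
    exists_halfBallBounds hκ hg hx₀ (ε := p * (ε / 2)) (by positivity)
  set b := extChartAt (𝓡∂ (n + 1)) x₀ x₀ with hbdef
  have hb : b 0 = 0 := by
    rw [← mem_boundary_iff_coord x₀ (mem_extChartAt_target x₀), extChartAt_to_inv]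
    exact hx₀
  let χ : ContDiffBump b := ⟨R / 8 / 2, R / 8, by positivity, by linarith⟩
  obtain ⟨K, hK0, hK⟩ := exists_deriv_logCutoff_le
  obtain ⟨Kχ, hKχ0, hKχ⟩ := exists_fderiv_bump_le χ
  have h2L : Tendsto (fun L : ℝ => 2 * L) atTop atTop := tendsto_id.const_mul_atTop two_pos
  have herr : Tendsto (fun L : ℝ => (k * K / L + C * Kχ * Real.exp (-(2 * L))) *
      errorConst n p c C) atTop (𝓝 0) := by
    have h1 := (tendsto_const_nhds (x := k * K)).div_atTop (tendsto_id (α := ℝ) (x := atTop))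
    have h2 := (Real.tendsto_exp_neg_atTop_nhds_zero.comp h2L).const_mul (C * Kχ)
    simpa using (h1.add h2).mul_const (errorConst n p c C)
  obtain ⟨L, hL, hexp, hη⟩ := ((eventually_gt_atTop (0 : ℝ)).and
    ((Real.tendsto_exp_neg_atTop_nhds_zero.eventually_lt_const
      (by positivity : 0 < R / 8 / 4)).and
    (herr.eventually_lt_const (half_pos hε)))).exists
  refine (firstEigenvalue_le_of_halfBallBounds (continuousOn_coordForm_of_isAH hg) hb hG hsub hk hc
    hC (δ := R / 8) (by positivity) hL hK0.le hKχ0.le hp (χ := χ) rfl rfl hK hKχ hexp.le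
    (by linarith)).trans ?_
  refine ENNReal.ofReal_le_ofReal (Real.rpow_le_rpow ?_ ?_ hp0.le)
  · rw [errorConst]; positivity
  · have h1 : (n : ℝ) / p * k ≤ n * κ / p + ε / 2 := by
      rw [div_mul_eq_mul_div, div_le_iff₀ hp0, add_mul, div_mul_cancel₀ _ hp0.ne']
      linarith
    linarith

end Conclusion

end AsympHyp

theorem mainTheorem10 (n : ℕ) (X : Type*) [TopologicalSpace X] [T2Space X] [CompactSpace X]
    [ChartedSpace (EuclideanHalfSpace (n + 1)) X] [IsManifold (𝓡∂ (n + 1)) ∞ X]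
    [MeasurableSpace X] [BorelSpace X]
    (hX : ((𝓡∂ (n + 1)).boundary X).Nonempty)
    (g : AsympHyp.FormField n X) (κ : ℝ) (hκ : 0 < κ) (hg : AsympHyp.IsAH g κ)
    (p : ℝ) (hp : 1 < p) :
    AsympHyp.firstEigenvalue g p ≤ ENNReal.ofReal ((n * κ / p) ^ p) := by
  obtain ⟨x₀, hx₀⟩ := hX
  have hp0 : 0 < p := one_pos.trans hp
  have hlim : Tendsto (fun ε : ℝ => ENNReal.ofReal ((n * κ / p + ε) ^ p)) (𝓝[>] 0)
      (𝓝 (ENNReal.ofReal ((n * κ / p) ^ p))) := by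
    have h1 : ContinuousAt (fun ε : ℝ => ENNReal.ofReal ((n * κ / p + ε) ^ p)) 0 :=
      ENNReal.continuous_ofReal.continuousAt.comp
        ((continuousAt_const.add continuousAt_id).rpow_const (Or.inr hp0.le))
    simpa using h1.tendsto.mono_left nhdsWithin_le_nhds
  refine ge_of_tendsto hlim ?_
  filter_upwards [self_mem_nhdsWithin] with ε hε
  exact AsympHyp.firstEigenvalue_le_add hκ hg hx₀ hp hε
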